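/- Fix absolute constants $a,b,K>0$. For a symmetric matrix $Z$, let $\Pi_{\ge\tau}(Z)$ be the orthogonal projection onto the span of the eigenvectors of $Z$ with eigenvalue at least $\tau$. For $X=(X_1,\dots,X_n)\in(\mathbb R^d)^n$ and $\rho,\beta,\kappa>0$ define the following randomized algorithms. * $\mathrm{NaivePCE}_{\rho,\beta,\kappa}(X)$: let $S=\{i:\|X_i\|_2^2\le a\,d\kappa\log(n/\beta)\}$ and $\sigma=b\,\frac{d\kappa\log(n/\beta)}{n\rho^{1/2}}$; draw a symmetric $d\times d$ matrix $N$ with $N_{ij}\sim\mathcal N(0,\sigma^2)$ i.i.d. for $i\le j$; return the projection of $\frac1n\sum_{i\in S}X_iX_i^\top+N$ onto the cone of positive semidefinite matrices. * $\mathrm{WeakPPC}_{\rho,\beta,\kappa}(X)$: let $Z\leftarrow\mathrm{NaivePCE}_{\rho,\beta,\kappa}(X)$ and $\Pi=\Pi_{\ge\kappa/2}(Z)$; return $K^{-1/2}\,\Pi+(\mathbb I-\Pi)$. * $\mathrm{PPC}_{\rho,\beta,\kappa}(X)$: let $T=\max\{0,\lceil\log_{10/7}(\kappa/1000)\rceil\}$,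 the least $T\ge 0$ with $0.7^T\kappa\le1000$; put $X^{(1)}=X$, $\kappa^{(1)}=\kappa$; for $t=1,\dots,T$ let $A^{(t)}\leftarrow1.1\cdot\mathrm{WeakPPC}_{\rho/T,\beta/T,\kappa^{(t)}}(X^{(t)})$, $\kappa^{(t+1)}=0.7\,\kappa^{(t)}$ and $X^{(t+1)}_i=A^{(t)}X^{(t)}_i$; return $A=A^{(T)}\cdots A^{(1)}$ (so $A=\mathbb I$ if $T=0$). * $\mathrm{PGCE}_{\rho,\beta,\kappa}(X)$: let $A\leftarrow\mathrm{PPC}_{\rho/2,\beta/2,\kappa}(X)$ and $\widetilde\Sigma\leftarrow\mathrm{NaivePCE}_{\rho/2,\beta/2,1000}(AX_1,\dots,AX_n)$; return $\widehat\Sigma=A^{-1}\widetilde\Sigma (A^{-1})^\top$. A randomized algorithm $M$ on datasets of size $n$ is $\rho$-zCDP if $D_\lambda(M(X)\,\|\,M(X'))\le\rho\lambda$ for all $\lambda>1$ and all $X,X'$ differing in at most one entry, where $D_\lambda(P\|Q)=\frac1{\lambda-1}\log\int(dP/dQ)^\lambda\,dQ$ is the Rényi divergence ($=\infty$ if $P\not\ll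 Q$). Write $\|M\|_\Sigma=\|\Sigma^{-1/2}M\Sigma^{-1/2}\|_F$ and, for $k\in\mathbb N$, $L_k(x)=(1+\log(1+x))^k$. **Theorem.** The constants $a,b,K>0$ can be chosen such that the following hold. 1. For all $d,n$ and all $\rho,\beta,\kappa>0$, $\mathrm{PGCE}_{\rho,\beta,\kappa}$ is $\rho$-zCDP. 2. There are absolute constants $C>0$ and $k\in\mathbb N$ such that for all $d,n$, all $\rho,\beta,\kappa>0$ and all $0<\alpha\le1$: if $$n\ \ge\ C\left(\frac{d^2+\log(1/\beta)}{\alpha^2}+\frac{d^2\,L_k\!\left(\frac{d}{\alpha\beta\rho}\right)}{\alpha\rho^{1/2}}+\frac{d^{3/2}\log^{1/2}(\kappa)\,L_k\!\left(\frac{d\log\kappa}{\min\{\rho,1\}\,\beta}\right)}{\rho^{1/2}}\right)$$ and $X_1,\dots,X_n$ are i.i.d. samples from $\mathcal N(0,\Sigma)$ with $\mathbb I\preceq\Sigma\preceq\kappa\mathbb I$, then with probability at least $1-C\beta$ (over the samples and the algorithm) $\mathrm{PGCE}_{\rho,\beta,\kappa}(X)$ outputs $\widehat\Sigma$ with $\|\Sigma-\widehat\Sigma\|_\Sigma\le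 C\alpha$. -/

import Mathlib

open MeasureTheory ProbabilityTheory Matrix
open scoped ENNReal MatrixOrder

noncomputable section

namespace PrivateGaussian

/-! ### Concentrated differential privacy -/

/-- The Rényi divergence of order `a`,
`D_a(P ‖ Q) = 1 / (a - 1) * log ∫ (dP/dQ) ^ a dQ`, equal to `⊤` when `P` is not absolutely
continuous with respect to `Q`. -/
def renyiDiv {Ω : Type*} [MeasurableSpace Ω] (a : ℝ) (P Q : Measure Ω) : EReal :=
  open Classical in
  if P ≪ Q then
    ((1 / (a - 1) : ℝ) : EReal) * ENNReal.log (∫⁻ x, (P.rnDeriv Q x) ^ a ∂Q)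
  else ⊤

/-- Two datasets are neighboring if they differ in at most one entry. -/
def Neighboring {n : ℕ} {𝒳 : Type*} (X X' : Fin n → 𝒳) : Prop :=
  {i | X i ≠ X' i}.Subsingleton

/-- `M` assigns to each dataset the law of the output. It is `ρ`-zCDP if these are probability laws
and `D_a(M X ‖ M X') ≤ ρ a` for all neighboring `X`, `X'` and all `a ∈ (1, ∞)`. -/
def IsZCDP {n : ℕ} {𝒳 𝒴 : Type*} [MeasurableSpace 𝒴] (ρ : ℝ)
    (M : (Fin n → 𝒳) → Measure 𝒴) : Prop :=
  (∀ X, IsProbabilityMeasure (M X)) ∧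
    ∀ X X', Neighboring X X' → ∀ a : ℝ, 1 < a →
      renyiDiv a (M X) (M X') ≤ ((ρ * a : ℝ) : EReal)

/-! ### Vectors and matrices -/

/-- `ℝ^d` with the Euclidean norm. -/
abbrev Vec (d : ℕ) : Type := EuclideanSpace ℝ (Fin d)

/-- Real `d × d` matrices. -/
abbrev Mat (d : ℕ) : Type := Matrix (Fin d) (Fin d) ℝ

/-- The Borel (= product) σ-algebra on matrices. -/
instance instMeasurableSpaceMat (d : ℕ) : MeasurableSpace (Mat d) :=
  inferInstanceAs (MeasurableSpace (Fin d → Fin d → ℝ))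

/-- The Frobenius norm. -/
def frobNorm {d : ℕ} (M : Mat d) : ℝ := √(∑ i, ∑ j, M i j ^ 2)

/-- `‖M‖_S = ‖S^{-1/2} M S^{-1/2}‖_F`, for positive definite `S`. -/
def relNorm {d : ℕ} (S M : Mat d) : ℝ :=
  frobNorm ((CFC.sqrt S)⁻¹ * M * (CFC.sqrt S)⁻¹)

/-- The projection of a symmetric matrix onto the cone of PSD matrices: eigenvectors are kept and
negative eigenvalues are replaced by zero. -/
def psdProj {d : ℕ} (M : Mat d) : Mat d := cfc (fun x : ℝ => max x 0) M

/-- For symmetric `Z`: the orthogonal projection onto the span of the eigenvectors of `Z`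
whose eigenvalue is at least `τ`. -/
def spectralProj {d : ℕ} (τ : ℝ) (Z : Mat d) : Mat d :=
  cfc (fun x : ℝ => if τ ≤ x then (1 : ℝ) else 0) Z

/-- Apply the matrix `A` to every sample. -/
def applyAll {n d : ℕ} (A : Mat d) (X : Fin n → Vec d) : Fin n → Vec d :=
  fun i => WithLp.toLp 2 (A *ᵥ (X i).ofLp)

/-- The law of the symmetric `d × d` matrix whose entries `M i j`, `i ≤ j`, are
independent `N(0, v)`. -/
def gue (d : ℕ) (v : NNReal) : Measure (Mat d) :=
  (Measure.pi fun _ : Fin d × Fin d => gaussianReal 0 v).map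
    fun g => Matrix.of fun i j => g (min i j, max i j)

/-! ### The algorithms

Each algorithm is given by the law of its output on a dataset. The numbers `a`, `b`, `K` are the
absolute constants that the pseudo-code leaves open. -/

/-- The empirical second moment matrix of the samples with squared norm at most `r`
(normalized by the number `n` of all samples). -/
def truncCov {n d : ℕ} (r : ℝ) (X : Fin n → Vec d) : Mat d :=
  (1 / (n : ℝ)) • ∑ i with ‖X i‖ ^ 2 ≤ r, vecMulVec (X i).ofLp (X i).ofLp

/-- NaivePCE: truncate at squared norm `a d κ log (n / β)`, add symmetric Gaussian noise of
standard deviation `σ = b d κ log (n / β) / (n ρ^{1/2})` to the empirical second moment matrix, and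
project onto the PSD cone. -/
def naivePCE (a b ρ β κ : ℝ) {n d : ℕ} (X : Fin n → Vec d) : Measure (Mat d) :=
  let r : ℝ := a * (d * κ * Real.log (n / β))
  let σ : ℝ := b * (d * κ * Real.log (n / β) / (n * √ρ))
  (gue d (Real.toNNReal (σ ^ 2))).map fun N => psdProj (truncCov r X + N)

/-- WeakPPC: output `A = K^{-1/2} Π_V + Π_{V^⊥}`, where `V` is the span of the eigenvectors of the
NaivePCE estimate with eigenvalue at least `κ / 2`. -/
def weakPPC (a b K ρ β κ : ℝ) {n d : ℕ} (X : Fin n → Vec d) : Measure (Mat d) :=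
  (naivePCE a b ρ β κ X).map fun Z =>
    (1 / √K) • spectralProj (κ / 2) Z + (1 - spectralProj (κ / 2) Z)

/-- `t` rounds of recursive preconditioning from the bound `κ` and the samples `X`; the output is
the product `A⁽ᵗ⁾ ⋯ A⁽¹⁾` of the matrices applied to the samples. -/
def ppcRounds (a b K ρ β : ℝ) {n d : ℕ} : ℕ → ℝ → (Fin n → Vec d) → Measure (Mat d)
  | 0, _, _ => Measure.dirac 1
  | t + 1, κ, X =>
      (weakPPC a b K ρ β κ X).bind fun A' =>
        let A₁ : Mat d := (11 / 10 : ℝ) • A'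
        (ppcRounds a b K ρ β t (7 / 10 * κ) (applyAll A₁ X)).map fun B => B * A₁

/-- The number `T = O(log κ)` of rounds: the least `T` with `0.7 ^ T * κ ≤ 1000`. -/
def numRounds (κ : ℝ) : ℕ := ⌈Real.log (κ / 1000) / Real.log (10 / 7)⌉₊

/-- PPC, the private preconditioner. -/
def ppc (a b K ρ β κ : ℝ) {n d : ℕ} (X : Fin n → Vec d) : Measure (Mat d) :=
  ppcRounds a b K (ρ / numRounds κ) (β / numRounds κ) (numRounds κ) κ X

/-- PGCE: precondition the samples by the output `A` of PPC, run NaivePCE with condition number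
bound `1000` on them, and undo the preconditioning. -/
def pgce (a b K ρ β κ : ℝ) {n d : ℕ} (X : Fin n → Vec d) : Measure (Mat d) :=
  (ppc a b K (ρ / 2) (β / 2) κ X).bind fun A =>
    (naivePCE a b (ρ / 2) (β / 2) 1000 (applyAll A X)).map fun S => A⁻¹ * S * (A⁻¹)ᵀ

/-! ### The sample complexity -/

/-- The polylogarithmic factor `(1 + log (1 + x)) ^ k`. -/
def polylogFactor (k : ℕ) (x : ℝ) : ℝ := (1 + Real.log (1 + x)) ^ k

/-- The sample complexity of PGCE, up to a constant factor, with polylogarithmic factors of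
degree `k`. -/
def sampleBound (k : ℕ) (d : ℕ) (α β ρ κ : ℝ) : ℝ :=
  (d ^ 2 + Real.log (1 / β)) / α ^ 2
    + d ^ 2 * polylogFactor k (d / (α * β * ρ)) / (α * √ρ)
    + (d : ℝ) ^ (3 / 2 : ℝ) * √(Real.log κ)
        * polylogFactor k (d * Real.log κ / (min ρ 1 * β)) / √ρ

end PrivateGaussian

end

/-! Privacy. A Rényi bound is carried in its dual form `HolderBound`: integrals against P are at
most exp((a-1)c) times the L^q(Q) norm, with q = a/(a-1). In this form post-processing is a change
of variables and adaptive composition is the inequality used twice (`HolderBound.map`,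
`HolderBound.bind`), so densities of kernels never appear. Each call of NaivePCE is a Gaussian
mechanism: truncation bounds the Frobenius sensitivity by 2r/n, and b ≥ 2a makes the noise large
enough (`holderBound_naivePCE`). The T rounds spend ρ/2 in total and the final estimate spends the
other ρ/2.

Accuracy. Write the samples as Σ^{1/2} g_i with g_i standard normal. Every preconditioned dataset is
then B g with B = A Σ^{1/2}, and if nothing is truncated its second moment matrix is B (1 + W) Bᵀ
with the same W = `empDev g` each time. Hence a single event, `Typical` (no long g_i, small ‖W‖_F),
serves all rounds, although they reuse the samples adaptively.

The invariant is 1 ≤ B Bᵀ ≤ κ. A round shrinks the directions in which the noisy estimate exceeds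
κ/2; the other directions are already bounded by about κ/2, and the factor 1.1 restores the lower
bound, so κ drops to 0.7 κ (`Sandwich.round`). This needs noise of operator norm at most κ/1000.
Noise and tolerance both scale with κ, so κ enters the sample size only through T; the operator
norm, controlled in d and not d² dimensions, leads to the power d^{3/2}. Once the bound is at most
1000, the Frobenius error of NaivePCE is pulled back by B⁻¹, which is a contraction (`relNorm_le`).

The concentration bounds replace nets by a volume argument (`measure_le_of_ball_witness`): a bad
outcome is witnessed by a whole ball of directions, and Tonelli turns this into a union bound.
Finally n occurs inside its own logarithm; `sq_add_log_le` resolves this. -/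

namespace PrivateGaussian

/-! ### Rényi divergence in dual form: post-processing and composition. -/

section Divergence

variable {Ω Ω' : Type*} [MeasurableSpace Ω] [MeasurableSpace Ω']

/-- The dual form of a bound on the Rényi divergence of order `a`: integrals against `P` are
controlled by `L^q` norms with respect to `Q`, where `q` is the exponent conjugate to `a`. -/
def HolderBound (a c : ℝ) (P Q : Measure Ω) : Prop :=
  ∀ h : Ω → ℝ≥0∞, Measurable h →
    ∫⁻ x, h x ∂P ≤ ENNReal.ofReal (Real.exp ((a - 1) * c)) *
      (∫⁻ x, h x ^ (a / (a - 1)) ∂Q) ^ ((a - 1) / a)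

theorem HolderBound.absolutelyContinuous {a c : ℝ} {P Q : Measure Ω} (ha : 1 < a)
    (h : HolderBound a c P Q) : P ≪ Q := by
  have h1 : 0 < a - 1 := by linarith
  have h0 : 0 < a := by linarith
  refine Measure.AbsolutelyContinuous.mk fun s hs hQ => ?_
  have := h (s.indicator 1) (measurable_one.indicator hs)
  have e : ∀ x, (s.indicator (1 : Ω → ℝ≥0∞) x) ^ (a / (a - 1)) = s.indicator 1 x := by
    intro x
    by_cases hx : x ∈ s
    · simp [hx]
    · simp [hx, div_pos h0 h1]
  simp only [e, lintegral_indicator_one hs, hQ] at this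
  rw [ENNReal.zero_rpow_of_pos (div_pos h1 h0), mul_zero] at this
  simpa using this

/-- Testing against f^(a-1), f the density, gives I ≤ E I^((a-1)/a) for I = ∫ f^a dQ, hence I^(1/a)
≤ E. The division requires I finite, so f is first cut off at n; monotone convergence removes the
cutoff. -/
theorem HolderBound.lintegral_rnDeriv_rpow_le {a c : ℝ} {P Q : Measure Ω} [IsProbabilityMeasure P]
    [IsProbabilityMeasure Q] (ha : 1 < a) (h : HolderBound a c P Q) :
    ∫⁻ x, (P.rnDeriv Q x) ^ a ∂Q ≤ ENNReal.ofReal (Real.exp (a * ((a - 1) * c))) := by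
  have h1 : 0 < a - 1 := by linarith
  have h0 : 0 < a := by linarith
  have hac := h.absolutelyContinuous ha
  set f := P.rnDeriv Q with hf
  have fm : Measurable f := Measure.measurable_rnDeriv P Q
  set E := ENNReal.ofReal (Real.exp ((a - 1) * c)) with hE
  have key : ∀ n : ℕ, ∫⁻ x, (min (f x) n) ^ a ∂Q ≤ E ^ a := by
    intro n
    have gm : Measurable fun x => min (f x) (n : ℝ≥0∞) := fm.min measurable_const
    set I := ∫⁻ x, (min (f x) n) ^ a ∂Q with hI
    have hfin : I ≠ ⊤ := by
      refine ne_top_of_le_ne_top (b := ∫⁻ _, (n : ℝ≥0∞) ^ a ∂Q) ?_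
        (lintegral_mono fun x => ENNReal.rpow_le_rpow (min_le_right _ _) h0.le)
      simp [ENNReal.rpow_eq_top_iff, h0.not_gt]
    have hb := h (fun x => (min (f x) n) ^ (a - 1)) (gm.pow_const _)
    have e1 : ∀ x, ((min (f x) (n : ℝ≥0∞)) ^ (a - 1)) ^ (a / (a - 1)) = (min (f x) n) ^ a := by
      intro x
      rw [← ENNReal.rpow_mul, mul_div_cancel₀ _ h1.ne']
    simp only [e1] at hb
    have hlow : I ≤ ∫⁻ x, (min (f x) n) ^ (a - 1) ∂P := by
      rw [← lintegral_rnDeriv_mul hac (gm.pow_const _).aemeasurable]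
      refine lintegral_mono fun x => ?_
      calc (min (f x) (n : ℝ≥0∞)) ^ a = (min (f x) n) ^ (1 + (a - 1)) := by ring_nf
        _ = (min (f x) n) * (min (f x) n) ^ (a - 1) := by
            rw [ENNReal.rpow_add_of_nonneg _ _ zero_le_one h1.le, ENNReal.rpow_one]
        _ ≤ _ := by gcongr; exact min_le_left _ _
    have hb2 : I ≤ E * I ^ ((a - 1) / a) := hlow.trans hb
    by_cases hz : I = 0
    · rw [hz]; exact zero_le
    have h3 : I ^ (1 / a) ≤ E := by
      have h4 : I = I ^ (1 / a) * I ^ ((a - 1) / a) := by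
        rw [← ENNReal.rpow_add _ _ hz hfin, ← add_div]
        simp [h0.ne']
      rw [h4] at hb2
      have hz' : I ^ ((a - 1) / a) ≠ 0 := by
        simp [ENNReal.rpow_eq_zero_iff, hz, hfin]
      have hf' : I ^ ((a - 1) / a) ≠ ⊤ := by
        simp [ENNReal.rpow_eq_top_iff, hz, hfin]
      rw [← h4] at hb2
      nth_rw 1 [h4] at hb2
      exact (ENNReal.mul_le_mul_iff_left hz' hf').1 hb2
    calc I = (I ^ (1 / a)) ^ a := by
          rw [← ENNReal.rpow_mul, one_div_mul_cancel h0.ne', ENNReal.rpow_one]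
      _ ≤ E ^ a := ENNReal.rpow_le_rpow h3 h0.le
  have hEa : E ^ a = ENNReal.ofReal (Real.exp (a * ((a - 1) * c))) := by
    rw [hE, ENNReal.ofReal_rpow_of_pos (Real.exp_pos _), ← Real.exp_mul, mul_comm a]
  rw [← hEa]
  have hsup : ∀ x, f x ^ a = ⨆ n : ℕ, (min (f x) n) ^ a := by
    intro x
    have : f x = ⨆ n : ℕ, min (f x) (n : ℝ≥0∞) := by
      rw [← inf_iSup_eq, ENNReal.iSup_natCast]; simp
    have hm := (ENNReal.orderIsoRpow a h0).map_iSup fun n : ℕ => min (f x) (n : ℝ≥0∞)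
    rw [← this] at hm
    simpa only [ENNReal.orderIsoRpow_apply] using hm
  simp_rw [hsup]
  rw [lintegral_iSup]
  · exact iSup_le key
  · exact fun n => (fm.min measurable_const).pow_const _
  · intro m n hmn x
    exact ENNReal.rpow_le_rpow (min_le_min_left _ (by exact_mod_cast hmn)) h0.le

theorem HolderBound.renyiDiv_le {a c : ℝ} {P Q : Measure Ω} [IsProbabilityMeasure P]
    [IsProbabilityMeasure Q] (ha : 1 < a) (h : HolderBound a c P Q) :
    renyiDiv a P Q ≤ ((c * a : ℝ) : EReal) := by
  have h1 : 0 < a - 1 := by linarith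
  rw [renyiDiv, if_pos (h.absolutelyContinuous ha)]
  calc _ ≤ ((1 / (a - 1) : ℝ) : EReal) * ((a * ((a - 1) * c) : ℝ) : EReal) := by
        refine mul_le_mul_of_nonneg_left ?_ (by exact_mod_cast (one_div_pos.2 h1).le)
        refine (ENNReal.log_monotone (h.lintegral_rnDeriv_rpow_le ha)).trans ?_
        rw [ENNReal.log_ofReal_of_pos (Real.exp_pos _), Real.log_exp]
    _ = _ := by
        rw [← EReal.coe_mul]
        congr 1
        field_simp

theorem HolderBound.map {a c : ℝ} {P Q : Measure Ω} (h : HolderBound a c P Q) {g : Ω → Ω'}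
    (hg : Measurable g) : HolderBound a c (P.map g) (Q.map g) := by
  intro u hu
  rw [lintegral_map hu hg, lintegral_map (hu.pow_const _) hg]
  exact h _ (hu.comp hg)

/-- The inner bound, applied for each x, leaves the integral over P of a power (a-1)/a. The outer
bound raises it to the reciprocal power a/(a-1), so the exponents cancel and the constants add. -/
theorem HolderBound.bind {a c₁ c₂ : ℝ} (ha : 1 < a) {P Q : Measure Ω} (h : HolderBound a c₁ P Q)
    {κ η : Ω → Measure Ω'} (hκ : Measurable κ) (hη : Measurable η)
    (hκη : ∀ x, HolderBound a c₂ (κ x) (η x)) :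
    HolderBound a (c₁ + c₂) (P.bind κ) (Q.bind η) := by
  intro u hu
  have h1 : 0 < a - 1 := by linarith
  have h0 : 0 < a := by linarith
  rw [Measure.lintegral_bind hκ.aemeasurable hu.aemeasurable,
    Measure.lintegral_bind hη.aemeasurable (hu.pow_const _).aemeasurable]
  have m1 : Measurable fun x => ∫⁻ y, u y ^ (a / (a - 1)) ∂(η x) :=
    (Measure.measurable_lintegral (hu.pow_const _)).comp hη
  calc ∫⁻ x, ∫⁻ y, u y ∂(κ x) ∂P
      ≤ ∫⁻ x, ENNReal.ofReal (Real.exp ((a - 1) * c₂)) *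
          (∫⁻ y, u y ^ (a / (a - 1)) ∂(η x)) ^ ((a - 1) / a) ∂P :=
        lintegral_mono fun x => hκη x u hu
    _ = ENNReal.ofReal (Real.exp ((a - 1) * c₂)) *
          ∫⁻ x, (∫⁻ y, u y ^ (a / (a - 1)) ∂(η x)) ^ ((a - 1) / a) ∂P :=
        lintegral_const_mul _ (m1.pow_const _)
    _ ≤ ENNReal.ofReal (Real.exp ((a - 1) * c₂)) *
          (ENNReal.ofReal (Real.exp ((a - 1) * c₁)) *
          (∫⁻ x, ((∫⁻ y, u y ^ (a / (a - 1)) ∂(η x)) ^ ((a - 1) / a)) ^ (a / (a - 1)) ∂Q)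
            ^ ((a - 1) / a)) := by
        gcongr
        exact h _ (m1.pow_const _)
    _ = _ := by
        have e : ∀ x : ℝ≥0∞, (x ^ ((a - 1) / a)) ^ (a / (a - 1)) = x := by
          intro x
          rw [← ENNReal.rpow_mul, div_mul_div_cancel₀' h1.ne', div_self h0.ne', ENNReal.rpow_one]
        simp only [e]
        rw [← mul_assoc, ← ENNReal.ofReal_mul (Real.exp_pos _).le, ← Real.exp_add]
        ring_nf

/-- Hölder's inequality: the entry point from explicit densities to the dual form. -/
theorem HolderBound.of_withDensity {a c : ℝ} (ha : 1 < a) {P Q : Measure Ω} {f : Ω → ℝ≥0∞}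
    (hf : Measurable f) (hP : P = Q.withDensity f)
    (hb : ∫⁻ x, f x ^ a ∂Q ≤ ENNReal.ofReal (Real.exp (a * ((a - 1) * c)))) :
    HolderBound a c P Q := by
  intro u hu
  have h0 : 0 < a := by linarith
  have hc : a.HolderConjugate (a / (a - 1)) := Real.HolderConjugate.conjExponent ha
  rw [hP, lintegral_withDensity_eq_lintegral_mul _ hf hu]
  refine (ENNReal.lintegral_mul_le_Lp_mul_Lq Q hc hf.aemeasurable hu.aemeasurable).trans ?_
  rw [one_div_div]
  gcongr
  calc (∫⁻ x, f x ^ a ∂Q) ^ (1 / a)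
      ≤ (ENNReal.ofReal (Real.exp (a * ((a - 1) * c)))) ^ (1 / a) :=
        ENNReal.rpow_le_rpow hb (by positivity)
    _ = _ := by
        rw [ENNReal.ofReal_rpow_of_pos (Real.exp_pos _), ← Real.exp_mul]
        congr 2
        field_simp

theorem HolderBound.refl {a c : ℝ} (ha : 1 < a) (hc : 0 ≤ c) (P : Measure Ω)
    [IsProbabilityMeasure P] : HolderBound a c P P := by
  refine HolderBound.of_withDensity ha (f := 1) measurable_one (by simp) ?_
  simp only [Pi.one_apply, ENNReal.one_rpow, lintegral_one, measure_univ]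
  rw [← ENNReal.ofReal_one]
  exact ENNReal.ofReal_le_ofReal (Real.one_le_exp (by
    have : 0 < a - 1 := by linarith
    positivity))

theorem HolderBound.mono {a c c' : ℝ} (ha : 1 < a) (hc : c ≤ c') {P Q : Measure Ω}
    (h : HolderBound a c P Q) : HolderBound a c' P Q := by
  intro u hu
  refine (h u hu).trans ?_
  have : 0 ≤ a - 1 := by linarith
  gcongr

end Divergence

/-! ### Product measures and the divergence of shifted Gaussians. -/

section Product

variable {ι : Type*} [Fintype ι]

theorem lintegral_pi_prod {Ω : ι → Type*} [∀ i, MeasurableSpace (Ω i)] (μ : ∀ i, Measure (Ω i))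
    [∀ i, IsProbabilityMeasure (μ i)] {f : ∀ i, Ω i → ℝ≥0∞} (hf : ∀ i, Measurable (f i)) :
    ∫⁻ x, ∏ i, f i (x i) ∂Measure.pi μ = ∏ i, ∫⁻ y, f i y ∂μ i := by
  have hind : iIndepFun (fun i (x : ∀ i, Ω i) => f i (x i)) (Measure.pi μ) :=
    iIndepFun_pi fun i => (hf i).aemeasurable
  have := lintegral_prod_eq_prod_lintegral_of_indepFun Finset.univ
    (fun i (x : ∀ i, Ω i) => f i (x i)) hind fun i => (hf i).comp (measurable_pi_apply i)
  rw [this]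
  refine Finset.prod_congr rfl fun i _ => ?_
  rw [← lintegral_map (hf i) (measurable_pi_apply i),
    (measurePreserving_eval μ i).map_eq]

theorem pi_withDensity {Ω : ι → Type*} [∀ i, MeasurableSpace (Ω i)] (μ ν : ∀ i, Measure (Ω i))
    [∀ i, IsProbabilityMeasure (μ i)] [∀ i, IsProbabilityMeasure (ν i)]
    {f : ∀ i, Ω i → ℝ≥0∞} (hf : ∀ i, Measurable (f i)) (h : ∀ i, μ i = (ν i).withDensity (f i)) :
    Measure.pi μ = (Measure.pi ν).withDensity fun x => ∏ i, f i (x i) := by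
  refine Measure.pi_eq fun s hs => ?_
  rw [withDensity_apply _ (MeasurableSet.univ_pi hs), ← lintegral_indicator (.univ_pi hs)]
  have : ∀ x : ∀ i, Ω i, (Set.univ.pi s).indicator (fun x => ∏ i, f i (x i)) x =
      ∏ i, (s i).indicator (f i) (x i) := by
    intro x
    by_cases hx : x ∈ Set.univ.pi s
    · rw [Set.indicator_of_mem hx]
      refine Finset.prod_congr rfl fun i _ => ?_
      rw [Set.indicator_of_mem (hx i trivial)]
    · rw [Set.indicator_of_notMem hx]
      simp only [Set.mem_pi, Set.mem_univ, true_implies, not_forall] at hx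
      obtain ⟨i, hi⟩ := hx
      exact (Finset.prod_eq_zero (Finset.mem_univ i) (Set.indicator_of_notMem hi _)).symm
  simp_rw [this]
  rw [lintegral_pi_prod ν fun i => (hf i).indicator (hs i)]
  refine Finset.prod_congr rfl fun i _ => ?_
  rw [lintegral_indicator (hs i), h i, withDensity_apply _ (hs i)]

theorem lintegral_exp_mul_gaussianReal (m : ℝ) (v : NNReal) (t : ℝ) :
    ∫⁻ x, ENNReal.ofReal (Real.exp (t * x)) ∂gaussianReal m v =
      ENNReal.ofReal (Real.exp (m * t + v * t ^ 2 / 2)) := by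
  rw [← ofReal_integral_eq_lintegral_ofReal (integrable_exp_mul_gaussianReal t)
    (Filter.Eventually.of_forall fun x => (Real.exp_pos _).le)]
  congr 1
  have := congrFun (mgf_fun_id_gaussianReal (μ := m) (v := v)) t
  simpa [mgf] using this

/-- The density of `N(m, v)` with respect to `N(m', v)`. -/
noncomputable def gaussianRatio (m m' : ℝ) (v : NNReal) (x : ℝ) : ℝ :=
  Real.exp ((m - m') / v * x + (m' ^ 2 - m ^ 2) / (2 * v))

theorem gaussianReal_eq_withDensity (m m' : ℝ) {v : NNReal} (hv : v ≠ 0) :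
    gaussianReal m v =
      (gaussianReal m' v).withDensity fun x => ENNReal.ofReal (gaussianRatio m m' v x) := by
  have hv' : (v : ℝ) ≠ 0 := by exact_mod_cast hv
  have hm : Measurable fun x => ENNReal.ofReal (gaussianRatio m m' v x) := by
    unfold gaussianRatio; fun_prop
  rw [gaussianReal_of_var_ne_zero m hv, gaussianReal_of_var_ne_zero m' hv,
    ← withDensity_mul _ (measurable_gaussianPDF _ _) hm]
  congr 1
  funext x
  simp only [gaussianPDF, gaussianPDFReal, Pi.mul_apply, gaussianRatio]
  rw [← ENNReal.ofReal_mul (by positivity), mul_assoc _ (Real.exp _), ← Real.exp_add]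
  congr 3
  field_simp
  ring

theorem lintegral_gaussianRatio_rpow (m m' : ℝ) {v : NNReal} (hv : v ≠ 0) {a : ℝ} (ha : 0 < a) :
    ∫⁻ x, ENNReal.ofReal (gaussianRatio m m' v x) ^ a ∂gaussianReal m' v =
      ENNReal.ofReal (Real.exp (a * (a - 1) * (m - m') ^ 2 / (2 * v))) := by
  have hv' : (v : ℝ) ≠ 0 := by exact_mod_cast hv
  have e : ∀ x, ENNReal.ofReal (gaussianRatio m m' v x) ^ a =
      ENNReal.ofReal (Real.exp (a * (m' ^ 2 - m ^ 2) / (2 * v))) *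
        ENNReal.ofReal (Real.exp (a * (m - m') / v * x)) := by
    intro x
    rw [gaussianRatio, ENNReal.ofReal_rpow_of_pos (Real.exp_pos _), ← Real.exp_mul,
      ← ENNReal.ofReal_mul (Real.exp_pos _).le, ← Real.exp_add]
    congr 2
    field_simp
    ring
  simp_rw [e]
  rw [lintegral_const_mul _ (by fun_prop), lintegral_exp_mul_gaussianReal,
    ← ENNReal.ofReal_mul (Real.exp_pos _).le, ← Real.exp_add]
  congr 2
  field_simp
  ring

/-- The density ratio factorizes over coordinates, and each contributes exp(a(a-1)(m_i -
m'_i)²/(2v)) to its a-th moment, so only the squared distance of the means matters. -/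
theorem holderBound_pi_gaussianReal {a c : ℝ} (ha : 1 < a) (m m' : ι → ℝ) {v : NNReal}
    (hv : v ≠ 0) (hc : ∑ i, (m i - m' i) ^ 2 ≤ 2 * v * c) :
    HolderBound a c (Measure.pi fun i => gaussianReal (m i) v)
      (Measure.pi fun i => gaussianReal (m' i) v) := by
  have h1 : 0 < a - 1 := by linarith
  have h0 : 0 < a := by linarith
  have hv' : 0 < (v : ℝ) := by positivity
  have hm : ∀ i, Measurable fun x => ENNReal.ofReal (gaussianRatio (m i) (m' i) v x) := by
    intro i; unfold gaussianRatio; fun_prop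
  have hP := pi_withDensity (fun i => gaussianReal (m i) v) (fun i => gaussianReal (m' i) v) hm
    fun i => gaussianReal_eq_withDensity _ _ hv
  have hM : Measurable fun x : ι → ℝ => ∏ i, ENNReal.ofReal (gaussianRatio (m i) (m' i) v (x i)) :=
    Finset.measurable_prod _ fun i _ => (hm i).comp (measurable_pi_apply i)
  refine HolderBound.of_withDensity ha hM hP ?_
  simp_rw [← ENNReal.prod_rpow_of_nonneg h0.le]
  rw [lintegral_pi_prod (fun i => gaussianReal (m' i) v) fun i => (hm i).pow_const a]
  simp_rw [lintegral_gaussianRatio_rpow _ _ hv h0]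
  rw [← ENNReal.ofReal_prod_of_nonneg fun i _ => (Real.exp_pos _).le, ← Real.exp_sum]
  refine ENNReal.ofReal_le_ofReal (Real.exp_le_exp.2 ?_)
  rw [← Finset.sum_div, ← Finset.mul_sum, div_le_iff₀ (by positivity)]
  calc _ ≤ a * (a - 1) * (2 * v * c) := by gcongr
    _ = _ := by ring

end Product

/-! ### Measurability of matrix operations and of the functional calculus. -/

section Measurability

variable {d : ℕ}

instance instBorelSpaceMat (d : ℕ) : BorelSpace (Mat d) :=
  inferInstanceAs (BorelSpace (Fin d → Fin d → ℝ))

instance instSecondCountableMat (d : ℕ) : SecondCountableTopology (Mat d) :=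
  inferInstanceAs (SecondCountableTopology (Fin d → Fin d → ℝ))

theorem measurable_mat_iff {Ω : Type*} [MeasurableSpace Ω] {F : Ω → Mat d} :
    Measurable F ↔ ∀ i j, Measurable fun x => F x i j := by
  constructor
  · intro h i j
    exact ((measurable_pi_apply j).comp ((measurable_pi_apply i).comp h))
  · intro h
    exact measurable_pi_lambda _ fun i => measurable_pi_lambda _ fun j => h i j

theorem measurable_mat_mul {Ω : Type*} [MeasurableSpace Ω] {F G : Ω → Mat d} (hF : Measurable F)
    (hG : Measurable G) : Measurable fun x => F x * G x :=
  (continuous_fst.matrix_mul continuous_snd).measurable.comp (hF.prodMk hG)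

theorem measurable_mat_add {Ω : Type*} [MeasurableSpace Ω] {F G : Ω → Mat d} (hF : Measurable F)
    (hG : Measurable G) : Measurable fun x => F x + G x :=
  (continuous_fst.add continuous_snd).measurable.comp (hF.prodMk hG)

theorem measurable_mat_const_smul {Ω : Type*} [MeasurableSpace Ω] {F : Ω → Mat d} (c : ℝ)
    (hF : Measurable F) : Measurable fun x => c • F x :=
  (continuous_id.const_smul c).measurable.comp hF

theorem measurable_mat_inv : Measurable fun M : Mat d => M⁻¹ := by
  rw [measurable_mat_iff]
  intro i j
  simp only [Matrix.inv_def, Matrix.smul_apply, smul_eq_mul, Ring.inverse_eq_inv']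
  exact (continuous_id.matrix_det.measurable.inv).mul
    (continuous_id.matrix_adjugate.matrix_elem i j).measurable

theorem measurable_mat_transpose : Measurable fun M : Mat d => Mᵀ :=
  continuous_id.matrix_transpose.measurable

/-- The diagonalization of M does not depend on the function applied, so pointwise convergence at
the eigenvalues is enough. Off the self-adjoint matrices `cfc` is constantly zero. -/
theorem tendsto_cfc {f : ℝ → ℝ} {F : ℕ → ℝ → ℝ}
    (h : ∀ x, Filter.Tendsto (fun n => F n x) Filter.atTop (nhds (f x))) (M : Mat d) :
    Filter.Tendsto (fun n => cfc (F n) M) Filter.atTop (nhds (cfc f M)) := by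
  by_cases hM : IsSelfAdjoint M
  · have hM' : M.IsHermitian := hM
    simp_rw [hM'.cfc_eq, Matrix.IsHermitian.cfc, Unitary.conjStarAlgAut_apply]
    have hd : Filter.Tendsto (fun n => diagonal (RCLike.ofReal ∘ F n ∘ hM'.eigenvalues))
        Filter.atTop (nhds (diagonal (RCLike.ofReal ∘ f ∘ hM'.eigenvalues) : Mat d)) := by
      refine ((continuous_id.matrix_diagonal).tendsto _).comp (tendsto_pi_nhds.2 fun i => ?_)
      exact h _
    exact (hd.const_mul _).mul_const _
  · simp_rw [cfc_apply_of_not_predicate (R := ℝ) M hM]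
    exact tendsto_const_nhds

theorem measurable_cfc_of_tendsto {f : ℝ → ℝ} {F : ℕ → ℝ → ℝ}
    (hF : ∀ n, Measurable fun M : Mat d => cfc (F n) M)
    (h : ∀ x, Filter.Tendsto (fun n => F n x) Filter.atTop (nhds (f x))) :
    Measurable fun M : Mat d => cfc f M :=
  measurable_of_tendsto_metrizable hF (tendsto_pi_nhds.2 fun M => tendsto_cfc h M)

theorem isClosed_isSelfAdjoint : IsClosed {M : Mat d | IsSelfAdjoint M} :=
  isClosed_eq continuous_star continuous_id

theorem measurable_cfc_polynomial (p : Polynomial ℝ) :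
    Measurable fun M : Mat d => cfc (fun x => p.eval x) M := by
  classical
  have : (fun M : Mat d => cfc (fun x => p.eval x) M) =
      {M : Mat d | IsSelfAdjoint M}.piecewise (fun M => Polynomial.aeval M p) 0 := by
    funext M
    by_cases hM : IsSelfAdjoint M
    · rw [Set.piecewise_eq_of_mem _ _ _ (show M ∈ {M : Mat d | IsSelfAdjoint M} from hM)]
      exact cfc_polynomial p M hM
    · rw [Set.piecewise_eq_of_notMem _ _ _ (show M ∉ {M : Mat d | IsSelfAdjoint M} from hM)]
      exact cfc_apply_of_not_predicate (R := ℝ) M hM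
  rw [this]
  exact Measurable.piecewise isClosed_isSelfAdjoint.measurableSet
    p.continuous_aeval.measurable measurable_const

theorem measurable_cfc_of_continuous {f : ℝ → ℝ} (hf : Continuous f) :
    Measurable fun M : Mat d => cfc f M := by
  -- Weierstrass on growing intervals: each fixed x lies in all but finitely many of them, which
  -- gives pointwise convergence on the whole line.
  have : ∀ n : ℕ, ∃ p : Polynomial ℝ, ∀ x ∈ Set.Icc (-(n : ℝ)) n,
      |p.eval x - f x| < 1 / ((n : ℝ) + 1) := fun n =>
    exists_polynomial_near_of_continuousOn _ _ f hf.continuousOn _ (by positivity)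
  choose p hp using this
  refine measurable_cfc_of_tendsto (fun n => measurable_cfc_polynomial (p n)) fun x => ?_
  rw [tendsto_iff_dist_tendsto_zero]
  refine squeeze_zero' (Filter.Eventually.of_forall fun _ => dist_nonneg) ?_
    tendsto_one_div_add_atTop_nhds_zero_nat
  filter_upwards [Filter.eventually_ge_atTop ⌈|x|⌉₊] with n hn
  rw [Real.dist_eq]
  exact (hp n x (abs_le.1 (Nat.ceil_le.1 hn))).le

theorem measurable_psdProj : Measurable (psdProj : Mat d → Mat d) :=
  measurable_cfc_of_continuous (by fun_prop)

theorem measurable_spectralProj (τ : ℝ) : Measurable (spectralProj τ : Mat d → Mat d) := by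
  -- The indicator is discontinuous; these ramps equal 1 on [τ, ∞), including τ itself, and vanish
  -- eventually at each point below τ.
  refine measurable_cfc_of_tendsto (F := fun n x => max 0 (min 1 (1 + n * (x - τ))))
    (fun n => measurable_cfc_of_continuous (by fun_prop)) fun x => ?_
  by_cases hx : τ ≤ x
  · have : ∀ n : ℕ, max 0 (min 1 (1 + n * (x - τ))) = 1 := fun n => by
      have : (0 : ℝ) ≤ n * (x - τ) := mul_nonneg (Nat.cast_nonneg _) (by linarith)
      rw [min_eq_left (by linarith), max_eq_right zero_le_one]
    simp [this, hx]
  · simp only [hx, if_false]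
    refine tendsto_const_nhds.congr' ?_
    filter_upwards [Filter.eventually_ge_atTop ⌈1 / (τ - x)⌉₊] with n hn
    have h1 : 0 < τ - x := by linarith
    have h2 := Nat.ceil_le.1 hn
    rw [div_le_iff₀ h1] at h2
    rw [max_eq_left]
    exact min_le_of_right_le (by linarith)

end Measurability

/-! ### Measurability of the algorithms as kernels. -/

section Kernels

variable {Ω Ω' Ω'' : Type*} [MeasurableSpace Ω] [MeasurableSpace Ω'] [MeasurableSpace Ω'']

/-- The continuation η also depends on x, because later stages read the dataset again; hence joint
measurability is assumed. -/
theorem measurable_bind_of_prod {κ : Ω → Measure Ω'} (hκ : Measurable κ)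
    [∀ x, IsProbabilityMeasure (κ x)] {η : Ω → Ω' → Measure Ω''}
    (hη : Measurable (Function.uncurry η)) : Measurable fun x => (κ x).bind (η x) := by
  refine Measure.measurable_of_measurable_coe _ fun s hs => ?_
  have hx : ∀ x, Measurable (η x) := fun x => hη.comp measurable_prodMk_left
  simp_rw [Measure.bind_apply hs (hx _).aemeasurable]
  let k : Kernel Ω Ω' := ⟨κ, hκ⟩
  have : IsMarkovKernel k := ⟨fun x => inferInstanceAs (IsProbabilityMeasure (κ x))⟩
  exact Measurable.lintegral_kernel_prod_right (κ := k) ((Measure.measurable_coe hs).comp hη)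

theorem measurable_map_of_prod {κ : Ω → Measure Ω'} (hκ : Measurable κ)
    [∀ x, IsProbabilityMeasure (κ x)] {F : Ω → Ω' → Ω''} (hF : Measurable (Function.uncurry F)) :
    Measurable fun x => (κ x).map (F x) := by
  have hx : ∀ x, Measurable (F x) := fun x => hF.comp measurable_prodMk_left
  simp_rw [← Measure.bind_dirac_eq_map _ (hx _)]
  exact measurable_bind_of_prod hκ (Measure.measurable_dirac.comp hF)

theorem isProbabilityMeasure_bind' {μ : Measure Ω} [IsProbabilityMeasure μ] {κ : Ω → Measure Ω'}
    (hκ : Measurable κ) [∀ x, IsProbabilityMeasure (κ x)] : IsProbabilityMeasure (μ.bind κ) := by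
  constructor
  rw [Measure.bind_apply .univ hκ.aemeasurable]
  simp

variable {n d : ℕ}

theorem measurable_truncCov (r : ℝ) : Measurable (truncCov r : (Fin n → Vec d) → Mat d) := by
  unfold truncCov
  refine measurable_mat_const_smul _ ?_
  rw [measurable_mat_iff]
  intro i j
  simp only [Matrix.sum_apply, Finset.sum_filter, vecMulVec_apply]
  refine Finset.measurable_sum _ fun k _ => Measurable.ite ?_ (by fun_prop) measurable_const
  exact measurableSet_le (by fun_prop) measurable_const

theorem measurable_applyAll {Ω : Type*} [MeasurableSpace Ω] {A : Ω → Mat d}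
    {X : Ω → Fin n → Vec d} (hA : Measurable A) (hX : Measurable X) :
    Measurable fun x => applyAll (A x) (X x) := by
  refine measurable_pi_lambda _ fun i => ?_
  unfold applyAll
  refine (PiLp.continuous_toLp 2 _).measurable.comp (measurable_pi_lambda _ fun j => ?_)
  simp only [mulVec, dotProduct]
  have := measurable_mat_iff.1 hA
  refine Finset.measurable_sum _ fun k _ => (this j k).mul ?_
  have h1 : Measurable fun x => X x i := (measurable_pi_apply i).comp hX
  fun_prop

/-- The symmetric matrix with the upper triangular entries of `g`. -/
def symMat (d : ℕ) (g : Fin d × Fin d → ℝ) : Mat d := Matrix.of fun i j => g (min i j, max i j)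

theorem measurable_symMat : Measurable (symMat d) := by
  rw [measurable_mat_iff]
  intro i j
  exact measurable_pi_apply _

theorem gue_eq (v : NNReal) :
    gue d v = (Measure.pi fun _ : Fin d × Fin d => gaussianReal 0 v).map (symMat d) := rfl

instance (v : NNReal) : IsProbabilityMeasure (gue d v) := by
  rw [gue_eq]
  exact Measure.isProbabilityMeasure_map measurable_symMat.aemeasurable

theorem measurable_naivePCE (a b ρ β κ : ℝ) :
    Measurable fun X : Fin n → Vec d => naivePCE a b ρ β κ X := by
  unfold naivePCE
  refine measurable_map_of_prod measurable_const ?_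
  refine measurable_psdProj.comp (measurable_mat_add ?_ measurable_snd)
  exact (measurable_truncCov _).comp measurable_fst

instance (a b ρ β κ : ℝ) (X : Fin n → Vec d) : IsProbabilityMeasure (naivePCE a b ρ β κ X) :=
  Measure.isProbabilityMeasure_map
    (measurable_psdProj.comp (measurable_mat_add measurable_const measurable_id)).aemeasurable

/-- The preconditioner computed from a NaivePCE estimate. -/
noncomputable def weakPrecond (K κ : ℝ) (Z : Mat d) : Mat d :=
  (1 / √K) • spectralProj (κ / 2) Z + (1 - spectralProj (κ / 2) Z)

theorem measurable_weakPrecond (K κ : ℝ) : Measurable (weakPrecond K κ : Mat d → Mat d) := by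
  have h := measurable_spectralProj (d := d) (κ / 2)
  refine measurable_mat_add (measurable_mat_const_smul _ h) ?_
  exact (continuous_const.sub continuous_id).measurable.comp h

theorem weakPPC_eq (a b K ρ β κ : ℝ) (X : Fin n → Vec d) :
    weakPPC a b K ρ β κ X = (naivePCE a b ρ β κ X).map (weakPrecond K κ) := rfl

instance (a b K ρ β κ : ℝ) (X : Fin n → Vec d) : IsProbabilityMeasure (weakPPC a b K ρ β κ X) :=
  Measure.isProbabilityMeasure_map (measurable_weakPrecond K κ).aemeasurable

theorem measurable_weakPPC (a b K ρ β κ : ℝ) :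
    Measurable fun X : Fin n → Vec d => weakPPC a b K ρ β κ X :=
  (Measure.measurable_map _ (measurable_weakPrecond K κ)).comp (measurable_naivePCE a b ρ β κ)

/-- The two claims share one induction: measurability of the next stage uses that the remaining
rounds have probability laws. -/
theorem ppcRounds_measurable_and_isProbabilityMeasure (a b K ρ β : ℝ) (t : ℕ) : ∀ κ : ℝ,
    (Measurable fun X : Fin n → Vec d => ppcRounds a b K ρ β t κ X) ∧
      ∀ X : Fin n → Vec d, IsProbabilityMeasure (ppcRounds a b K ρ β t κ X) := by
  induction t with
  | zero => exact fun κ => ⟨measurable_const, fun X => inferInstanceAs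
      (IsProbabilityMeasure (Measure.dirac (1 : Mat d)))⟩
  | succ t ih =>
    intro κ
    obtain ⟨hm, hp⟩ := ih (7 / 10 * κ)
    have hk : Measurable (Function.uncurry fun (X : Fin n → Vec d) (A' : Mat d) =>
        (ppcRounds a b K ρ β t (7 / 10 * κ) (applyAll ((11 / 10 : ℝ) • A') X)).map
          fun B => B * ((11 / 10 : ℝ) • A')) := by
      refine measurable_map_of_prod (κ := fun z : (Fin n → Vec d) × Mat d =>
        ppcRounds a b K ρ β t (7 / 10 * κ) (applyAll ((11 / 10 : ℝ) • z.2) z.1)) ?_ ?_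
      · exact hm.comp (measurable_applyAll (measurable_mat_const_smul _ measurable_snd)
          measurable_fst)
      · exact measurable_mat_mul measurable_snd
          (measurable_mat_const_smul _ (measurable_snd.comp measurable_fst))
    refine ⟨?_, fun X => ?_⟩
    · exact measurable_bind_of_prod (measurable_weakPPC a b K ρ β κ) hk
    · have hp' : ∀ A' : Mat d, IsProbabilityMeasure
          ((ppcRounds a b K ρ β t (7 / 10 * κ) (applyAll ((11 / 10 : ℝ) • A') X)).map
            fun B => B * ((11 / 10 : ℝ) • A')) := fun A' =>
        Measure.isProbabilityMeasure_map
          (measurable_mat_mul measurable_id measurable_const).aemeasurable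
      exact isProbabilityMeasure_bind' (hk.comp measurable_prodMk_left)

theorem measurable_ppcRounds (a b K ρ β κ : ℝ) (t : ℕ) :
    Measurable fun X : Fin n → Vec d => ppcRounds a b K ρ β t κ X :=
  (ppcRounds_measurable_and_isProbabilityMeasure a b K ρ β t κ).1

instance (a b K ρ β κ : ℝ) (t : ℕ) (X : Fin n → Vec d) :
    IsProbabilityMeasure (ppcRounds a b K ρ β t κ X) :=
  (ppcRounds_measurable_and_isProbabilityMeasure a b K ρ β t κ).2 X

/-- One continuation of PPC: the remaining rounds after the preconditioner `A'` was found. -/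
theorem measurable_ppcRounds_step (a b K ρ β κ : ℝ) (t : ℕ) (X : Fin n → Vec d) :
    Measurable fun A' : Mat d =>
      (ppcRounds a b K ρ β t κ (applyAll ((11 / 10 : ℝ) • A') X)).map
        fun B => B * ((11 / 10 : ℝ) • A') := by
  refine measurable_map_of_prod (κ := fun A' : Mat d =>
        ppcRounds a b K ρ β t κ (applyAll ((11 / 10 : ℝ) • A') X)) ?_ ?_
  · exact (measurable_ppcRounds a b K ρ β κ t).comp
      (measurable_applyAll (measurable_mat_const_smul _ measurable_id) measurable_const)
  · exact measurable_mat_mul measurable_snd (measurable_mat_const_smul _ measurable_fst)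

theorem measurable_ppc (a b K ρ β κ : ℝ) :
    Measurable fun X : Fin n → Vec d => ppc a b K ρ β κ X :=
  measurable_ppcRounds _ _ _ _ _ _ _

instance (a b K ρ β κ : ℝ) (X : Fin n → Vec d) : IsProbabilityMeasure (ppc a b K ρ β κ X) :=
  inferInstanceAs (IsProbabilityMeasure (ppcRounds _ _ _ _ _ _ _ _))

theorem measurable_pgce_step (a b ρ β κ : ℝ) :
    Measurable (Function.uncurry fun (X : Fin n → Vec d) (A : Mat d) =>
      (naivePCE a b ρ β κ (applyAll A X)).map fun S => A⁻¹ * S * (A⁻¹)ᵀ) := by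
  refine measurable_map_of_prod (κ := fun z : (Fin n → Vec d) × Mat d =>
    naivePCE a b ρ β κ (applyAll z.2 z.1)) ?_ ?_
  · exact (measurable_naivePCE _ _ _ _ _).comp (measurable_applyAll measurable_snd measurable_fst)
  · have h : Measurable fun z : ((Fin n → Vec d) × Mat d) × Mat d => z.1.2⁻¹ :=
      measurable_mat_inv.comp (measurable_snd.comp measurable_fst)
    exact measurable_mat_mul (measurable_mat_mul h measurable_snd) (measurable_mat_transpose.comp h)

theorem measurable_conj_inv_right (A : Mat d) : Measurable fun S : Mat d => A⁻¹ * S * (A⁻¹)ᵀ :=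
  measurable_mat_mul (measurable_mat_mul measurable_const measurable_id) measurable_const

/-- The last step of PGCE, given the preconditioner `A`. -/
noncomputable def pgceStep (a b ρ β : ℝ) (X : Fin n → Vec d) (A : Mat d) : Measure (Mat d) :=
  (naivePCE a b ρ β 1000 (applyAll A X)).map fun S => A⁻¹ * S * (A⁻¹)ᵀ

instance (a b ρ β : ℝ) (X : Fin n → Vec d) (A : Mat d) :
    IsProbabilityMeasure (pgceStep a b ρ β X A) :=
  Measure.isProbabilityMeasure_map (measurable_conj_inv_right A).aemeasurable

theorem measurable_pgceStep_uncurry (a b ρ β : ℝ) :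
    Measurable (Function.uncurry (pgceStep a b ρ β : (Fin n → Vec d) → Mat d → Measure (Mat d))) :=
  measurable_pgce_step a b ρ β 1000

theorem measurable_pgceStep (a b ρ β : ℝ) (X : Fin n → Vec d) :
    Measurable (pgceStep a b ρ β X) := by
  have := (measurable_pgceStep_uncurry a b ρ β).comp (measurable_prodMk_left (x := X))
  exact this

theorem pgce_eq (a b K ρ β κ : ℝ) (X : Fin n → Vec d) :
    pgce a b K ρ β κ X =
      (ppc a b K (ρ / 2) (β / 2) κ X).bind (pgceStep a b (ρ / 2) (β / 2) X) := rfl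

theorem measurable_pgce (a b K ρ β κ : ℝ) :
    Measurable fun X : Fin n → Vec d => pgce a b K ρ β κ X := by
  simp_rw [pgce_eq]
  exact measurable_bind_of_prod (measurable_ppc _ _ _ _ _ _) (measurable_pgceStep_uncurry _ _ _ _)

instance (a b K ρ β κ : ℝ) (X : Fin n → Vec d) : IsProbabilityMeasure (pgce a b K ρ β κ X) := by
  rw [pgce_eq]
  exact isProbabilityMeasure_bind' (measurable_pgceStep _ _ _ _ X)

end Kernels

/-! ### Sensitivity and zCDP. -/

section Privacy

variable {n d : ℕ}

/-- The contribution of one sample to the truncated second moment matrix. -/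
noncomputable def truncOuter (r : ℝ) (x : Vec d) : Mat d :=
  if ‖x‖ ^ 2 ≤ r then vecMulVec x.ofLp x.ofLp else 0

theorem truncCov_apply (r : ℝ) (X : Fin n → Vec d) (i j : Fin d) :
    truncCov r X i j = 1 / (n : ℝ) * ∑ k, truncOuter r (X k) i j := by
  rw [truncCov, Matrix.smul_apply, Finset.sum_filter, Matrix.sum_apply, smul_eq_mul]
  rfl

theorem truncCov_symm (r : ℝ) (X : Fin n → Vec d) (i j : Fin d) :
    truncCov r X i j = truncCov r X j i := by
  simp_rw [truncCov_apply]
  congr 2 with k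
  unfold truncOuter
  split_ifs
  · simp [vecMulVec_apply, mul_comm]
  · rfl

theorem sum_sq_vecMulVec (x : Vec d) :
    ∑ p : Fin d × Fin d, (vecMulVec x.ofLp x.ofLp p.1 p.2) ^ 2 = ‖x‖ ^ 4 := by
  rw [show ‖x‖ ^ 4 = ‖x‖ ^ 2 * ‖x‖ ^ 2 by ring, EuclideanSpace.real_norm_sq_eq,
    Finset.sum_mul_sum, ← Finset.univ_product_univ, Finset.sum_product]
  simp [vecMulVec_apply, mul_pow]

theorem sum_sq_truncOuter_le (r : ℝ) (x : Vec d) :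
    ∑ p : Fin d × Fin d, (truncOuter r x p.1 p.2) ^ 2 ≤ r ^ 2 := by
  unfold truncOuter
  split_ifs with h
  · rw [sum_sq_vecMulVec]
    calc ‖x‖ ^ 4 = (‖x‖ ^ 2) ^ 2 := by ring
      _ ≤ r ^ 2 := by gcongr
  · simp [sq_nonneg]

theorem truncOuter_of_nonpos {r : ℝ} (hr : r ≤ 0) (x : Vec d) : truncOuter r x = 0 := by
  unfold truncOuter
  split_ifs with h
  · have : ‖x‖ = 0 := by
      have := sq_nonneg ‖x‖
      exact pow_eq_zero_iff two_ne_zero |>.1 (by linarith)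
    rw [norm_eq_zero.1 this]
    ext i j
    simp [vecMulVec_apply]
  · rfl

/-- The sensitivity of the truncated second moment matrix. -/
theorem sum_sq_truncCov_sub_le (r : ℝ) {X X' : Fin n → Vec d} (h : Neighboring X X') :
    ∑ p : Fin d × Fin d, (truncCov r X p.1 p.2 - truncCov r X' p.1 p.2) ^ 2 ≤
      (2 * r / n) ^ 2 := by
  by_cases hX : ∃ k, X k ≠ X' k
  · obtain ⟨k, hk⟩ := hX
    have hne : ∀ l, l ≠ k → X l = X' l := fun l hl => by
      by_contra hc
      exact hl (h hc hk)
    have e : ∀ i j, truncCov r X i j - truncCov r X' i j =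
        1 / (n : ℝ) * (truncOuter r (X k) i j - truncOuter r (X' k) i j) := by
      intro i j
      rw [truncCov_apply, truncCov_apply, ← mul_sub, ← Finset.sum_sub_distrib]
      congr 1
      refine Finset.sum_eq_single k (fun l _ hl => ?_) (fun hc => absurd (Finset.mem_univ k) hc)
      rw [hne l hl, sub_self]
    simp_rw [e, mul_pow]
    rw [← Finset.mul_sum]
    have hb : ∑ p : Fin d × Fin d, (truncOuter r (X k) p.1 p.2 - truncOuter r (X' k) p.1 p.2) ^ 2 ≤
        4 * r ^ 2 := by
      calc _ ≤ ∑ p : Fin d × Fin d,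
            (2 * truncOuter r (X k) p.1 p.2 ^ 2 + 2 * truncOuter r (X' k) p.1 p.2 ^ 2) :=
            Finset.sum_le_sum fun p _ => by
              nlinarith [sq_nonneg (truncOuter r (X k) p.1 p.2 + truncOuter r (X' k) p.1 p.2)]
        _ ≤ 4 * r ^ 2 := by
            rw [Finset.sum_add_distrib, ← Finset.mul_sum, ← Finset.mul_sum]
            linarith [sum_sq_truncOuter_le r (X k), sum_sq_truncOuter_le r (X' k)]
    calc _ ≤ (1 / (n : ℝ)) ^ 2 * (4 * r ^ 2) := by gcongr
      _ = _ := by ring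
  · push Not at hX
    rw [funext hX]
    simp only [sub_self, ne_eq, OfNat.ofNat_ne_zero, not_false_eq_true, zero_pow,
      Finset.sum_const_zero]
    exact sq_nonneg _

theorem map_add_pi_gaussianReal {ι : Type*} [Fintype ι] (m : ι → ℝ) (v : NNReal) :
    (Measure.pi fun _ : ι => gaussianReal 0 v).map (fun g i => m i + g i) =
      Measure.pi fun i => gaussianReal (m i) v := by
  rw [Measure.pi_map_pi (f := fun i x => m i + x)
    fun i => (measurable_const_add (m i)).aemeasurable]
  simp [gaussianReal_map_const_add]

theorem add_symMat {T : Mat d} (hT : ∀ i j, T i j = T j i) (g : Fin d × Fin d → ℝ) :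
    T + symMat d g = symMat d fun p => T p.1 p.2 + g p := by
  ext i j
  simp only [symMat, Matrix.add_apply, Matrix.of_apply]
  rcases le_total i j with h | h
  · simp [h]
  · simp [h, hT i j]

/-- The standard deviation of the noise of NaivePCE. -/
noncomputable def noiseStd (b ρ β κ : ℝ) (n d : ℕ) : ℝ :=
  b * (d * κ * Real.log (n / β) / (n * √ρ))

/-- The truncation radius (squared) of NaivePCE. -/
noncomputable def truncRadius (a β κ : ℝ) (n d : ℕ) : ℝ := a * (d * κ * Real.log (n / β))

theorem naivePCE_eq (a b ρ β κ : ℝ) (X : Fin n → Vec d) :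
    naivePCE a b ρ β κ X = (gue d (Real.toNNReal (noiseStd b ρ β κ n d ^ 2))).map fun N =>
      psdProj (truncCov (truncRadius a β κ n d) X + N) := rfl

/-- The second moment matrix is symmetric, so it can be absorbed into the means of a full d × d
array of independent Gaussians. Only the upper triangle of the array is read, so the whole estimate
is post-processing of that array. -/
theorem naivePCE_eq_map_pi (a b ρ β κ : ℝ) (X : Fin n → Vec d) :
    naivePCE a b ρ β κ X = (Measure.pi fun p : Fin d × Fin d =>
      gaussianReal (truncCov (truncRadius a β κ n d) X p.1 p.2)
        (Real.toNNReal (noiseStd b ρ β κ n d ^ 2))).map fun g => psdProj (symMat d g) := by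
  have hm : Measurable fun g => psdProj (symMat d g) := measurable_psdProj.comp measurable_symMat
  have hm' : Measurable fun N => psdProj (truncCov (truncRadius a β κ n d) X + N) :=
    measurable_psdProj.comp (measurable_mat_add measurable_const measurable_id)
  rw [naivePCE_eq, gue_eq, Measure.map_map hm' measurable_symMat,
    ← map_add_pi_gaussianReal fun p : Fin d × Fin d => truncCov (truncRadius a β κ n d) X p.1 p.2,
    Measure.map_map hm (by fun_prop)]
  congr 1
  funext g
  simp only [Function.comp_apply]
  rw [add_symMat (truncCov_symm _ _)]

theorem holderBound_naivePCE {a b lam : ℝ} (ha : 0 < a) (hb : 2 * a ≤ b) (hl : 1 < lam)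
    {ρ : ℝ} (hρ : 0 < ρ) (β κ : ℝ) {X X' : Fin n → Vec d} (h : Neighboring X X') :
    HolderBound lam ρ (naivePCE a b ρ β κ X) (naivePCE a b ρ β κ X') := by
  set r := truncRadius a β κ n d with hr
  -- The noise variance may be zero when n = 0 or r ≤ 0; in these cases both truncated matrices
  -- vanish and the two laws coincide.
  have key : truncCov r X = truncCov r X' ∨ (0 < n ∧ 0 < r) := by
    by_cases hn : n = 0
    · left
      subst hn
      ext i j
      simp [truncCov_apply]
    by_cases hr0 : r ≤ 0
    · left
      ext i j
      simp [truncCov_apply, truncOuter_of_nonpos hr0]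
    · exact Or.inr ⟨Nat.pos_of_ne_zero hn, not_le.1 hr0⟩
  rcases key with h0 | ⟨hn, hr0⟩
  · have : naivePCE a b ρ β κ X = naivePCE a b ρ β κ X' := by
      rw [naivePCE_eq, naivePCE_eq, ← hr, h0]
    rw [this]
    exact HolderBound.refl hl hρ.le _
  · rw [naivePCE_eq_map_pi, naivePCE_eq_map_pi, ← hr]
    refine HolderBound.map ?_ (measurable_psdProj.comp measurable_symMat)
    have hn' : (0 : ℝ) < n := by exact_mod_cast hn
    have hσ : noiseStd b ρ β κ n d = b / a * r / (n * √ρ) := by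
      rw [hr, noiseStd, truncRadius]
      field_simp
    have hb0 : 0 < b := by linarith
    have hpos : 0 < noiseStd b ρ β κ n d ^ 2 := by
      rw [hσ]
      have := Real.sqrt_pos.2 hρ
      positivity
    refine holderBound_pi_gaussianReal hl _ _ (by simpa using hpos.ne') ?_
    refine (sum_sq_truncCov_sub_le r h).trans ?_
    rw [Real.coe_toNNReal _ hpos.le, hσ, div_pow (b / a * r), mul_pow (n : ℝ),
      Real.sq_sqrt hρ.le]
    -- The squared sensitivity 4r²/n² has to be at most 2σ²ρ = 2(b/a)² r²/n²; this is the role of b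
    -- ≥ 2a.
    have h4 : 4 ≤ 2 * (b / a) ^ 2 := by
      have : 2 ≤ b / a := by rw [le_div_iff₀ ha]; exact hb
      nlinarith
    calc (2 * r / n) ^ 2 = 4 * (r ^ 2 / n ^ 2) := by ring
      _ ≤ 2 * (b / a) ^ 2 * (r ^ 2 / n ^ 2) := by gcongr
      _ = _ := by field_simp

theorem Neighboring.applyAll {X X' : Fin n → Vec d} (h : Neighboring X X') (A : Mat d) :
    Neighboring (applyAll A X) (applyAll A X') := by
  refine Set.Subsingleton.anti h fun i hi hc => hi ?_
  simp only [PrivateGaussian.applyAll, hc]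

theorem holderBound_weakPPC {a b lam : ℝ} (ha : 0 < a) (hb : 2 * a ≤ b) (hl : 1 < lam)
    {ρ : ℝ} (hρ : 0 < ρ) (K β κ : ℝ) {X X' : Fin n → Vec d} (h : Neighboring X X') :
    HolderBound lam ρ (weakPPC a b K ρ β κ X) (weakPPC a b K ρ β κ X') :=
  (holderBound_naivePCE ha hb hl hρ β κ h).map (measurable_weakPrecond K κ)

/-- Positivity of ρ is requested only for t > 0: with no rounds the budget per round is a division
by zero, hence 0. -/
theorem holderBound_ppcRounds {a b lam : ℝ} (ha : 0 < a) (hb : 2 * a ≤ b) (hl : 1 < lam)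
    {ρ : ℝ} (K β : ℝ) (t : ℕ) (hρ : 0 < t → 0 < ρ) (κ : ℝ) {X X' : Fin n → Vec d}
    (h : Neighboring X X') :
    HolderBound lam (t * ρ) (ppcRounds a b K ρ β t κ X) (ppcRounds a b K ρ β t κ X') := by
  induction t generalizing κ X X' with
  | zero =>
    rw [Nat.cast_zero, zero_mul]
    exact HolderBound.refl hl le_rfl (Measure.dirac (1 : Mat d))
  | succ t ih =>
    have hρ' := hρ t.succ_pos
    have e : ((t + 1 : ℕ) : ℝ) * ρ = ρ + t * ρ := by push_cast; ring
    rw [e]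
    refine HolderBound.bind hl (holderBound_weakPPC ha hb hl hρ' K β κ h)
      (measurable_ppcRounds_step a b K ρ β (7 / 10 * κ) t X)
      (measurable_ppcRounds_step a b K ρ β (7 / 10 * κ) t X') fun A => ?_
    exact (ih (fun _ => hρ') (7 / 10 * κ) (h.applyAll _)).map
      (measurable_mat_mul measurable_id measurable_const)

theorem isZCDP_pgce {a b : ℝ} (ha : 0 < a) (hb : 2 * a ≤ b) (K : ℝ) {ρ : ℝ} (hρ : 0 < ρ)
    (β κ : ℝ) : IsZCDP ρ fun X : Fin n → Vec d => pgce a b K ρ β κ X := by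
  refine ⟨fun X => inferInstance, fun X X' h lam hl => HolderBound.renyiDiv_le hl ?_⟩
  simp only [pgce_eq]
  have hT : (numRounds κ : ℝ) * (ρ / 2 / numRounds κ) ≤ ρ / 2 := by
    rcases Nat.eq_zero_or_pos (numRounds κ) with h0 | h0
    · simp [h0, (half_pos hρ).le]
    · have : (0 : ℝ) < numRounds κ := by exact_mod_cast h0
      exact (mul_div_cancel₀ _ this.ne').le
  refine HolderBound.mono hl (add_halves ρ).le ?_
  refine HolderBound.bind hl (HolderBound.mono hl hT ?_)
    (measurable_pgceStep _ _ _ _ X) (measurable_pgceStep _ _ _ _ X') fun A => ?_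
  · refine holderBound_ppcRounds ha hb hl K _ _ (fun h0 => ?_) κ h
    have : (0 : ℝ) < numRounds κ := by exact_mod_cast h0
    positivity
  · exact (holderBound_naivePCE ha hb hl (half_pos hρ) _ _ (h.applyAll A)).map
      (measurable_conj_inv_right A)

end Privacy

/-! ### Frobenius norm, PSD projection and spectral projections. -/

section MatrixFacts

variable {d : ℕ}

theorem dot_self_nonneg (x : Fin d → ℝ) : 0 ≤ x ⬝ᵥ x :=
  Finset.sum_nonneg fun i _ => mul_self_nonneg (x i)

theorem dot_sq_le (x y : Fin d → ℝ) : (x ⬝ᵥ y) ^ 2 ≤ (x ⬝ᵥ x) * (y ⬝ᵥ y) := by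
  simp only [dotProduct, ← sq]
  exact Finset.sum_mul_sq_le_sq_mul_sq _ _ _

/-- A bound on `‖Bᵀ x‖` implies the same bound on `‖B x‖`. -/
theorem mulVec_dot_le_of_transpose {B : Mat d} {κ : ℝ} (hκ : 0 ≤ κ)
    (h : ∀ x, (Bᵀ *ᵥ x) ⬝ᵥ (Bᵀ *ᵥ x) ≤ κ * (x ⬝ᵥ x)) (x : Fin d → ℝ) :
    (B *ᵥ x) ⬝ᵥ (B *ᵥ x) ≤ κ * (x ⬝ᵥ x) := by
  set q := (B *ᵥ x) ⬝ᵥ (B *ᵥ x) with hq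
  have e : q = (Bᵀ *ᵥ (B *ᵥ x)) ⬝ᵥ x := by
    rw [hq, mulVec_transpose, ← dotProduct_mulVec]
  have h1 := dot_sq_le (Bᵀ *ᵥ (B *ᵥ x)) x
  rw [← e] at h1
  have h2 := h (B *ᵥ x)
  rw [← hq] at h2
  have h3 : q ^ 2 ≤ κ * q * (x ⬝ᵥ x) := h1.trans (by gcongr; exact dot_self_nonneg x)
  have hq0 : 0 ≤ q := dot_self_nonneg _
  rcases hq0.eq_or_lt with h0 | h0
  · rw [← h0]; exact mul_nonneg hκ (dot_self_nonneg x)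
  · by_contra hc
    push Not at hc
    nlinarith [mul_lt_mul_of_pos_left hc h0]

theorem frobNorm_nonneg (M : Mat d) : 0 ≤ frobNorm M := Real.sqrt_nonneg _

theorem frobNorm_sq (M : Mat d) : frobNorm M ^ 2 = ∑ i, ∑ j, M i j ^ 2 :=
  Real.sq_sqrt (by positivity)

theorem frobNorm_transpose (M : Mat d) : frobNorm Mᵀ = frobNorm M := by
  unfold frobNorm
  rw [Finset.sum_comm]
  rfl

theorem sum_mul_le_frobNorm (M N : Mat d) :
    ∑ i, ∑ j, M i j * N i j ≤ frobNorm M * frobNorm N := by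
  unfold frobNorm
  simp only [← Finset.sum_product']
  exact Real.sum_mul_le_sqrt_mul_sqrt _ (fun p : Fin d × Fin d => M p.1 p.2) fun p => N p.1 p.2

theorem frobNorm_sub_le (M N P : Mat d) :
    frobNorm (M - P) ≤ frobNorm (M - N) + frobNorm (N - P) := by
  refine abs_le_of_sq_le_sq' ?_ (add_nonneg (frobNorm_nonneg _) (frobNorm_nonneg _)) |>.2
  have e : ∑ i, ∑ j, (M - P) i j ^ 2 = ∑ i, ∑ j, (M - N) i j ^ 2 +
      2 * ∑ i, ∑ j, (M - N) i j * (N - P) i j + ∑ i, ∑ j, (N - P) i j ^ 2 := by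
    simp only [Finset.mul_sum, ← Finset.sum_add_distrib]
    refine Finset.sum_congr rfl fun i _ => Finset.sum_congr rfl fun j _ => ?_
    simp only [Matrix.sub_apply]
    ring
  rw [frobNorm_sq, e, ← frobNorm_sq, ← frobNorm_sq]
  nlinarith [sum_mul_le_frobNorm (M - N) (N - P)]

theorem dot_mulVec_eq_sum (M : Mat d) (x y : Fin d → ℝ) :
    x ⬝ᵥ (M *ᵥ y) = ∑ i, ∑ j, M i j * (x i * y j) := by
  simp only [dotProduct, mulVec, Finset.mul_sum]
  exact Finset.sum_congr rfl fun i _ => Finset.sum_congr rfl fun j _ => by ring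

theorem frobNorm_vecMulVec (x : Fin d → ℝ) : frobNorm (vecMulVec x x) = x ⬝ᵥ x := by
  have : ∑ i, ∑ j, vecMulVec x x i j ^ 2 = (x ⬝ᵥ x) ^ 2 := by
    rw [sq (x ⬝ᵥ x), dotProduct, Finset.sum_mul_sum]
    exact Finset.sum_congr rfl fun i _ => Finset.sum_congr rfl fun j _ => by
      rw [vecMulVec_apply]; ring
  rw [frobNorm, this, Real.sqrt_sq (dot_self_nonneg x)]

theorem abs_dot_mulVec_le_frobNorm (M : Mat d) (x : Fin d → ℝ) :
    |x ⬝ᵥ (M *ᵥ x)| ≤ frobNorm M * (x ⬝ᵥ x) := by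
  have key : ∀ N : Mat d, x ⬝ᵥ (N *ᵥ x) ≤ frobNorm N * (x ⬝ᵥ x) := fun N => by
    rw [dot_mulVec_eq_sum, ← frobNorm_vecMulVec]
    exact sum_mul_le_frobNorm N (vecMulVec x x)
  have hn : frobNorm (-M) = frobNorm M := by simp [frobNorm]
  have := key (-M)
  rw [neg_mulVec, dotProduct_neg, hn] at this
  exact abs_le.2 ⟨by linarith, key M⟩

theorem frobNorm_mul_le {C : Mat d} (hC : ∀ x, (C *ᵥ x) ⬝ᵥ (C *ᵥ x) ≤ x ⬝ᵥ x) (M : Mat d) :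
    frobNorm (C * M) ≤ frobNorm M := by
  refine Real.sqrt_le_sqrt ?_
  rw [Finset.sum_comm, Finset.sum_comm (f := fun i j => M i j ^ 2)]
  refine Finset.sum_le_sum fun j _ => ?_
  have := hC fun i => M i j
  simpa only [dotProduct, ← sq, mulVec, Matrix.mul_apply] using this

theorem frobNorm_conj_le {C : Mat d} (hC : ∀ x, (C *ᵥ x) ⬝ᵥ (C *ᵥ x) ≤ x ⬝ᵥ x) (M : Mat d) :
    frobNorm (C * M * Cᵀ) ≤ frobNorm M := by
  rw [mul_assoc]
  refine (frobNorm_mul_le hC _).trans ?_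
  rw [← frobNorm_transpose, transpose_mul, transpose_transpose, ← frobNorm_transpose M]
  exact frobNorm_mul_le hC _

theorem isHermitian_of_transpose {M : Mat d} (hM : Mᵀ = M) : M.IsHermitian := by
  rw [Matrix.IsHermitian, conjTranspose_eq_transpose_of_trivial, hM]

theorem continuousOn_spectrum (f : ℝ → ℝ) (M : Mat d) : ContinuousOn f (spectrum ℝ M) :=
  M.finite_real_spectrum.continuousOn f

theorem cfc_transpose (f : ℝ → ℝ) (M : Mat d) : (cfc f M)ᵀ = cfc f M := by
  have : IsSelfAdjoint (cfc f M) := cfc_predicate f M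
  rw [← conjTranspose_eq_transpose_of_trivial]
  exact this

theorem dot_cfc_nonneg {f : ℝ → ℝ} (hf : ∀ x, 0 ≤ f x) (M : Mat d) (x : Fin d → ℝ) :
    0 ≤ x ⬝ᵥ (cfc f M *ᵥ x) := by
  have h : (cfc f M).PosSemidef := nonneg_iff_posSemidef.1 (cfc_nonneg fun x _ => hf x)
  simpa using h.dotProduct_mulVec_nonneg x

theorem frobInner_eq_trace (M N : Mat d) : ∑ i, ∑ j, M i j * N i j = (Mᵀ * N).trace := by
  rw [Finset.sum_comm]
  simp [trace, Matrix.mul_apply]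

theorem trace_mul_nonneg_of_posSemidef {D Y : Mat d} (hD : D.PosSemidef) (hY : Y.PosSemidef) :
    0 ≤ (D * Y).trace := by
  obtain ⟨R, rfl⟩ : ∃ R : Mat d, D = Rᴴ * R := by
    obtain ⟨R, hR⟩ := CStarAlgebra.nonneg_iff_eq_star_mul_self.1 (nonneg_iff_posSemidef.2 hD)
    exact ⟨R, hR⟩
  rw [trace_mul_cycle, trace_mul_comm, ← mul_assoc]
  exact (hY.mul_mul_conjTranspose_same R).trace_nonneg

/-- The truncation of negative eigenvalues is at least as close to any PSD matrix. -/
theorem frobNorm_psdProj_sub_le {M Y : Mat d} (hM : Mᵀ = M) (hY : Y.PosSemidef) :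
    frobNorm (psdProj M - Y) ≤ frobNorm (M - Y) := by
  have hMs : IsSelfAdjoint M := isHermitian_of_transpose hM
  set Z := psdProj M with hZ
  set D := cfc (fun x : ℝ => max x 0 - x) M with hD
  have hDZ : D = Z - M := by
    rw [hD, cfc_sub (fun x : ℝ => max x 0) (fun x => x) M (continuousOn_spectrum _ _)
      (continuousOn_spectrum _ _), cfc_id' ℝ M]
    rfl
  have hDZ0 : D * Z = 0 := by
    rw [hD, hZ, psdProj, ← cfc_mul _ _ M (continuousOn_spectrum _ _) (continuousOn_spectrum _ _)]
    have : (fun x : ℝ => (max x 0 - x) * max x 0) = fun _ => 0 := by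
      funext x
      rcases le_total x 0 with h | h <;> simp [h]
    rw [this, cfc_const_zero]
  have hDp : D.PosSemidef := nonneg_iff_posSemidef.1 (cfc_nonneg fun x _ => by
    simp)
  -- First-order optimality of the projection onto the cone: the removed part D is PSD and
  -- orthogonal to Z, while its inner product with the PSD matrix Y is nonnegative.
  have h1 : ∑ i, ∑ j, D i j * (Z - Y) i j ≤ 0 := by
    rw [frobInner_eq_trace, hD, cfc_transpose, ← hD, mul_sub, hDZ0, zero_sub, trace_neg]
    linarith [trace_mul_nonneg_of_posSemidef hDp hY]
  have h2 : frobNorm (Z - Y) ^ 2 =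
      ∑ i, ∑ j, D i j * (Z - Y) i j + ∑ i, ∑ j, (M - Y) i j * (Z - Y) i j := by
    rw [frobNorm_sq, ← Finset.sum_add_distrib]
    refine Finset.sum_congr rfl fun i _ => ?_
    rw [← Finset.sum_add_distrib]
    refine Finset.sum_congr rfl fun j _ => ?_
    rw [hDZ]
    simp only [Matrix.sub_apply]
    ring
  have h3 := sum_mul_le_frobNorm (M - Y) (Z - Y)
  have h4 := frobNorm_nonneg (Z - Y)
  rcases h4.eq_or_lt with h | h
  · rw [← h]; exact frobNorm_nonneg _
  · nlinarith

theorem spectralProj_mul_self (τ : ℝ) (M : Mat d) :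
    spectralProj τ M * spectralProj τ M = spectralProj τ M := by
  unfold spectralProj
  rw [← cfc_mul _ _ M (continuousOn_spectrum _ _) (continuousOn_spectrum _ _)]
  congr 1
  funext x
  split_ifs <;> simp

theorem spectralProj_transpose (τ : ℝ) (M : Mat d) : (spectralProj τ M)ᵀ = spectralProj τ M :=
  cfc_transpose _ _

/-- Clipping at zero does not affect which eigenvalues reach a positive threshold; the rounds may
therefore ignore the PSD projection. -/
theorem spectralProj_psdProj {τ : ℝ} (hτ : 0 < τ) {M : Mat d} (hM : Mᵀ = M) :
    spectralProj τ (psdProj M) = spectralProj τ M := by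
  have hMs : IsSelfAdjoint M := isHermitian_of_transpose hM
  unfold spectralProj psdProj
  rw [← cfc_comp' _ _ M ((M.finite_real_spectrum.image _).continuousOn _)
    (continuousOn_spectrum _ _) hMs]
  congr 1
  funext x
  by_cases h : τ ≤ x
  · simp [h]
  · simp [h, hτ]

theorem dot_mulVec_transpose (P M : Mat d) (x : Fin d → ℝ) :
    (P *ᵥ x) ⬝ᵥ (M *ᵥ (P *ᵥ x)) = x ⬝ᵥ ((Pᵀ * M * P) *ᵥ x) := by
  rw [← mulVec_mulVec, ← mulVec_mulVec, mulVec_transpose, dotProduct_comm x, ← dotProduct_mulVec,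
    dotProduct_comm]

/-- The spectral decomposition of the quadratic form of `M` at the threshold `τ`. -/
theorem spectralProj_quadratic (τ : ℝ) {M : Mat d} (hM : Mᵀ = M) (x : Fin d → ℝ) :
    τ * ((spectralProj τ M *ᵥ x) ⬝ᵥ (spectralProj τ M *ᵥ x)) ≤
        (spectralProj τ M *ᵥ x) ⬝ᵥ (M *ᵥ (spectralProj τ M *ᵥ x)) ∧
      ((1 - spectralProj τ M) *ᵥ x) ⬝ᵥ (M *ᵥ ((1 - spectralProj τ M) *ᵥ x)) ≤
        τ * (((1 - spectralProj τ M) *ᵥ x) ⬝ᵥ ((1 - spectralProj τ M) *ᵥ x)) ∧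
      (spectralProj τ M *ᵥ x) ⬝ᵥ (M *ᵥ ((1 - spectralProj τ M) *ᵥ x)) = 0 ∧
      ((1 - spectralProj τ M) *ᵥ x) ⬝ᵥ (M *ᵥ (spectralProj τ M *ᵥ x)) = 0 := by
  have hMs : IsSelfAdjoint M := isHermitian_of_transpose hM
  have hc := fun f => continuousOn_spectrum f M
  set P := spectralProj τ M with hP
  set f : ℝ → ℝ := fun x => if τ ≤ x then (1 : ℝ) else 0 with hf
  have hPf : P = cfc f M := rfl
  have hQf : 1 - P = cfc (fun x => 1 - f x) M := by
    rw [cfc_sub _ _ M (hc _) (hc _), cfc_const_one ℝ M, hPf]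
  have hPt : Pᵀ = P := spectralProj_transpose τ M
  have hQt : (1 - P)ᵀ = 1 - P := by rw [transpose_sub, transpose_one, hPt]
  have hMf : M = cfc (fun x : ℝ => x) M := (cfc_id' ℝ M).symm
  have e1 : ∀ (g h : ℝ → ℝ), cfc g M * M * cfc h M = cfc (fun x => g x * x * h x) M := by
    intro g h
    rw [cfc_mul _ _ M (hc _) (hc _), cfc_mul _ _ M (hc _) (hc _), cfc_id' ℝ M]
  have e2 : ∀ (g h : ℝ → ℝ), (cfc g M *ᵥ x) ⬝ᵥ (M *ᵥ (cfc h M *ᵥ x)) =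
      x ⬝ᵥ (cfc (fun x => g x * x * h x) M *ᵥ x) := by
    intro g h
    rw [← e1, ← mulVec_mulVec, ← mulVec_mulVec, ← cfc_transpose g M, mulVec_transpose,
      ← dotProduct_mulVec]
    simp [cfc_transpose]
  have e3 : ∀ (g : ℝ → ℝ), (cfc g M *ᵥ x) ⬝ᵥ (cfc g M *ᵥ x) =
      x ⬝ᵥ (cfc (fun x => g x * g x) M *ᵥ x) := by
    intro g
    rw [cfc_mul _ _ M (hc _) (hc _), ← mulVec_mulVec, ← cfc_transpose g M, mulVec_transpose,
      ← dotProduct_mulVec]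
    simp [cfc_transpose]
  have e4 : ∀ (g : ℝ → ℝ) (t : ℝ), t * (x ⬝ᵥ (cfc g M *ᵥ x)) =
      x ⬝ᵥ (cfc (fun x => t * g x) M *ᵥ x) := by
    intro g t
    rw [cfc_const_mul _ _ M (hc _), smul_mulVec, dotProduct_smul, smul_eq_mul]
  have e5 : ∀ (g h : ℝ → ℝ), (∀ y, g y ≤ h y) →
      x ⬝ᵥ (cfc g M *ᵥ x) ≤ x ⬝ᵥ (cfc h M *ᵥ x) := by
    intro g h hgh
    have := dot_cfc_nonneg (f := fun y => h y - g y) (fun y => sub_nonneg.2 (hgh y)) M x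
    rw [cfc_sub _ _ M (hc _) (hc _), sub_mulVec, dotProduct_sub] at this
    linarith
  have e6 : ∀ g : ℝ → ℝ, (∀ y, g y = 0) → x ⬝ᵥ (cfc g M *ᵥ x) = 0 := by
    intro g hg
    rw [show g = fun _ => 0 from funext hg, cfc_const_zero]
    simp
  rw [hQf, hPf]
  simp only [e2, e3, e4]
  refine ⟨e5 _ _ fun y => ?_, e5 _ _ fun y => ?_, e6 _ fun y => ?_, e6 _ fun y => ?_⟩
  all_goals
    simp only [hf]
    split_ifs with hy <;> simp <;> linarith

end MatrixFacts

/-! ### Deterministic analysis of one round and of the final estimate. -/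

section Preconditioning

variable {n d : ℕ}

/-- `1 ≤ B Bᵀ ≤ κ`. -/
def Sandwich (κ : ℝ) (B : Mat d) : Prop :=
  ∀ x : Fin d → ℝ, x ⬝ᵥ x ≤ (Bᵀ *ᵥ x) ⬝ᵥ (Bᵀ *ᵥ x) ∧
    (Bᵀ *ᵥ x) ⬝ᵥ (Bᵀ *ᵥ x) ≤ κ * (x ⬝ᵥ x)

theorem dot_conj (B W : Mat d) (x : Fin d → ℝ) :
    x ⬝ᵥ ((B * (1 + W) * Bᵀ) *ᵥ x) =
      (Bᵀ *ᵥ x) ⬝ᵥ (Bᵀ *ᵥ x) + (Bᵀ *ᵥ x) ⬝ᵥ (W *ᵥ (Bᵀ *ᵥ x)) := by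
  have := dot_mulVec_transpose Bᵀ (1 + W) x
  rw [transpose_transpose] at this
  rw [← this, add_mulVec, one_mulVec, dotProduct_add]

/-- Young's inequality with uneven weights: u will be the component already shrunk by 1/20, which
can afford the factor 11. -/
theorem dot_add_self_le (u w : Fin d → ℝ) :
    (u + w) ⬝ᵥ (u + w) ≤ 11 * (u ⬝ᵥ u) + 11 / 10 * (w ⬝ᵥ w) := by
  have h := dot_self_nonneg (u - (1 / 10 : ℝ) • w)
  simp only [sub_dotProduct, dotProduct_sub, smul_dotProduct, dotProduct_smul, smul_eq_mul] at h
  simp only [add_dotProduct, dotProduct_add]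
  rw [dotProduct_comm w u] at *
  linarith

/-- One round of preconditioning improves the condition number by the factor `0.7`. -/
theorem Sandwich.round {κ : ℝ} {B W N : Mat d} (hB : Sandwich κ B) (hκ : 1000 ≤ κ)
    (hW : ∀ x, |x ⬝ᵥ (W *ᵥ x)| ≤ 1 / 100 * (x ⬝ᵥ x)) (hWt : Wᵀ = W)
    (hN : ∀ x, |x ⬝ᵥ (N *ᵥ x)| ≤ κ / 1000 * (x ⬝ᵥ x)) (hNt : Nᵀ = N) :
    Sandwich (7 / 10 * κ)
      (((11 / 10 : ℝ) • weakPrecond 20 κ (psdProj (B * (1 + W) * Bᵀ + N))) * B) := by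
  set M := B * (1 + W) * Bᵀ + N with hM
  have hMt : Mᵀ = M := by
    rw [hM]
    simp only [transpose_add, transpose_mul, transpose_transpose, transpose_one, hWt, hNt, mul_assoc]
  have hκ0 : 0 < κ / 2 := by linarith
  set P := spectralProj (κ / 2) M with hP
  have hA : weakPrecond 20 κ (psdProj M) = (1 / √20 : ℝ) • P + (1 - P) := by
    rw [weakPrecond, spectralProj_psdProj hκ0 hMt]
  have hPt : Pᵀ = P := spectralProj_transpose _ _
  have hPP : P * P = P := spectralProj_mul_self _ _
  rw [hA]
  intro x
  set p := P *ᵥ x with hp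
  set q := (1 - P) *ᵥ x with hq
  have hpq0 : p ⬝ᵥ q = 0 := by
    rw [hp, hq, ← hPt, mulVec_transpose, ← dotProduct_mulVec, mulVec_mulVec, hPt, mul_sub, hPP]
    simp
  have hx : x = p + q := by
    rw [hp, hq, ← add_mulVec, add_sub_cancel, one_mulVec]
  have hxx : x ⬝ᵥ x = p ⬝ᵥ p + q ⬝ᵥ q := by
    conv_lhs => rw [hx]
    rw [add_dotProduct, dotProduct_add, dotProduct_add, dotProduct_comm q p, hpq0]
    ring
  set c : ℝ := 1 / √20 with hc
  have hcc : c * c = 1 / 20 := by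
    rw [hc, div_mul_div_comm, Real.mul_self_sqrt (by norm_num)]; norm_num
  set y := c • p + q with hy
  have hyy : y ⬝ᵥ y = 1 / 20 * (p ⬝ᵥ p) + q ⬝ᵥ q := by
    rw [hy, add_dotProduct, dotProduct_add, dotProduct_add, smul_dotProduct, smul_dotProduct,
      dotProduct_smul, dotProduct_smul, dotProduct_comm q p, hpq0]
    simp only [smul_eq_mul, mul_zero, add_zero, zero_add]
    rw [← mul_assoc, hcc]
  have hBx : (((11 / 10 : ℝ) • (c • P + (1 - P))) * B)ᵀ *ᵥ x = (11 / 10 : ℝ) • (Bᵀ *ᵥ y) := by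
    rw [transpose_mul, transpose_smul, transpose_add, transpose_smul, transpose_sub, transpose_one,
      hPt, ← mulVec_mulVec, smul_mulVec, mulVec_smul, add_mulVec, smul_mulVec]
  rw [hBx, smul_dotProduct, dotProduct_smul, smul_eq_mul, smul_eq_mul]
  obtain ⟨s1, s2, s3, s4⟩ := spectralProj_quadratic (κ / 2) hMt x
  simp only [← hP, ← hp, ← hq] at s1 s2 s3 s4
  have hquad : ∀ z, z ⬝ᵥ (M *ᵥ z) = (Bᵀ *ᵥ z) ⬝ᵥ (Bᵀ *ᵥ z) +
      (Bᵀ *ᵥ z) ⬝ᵥ (W *ᵥ (Bᵀ *ᵥ z)) + z ⬝ᵥ (N *ᵥ z) := fun z => by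
    rw [hM, add_mulVec, dotProduct_add, dot_conj]
  have hWz := fun z => abs_le.1 (hW (Bᵀ *ᵥ z))
  have hNz := fun z => abs_le.1 (hN z)
  have hp0 := dot_self_nonneg p
  have hq0 := dot_self_nonneg q
  -- The vectors Bᵀp and Bᵀq need not be orthogonal, since P is a spectral projection of M and not
  -- of B Bᵀ; hence Young's inequality.
  have hupp : (Bᵀ *ᵥ y) ⬝ᵥ (Bᵀ *ᵥ y) ≤
      11 * (1 / 20 * ((Bᵀ *ᵥ p) ⬝ᵥ (Bᵀ *ᵥ p))) + 11 / 10 * ((Bᵀ *ᵥ q) ⬝ᵥ (Bᵀ *ᵥ q)) := by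
    have := dot_add_self_le (Bᵀ *ᵥ (c • p)) (Bᵀ *ᵥ q)
    rw [← mulVec_add, ← hy, mulVec_smul, smul_dotProduct, dotProduct_smul, smul_eq_mul, smul_eq_mul,
      ← mul_assoc c, hcc] at this
    exact this
  -- For M itself the cross terms do vanish.
  have hyM : y ⬝ᵥ (M *ᵥ y) = 1 / 20 * (p ⬝ᵥ (M *ᵥ p)) + q ⬝ᵥ (M *ᵥ q) := by
    rw [hy, mulVec_add, mulVec_smul, add_dotProduct, dotProduct_add, dotProduct_add,
      smul_dotProduct, smul_dotProduct, dotProduct_smul, dotProduct_smul, s3, s4]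
    simp only [smul_eq_mul, mul_zero, add_zero, zero_add]
    rw [← mul_assoc, hcc]
  have hκp := mul_nonneg (by linarith : (0 : ℝ) ≤ κ) hp0
  have hκq := mul_nonneg (by linarith : (0 : ℝ) ≤ κ) hq0
  constructor
  · have l1 := (hB y).1
    have l2 := hquad y
    have l3 := hquad q
    have l4 := hWz y
    have l5 := hNz y
    have l6 := hWz q
    have l7 := hNz q
    have l8 := dot_self_nonneg (Bᵀ *ᵥ q)
    -- On p the form of M is at least κ/2, hence κ/40 after the factor 1/20. On q it is at least
    -- -κ/1000, because only the noise can be negative there; passing from M to B Bᵀ costs another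
    -- κ/1000 times y·y.
    have key : 101 / 100 * ((Bᵀ *ᵥ y) ⬝ᵥ (Bᵀ *ᵥ y)) ≥
        κ * (1 / 40 * (p ⬝ᵥ p) - 1 / 20000 * (p ⬝ᵥ p) - 1 / 500 * (q ⬝ᵥ q)) := by
      rw [hyy] at l5
      nlinarith
    rw [hxx]
    rw [hyy] at l1
    set s := (Bᵀ *ᵥ y) ⬝ᵥ (Bᵀ *ᵥ y)
    -- Two lower bounds are averaged: `key`, strong on p, with weight 36/κ, and the invariant for y,
    -- strong on q, with the complementary weight. Adding 1.01 times the second to the first cancels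
    -- the terms in 36/κ times s.
    have hθ : 0 < 36 / κ := by positivity
    have hθ1 : 36 / κ ≤ 36 / 1000 := by gcongr
    have k1 := mul_le_mul_of_nonneg_left key hθ.le
    rw [← mul_assoc, div_mul_cancel₀ _ (by linarith : κ ≠ 0)] at k1
    have k2 := mul_le_mul_of_nonneg_left l1 (by linarith : 0 ≤ 1 - 36 / κ)
    have k3 : (1 - 36 / 1000) * (1 / 20 * (p ⬝ᵥ p) + q ⬝ᵥ q) ≤
        (1 - 36 / κ) * (1 / 20 * (p ⬝ᵥ p) + q ⬝ᵥ q) := by gcongr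
    linarith
  · have u1 := (hB p).2
    have u2 := hquad q
    have u3 := hWz q
    have u4 := hNz q
    rw [hxx]
    -- Here 0.501 = 1/2 + 1/1000, threshold plus noise. The final factors are 1.21 · 11/20 = 0.6655
    -- on p and 1.21 · 1.1 · 0.501/0.99 < 0.674 on q, both below 0.7.
    have : 99 / 100 * ((Bᵀ *ᵥ q) ⬝ᵥ (Bᵀ *ᵥ q)) ≤ 501 / 1000 * (κ * (q ⬝ᵥ q)) := by linarith
    linarith

theorem Sandwich.isUnit {κ : ℝ} {B : Mat d} (hB : Sandwich κ B) : IsUnit B := by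
  have : IsUnit Bᵀ := by
    refine mulVec_injective_iff_isUnit.1 ((injective_iff_map_eq_zero (mulVecLin Bᵀ)).2 fun x hx => ?_)
    have h := (hB x).1
    rw [mulVecLin_apply] at hx
    rw [hx, dotProduct_zero] at h
    exact dotProduct_self_eq_zero.1 (le_antisymm h (dot_self_nonneg x))
  simpa using this

/-- The lower half of the invariant, evaluated at (B⁻¹)ᵀx, shows that (B⁻¹)ᵀ contracts; the bound
then passes to the transpose. -/
theorem Sandwich.inv_contracts {κ : ℝ} {B : Mat d} (hB : Sandwich κ B) (x : Fin d → ℝ) :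
    (B⁻¹ *ᵥ x) ⬝ᵥ (B⁻¹ *ᵥ x) ≤ x ⬝ᵥ x := by
  have hdet : IsUnit Bᵀ.det := by
    rw [det_transpose]; exact (isUnit_iff_isUnit_det B).1 hB.isUnit
  have h : ∀ x, ((B⁻¹)ᵀ *ᵥ x) ⬝ᵥ ((B⁻¹)ᵀ *ᵥ x) ≤ 1 * (x ⬝ᵥ x) := fun x => by
    have := (hB ((B⁻¹)ᵀ *ᵥ x)).1
    rw [mulVec_mulVec, transpose_nonsing_inv, mul_nonsing_inv _ hdet, one_mulVec] at this
    rwa [transpose_nonsing_inv, one_mul]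
  simpa using mulVec_dot_le_of_transpose zero_le_one h x

/-- The deviation of the empirical second moment matrix from the identity. -/
noncomputable def empDev (g : Fin n → Vec d) : Mat d :=
  (1 / (n : ℝ)) • (∑ i, vecMulVec (g i).ofLp (g i).ofLp) - 1

theorem empDev_transpose (g : Fin n → Vec d) : (empDev g)ᵀ = empDev g := by
  simp [empDev, transpose_sum, transpose_vecMulVec]

theorem applyAll_applyAll (A B : Mat d) (X : Fin n → Vec d) :
    applyAll A (applyAll B X) = applyAll (A * B) X := by
  funext i
  simp [applyAll]

theorem norm_sq_toLp (x : Fin d → ℝ) : ‖(WithLp.toLp 2 x : Vec d)‖ ^ 2 = x ⬝ᵥ x := by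
  rw [EuclideanSpace.real_norm_sq_eq]
  simp [dotProduct, sq]

theorem norm_sq_eq_dot (x : Vec d) : ‖x‖ ^ 2 = x.ofLp ⬝ᵥ x.ofLp := norm_sq_toLp x.ofLp

/-- If no sample is truncated, then the truncated second moment matrix is the empirical one. -/
theorem truncCov_applyAll {r κ R : ℝ} {B : Mat d} (hκ : 0 ≤ κ)
    (hB : ∀ x, (Bᵀ *ᵥ x) ⬝ᵥ (Bᵀ *ᵥ x) ≤ κ * (x ⬝ᵥ x)) {g : Fin n → Vec d}
    (hg : ∀ i, ‖g i‖ ^ 2 ≤ R) (hr : κ * R ≤ r) :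
    truncCov r (applyAll B g) = B * (1 + empDev g) * Bᵀ := by
  have h1 : ∀ i, ‖applyAll B g i‖ ^ 2 ≤ r := fun i => by
    rw [applyAll, norm_sq_toLp]
    refine (mulVec_dot_le_of_transpose hκ hB _).trans (le_trans ?_ hr)
    rw [← norm_sq_eq_dot]
    exact mul_le_mul_of_nonneg_left (hg i) hκ
  rw [truncCov, Finset.filter_true_of_mem fun i _ => h1 i, empDev, add_sub_cancel, mul_smul_comm,
    smul_mul_assoc, Matrix.mul_sum, Matrix.sum_mul]
  congr 1
  refine Finset.sum_congr rfl fun i _ => ?_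
  rw [mul_vecMulVec, vecMulVec_mul, vecMul_transpose]
  rfl

theorem posSemidef_conj_empDev (B : Mat d) (g : Fin n → Vec d) :
    (B * (1 + empDev g) * Bᵀ).PosSemidef := by
  have h : (1 + empDev g).PosSemidef := by
    rw [empDev, add_sub_cancel]
    refine PosSemidef.smul (posSemidef_sum _ fun i _ => ?_) (by positivity)
    simpa using posSemidef_vecMulVec_self_star (g i).ofLp
  simpa using h.mul_mul_conjTranspose_same B

/-- The error of PGCE in the Mahalanobis norm, for a successful preconditioner. -/
theorem relNorm_le {κ : ℝ} {S A N : Mat d} {g : Fin n → Vec d} (hS : S.PosSemidef)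
    (hA : Sandwich κ (A * CFC.sqrt S)) (hNt : Nᵀ = N) :
    relNorm S (S - A⁻¹ * psdProj ((A * CFC.sqrt S) * (1 + empDev g) * (A * CFC.sqrt S)ᵀ + N) *
      (A⁻¹)ᵀ) ≤ frobNorm (empDev g) + frobNorm N := by
  set Q := CFC.sqrt S with hQ
  set B := A * Q with hB
  set Y := B * (1 + empDev g) * Bᵀ with hY
  set Z := psdProj (Y + N) with hZ
  have hBu := (isUnit_iff_isUnit_det _).1 hA.isUnit
  rw [hB, det_mul] at hBu
  have hAu : IsUnit A.det := isUnit_of_mul_isUnit_left hBu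
  have hQu : IsUnit Q.det := isUnit_of_mul_isUnit_right hBu
  have hBd : IsUnit B.det := by rw [hB, det_mul]; exact hBu
  have hQQ : Q * Q = S := CFC.sqrt_mul_sqrt_self _ (nonneg_iff_posSemidef.2 hS)
  have hQt : Qᵀ = Q := by
    rw [← conjTranspose_eq_transpose_of_trivial]
    exact (CFC.sqrt_nonneg S).isSelfAdjoint
  have hBi : B⁻¹ = Q⁻¹ * A⁻¹ := by rw [hB, Matrix.mul_inv_rev]
  have hBit : (B⁻¹)ᵀ = (A⁻¹)ᵀ * Q⁻¹ := by
    rw [hBi, transpose_mul, transpose_nonsing_inv Q, hQt]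
  -- Whitening by Q = S^{1/2} merges with undoing A: only B = A Q is left.
  have h1 : Q⁻¹ * (S - A⁻¹ * Z * (A⁻¹)ᵀ) * Q⁻¹ = 1 - B⁻¹ * Z * (B⁻¹)ᵀ := by
    have e1 : Q⁻¹ * S * Q⁻¹ = 1 := by
      rw [← hQQ, ← mul_assoc, nonsing_inv_mul _ hQu, one_mul, mul_nonsing_inv _ hQu]
    rw [mul_sub, sub_mul, e1, hBit, hBi]
    simp only [mul_assoc]
  have h2 : B⁻¹ * Y * (B⁻¹)ᵀ = 1 + empDev g := by
    have e2 : Bᵀ * (B⁻¹)ᵀ = 1 := by rw [← transpose_mul, nonsing_inv_mul _ hBd, transpose_one]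
    rw [hY, ← mul_assoc, ← mul_assoc, nonsing_inv_mul _ hBd, one_mul, mul_assoc, e2, mul_one]
  rw [relNorm, ← hQ, h1]
  have hYt : Yᵀ = Y := by
    rw [hY]
    simp only [transpose_add, transpose_mul, transpose_transpose, transpose_one,
      empDev_transpose, mul_assoc]
  have neg_frob : ∀ M : Mat d, frobNorm (-M) = frobNorm M := fun M => by simp [frobNorm]
  calc frobNorm (1 - B⁻¹ * Z * (B⁻¹)ᵀ)
      ≤ frobNorm (1 - B⁻¹ * Y * (B⁻¹)ᵀ) + frobNorm (B⁻¹ * Y * (B⁻¹)ᵀ - B⁻¹ * Z * (B⁻¹)ᵀ) :=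
        frobNorm_sub_le _ _ _
    _ = frobNorm (empDev g) + frobNorm (B⁻¹ * (Z - Y) * (B⁻¹)ᵀ) := by
        rw [h2, sub_add_cancel_left, neg_frob, ← h2, ← neg_frob (B⁻¹ * (Z - Y) * (B⁻¹)ᵀ)]
        simp only [mul_sub, sub_mul, neg_sub]
    _ ≤ frobNorm (empDev g) + frobNorm (Z - Y) := by
        gcongr
        exact frobNorm_conj_le hA.inv_contracts _
    _ ≤ frobNorm (empDev g) + frobNorm N := by
        gcongr
        -- The noiseless matrix Y is PSD, so projecting Y + N does not move it farther from Y than N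
        -- did.
        have := frobNorm_psdProj_sub_le (M := Y + N) (Y := Y)
          (by rw [transpose_add, hYt, hNt]) (posSemidef_conj_empDev B g)
        rwa [add_sub_cancel_left] at this

end Preconditioning

/-! ### Exponential moments and tails of Gaussian variables. -/

section GaussianTails

variable {ι : Type*} [Fintype ι]

/-- Markov's inequality in exponential form. -/
theorem measure_ge_le_exp {Ω : Type*} [MeasurableSpace Ω] {μ : Measure Ω} {f : Ω → ℝ}
    (hf : Measurable f) {s A : ℝ}
    (h : ∫⁻ x, ENNReal.ofReal (Real.exp (f x)) ∂μ ≤ ENNReal.ofReal (Real.exp A)) :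
    μ {x | s ≤ f x} ≤ ENNReal.ofReal (Real.exp (A - s)) := by
  have hs : {x | s ≤ f x} =
      {x | ENNReal.ofReal (Real.exp s) ≤ ENNReal.ofReal (Real.exp (f x))} := by
    ext x
    simp only [Set.mem_ofPred_eq]
    rw [ENNReal.ofReal_le_ofReal_iff (Real.exp_pos _).le, Real.exp_le_exp]
  have hpos : ENNReal.ofReal (Real.exp s) ≠ 0 := by simp [Real.exp_pos]
  rw [hs]
  refine (meas_ge_le_lintegral_div (by fun_prop) hpos ENNReal.ofReal_ne_top).trans ?_
  rw [ENNReal.div_le_iff hpos ENNReal.ofReal_ne_top, ← ENNReal.ofReal_mul (Real.exp_pos _).le,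
    ← Real.exp_add, sub_add_cancel]
  exact h

theorem lintegral_exp_sum_pi_gaussianReal (v : NNReal) (c : ι → ℝ) :
    ∫⁻ g, ENNReal.ofReal (Real.exp (∑ i, c i * g i)) ∂Measure.pi (fun _ : ι => gaussianReal 0 v) =
      ENNReal.ofReal (Real.exp (v * (∑ i, c i ^ 2) / 2)) := by
  have e : ∀ g : ι → ℝ, ENNReal.ofReal (Real.exp (∑ i, c i * g i)) =
      ∏ i, ENNReal.ofReal (Real.exp (c i * g i)) := fun g => by
    rw [Real.exp_sum, ENNReal.ofReal_prod_of_nonneg fun i _ => (Real.exp_pos _).le]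
  simp_rw [e]
  rw [lintegral_pi_prod (fun _ : ι => gaussianReal 0 v)
    (f := fun i x => ENNReal.ofReal (Real.exp (c i * x))) fun i => by fun_prop]
  simp_rw [lintegral_exp_mul_gaussianReal]
  rw [← ENNReal.ofReal_prod_of_nonneg fun i _ => (Real.exp_pos _).le, ← Real.exp_sum]
  congr 2
  rw [Finset.mul_sum, Finset.sum_div]
  exact Finset.sum_congr rfl fun i _ => by ring

/-- Chernoff's bound with parameter s/V, optimal when the variance is exactly V; an upper bound on
the variance suffices. -/
theorem pi_gaussianReal_tail (v : NNReal) (c : ι → ℝ) {V s : ℝ} (hV : 0 < V)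
    (hs : 0 < s) (hc : v * ∑ i, c i ^ 2 ≤ V) :
    Measure.pi (fun _ : ι => gaussianReal 0 v) {g | s ≤ ∑ i, c i * g i} ≤
      ENNReal.ofReal (Real.exp (-(s ^ 2 / (2 * V)))) := by
  have e : {g : ι → ℝ | s ≤ ∑ i, c i * g i} =
      {g : ι → ℝ | s ^ 2 / V ≤ ∑ i, s / V * c i * g i} := by
    ext g
    simp only [Set.mem_ofPred_eq, mul_assoc, ← Finset.mul_sum]
    rw [sq, mul_div_assoc, mul_comm s, mul_le_mul_iff_right₀ (div_pos hs hV)]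
  rw [e]
  refine (measure_ge_le_exp (A := s ^ 2 / (2 * V)) (by fun_prop) ?_).trans ?_
  · rw [lintegral_exp_sum_pi_gaussianReal]
    refine ENNReal.ofReal_le_ofReal (Real.exp_le_exp.2 ?_)
    simp_rw [mul_pow]
    rw [← Finset.mul_sum]
    calc _ = (s / V) ^ 2 * (v * ∑ i, c i ^ 2) / 2 := by ring
      _ ≤ (s / V) ^ 2 * V / 2 := by gcongr
      _ = _ := by field_simp
  · refine ENNReal.ofReal_le_ofReal (Real.exp_le_exp.2 (le_of_eq ?_))
    field_simp
    ring

theorem pi_gaussianReal_abs_tail (v : NNReal) (c : ι → ℝ) {V s : ℝ} (hV : 0 < V) (hs : 0 < s)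
    (hc : v * ∑ i, c i ^ 2 ≤ V) :
    Measure.pi (fun _ : ι => gaussianReal 0 v) {g | s ≤ |∑ i, c i * g i|} ≤
      ENNReal.ofReal (2 * Real.exp (-(s ^ 2 / (2 * V)))) := by
  have hsub : {g : ι → ℝ | s ≤ |∑ i, c i * g i|} ⊆
      {g | s ≤ ∑ i, c i * g i} ∪ {g | s ≤ ∑ i, (-c i) * g i} := by
    intro g hg
    simp only [Set.mem_union, Set.mem_ofPred_eq, neg_mul, Finset.sum_neg_distrib] at hg ⊢
    exact le_abs.1 hg
  refine (measure_mono hsub).trans ((measure_union_le _ _).trans ?_)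
  rw [two_mul, ENNReal.ofReal_add (Real.exp_pos _).le (Real.exp_pos _).le]
  exact add_le_add (pi_gaussianReal_tail v c hV hs hc)
    (pi_gaussianReal_tail v (fun i => -c i) hV hs (by simpa using hc))

theorem pi_gaussianReal_coord_tail (v : NNReal) (hv : v ≠ 0) {s : ℝ} (hs : 0 < s) :
    Measure.pi (fun _ : ι => gaussianReal 0 v) {g | ∃ i, s ≤ |g i|} ≤
      ENNReal.ofReal (Fintype.card ι * (2 * Real.exp (-(s ^ 2 / (2 * v))))) := by
  classical
  have hsub : {g : ι → ℝ | ∃ i, s ≤ |g i|} ⊆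
      ⋃ i, {g | s ≤ |∑ j, (Pi.single i 1 : ι → ℝ) j * g j|} := by
    intro g ⟨i, hi⟩
    refine Set.mem_iUnion.2 ⟨i, ?_⟩
    simpa [Pi.single_apply] using hi
  refine (measure_mono hsub).trans ((measure_iUnion_fintype_le _ _).trans ?_)
  rw [ENNReal.ofReal_mul (Nat.cast_nonneg _), ENNReal.ofReal_natCast, ← nsmul_eq_mul,
    ← Finset.card_univ]
  refine Finset.sum_le_card_nsmul _ _ _ fun i _ => ?_
  refine pi_gaussianReal_abs_tail v _ (by positivity) hs ?_
  simp [Pi.single_apply, ite_pow]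

theorem stdGaussian_norm_tail (d : ℕ) {s : ℝ} (hs : 0 < s) :
    stdGaussian (Vec d) {x | d * s ^ 2 < ‖x‖ ^ 2} ≤
      ENNReal.ofReal (d * (2 * Real.exp (-(s ^ 2 / 2)))) := by
  have hm : MeasurableSet {x : Vec d | d * s ^ 2 < ‖x‖ ^ 2} :=
    measurableSet_lt measurable_const (by fun_prop)
  rw [← map_pi_eq_stdGaussian, Measure.map_apply (by fun_prop) hm]
  have h := pi_gaussianReal_coord_tail (ι := Fin d) 1 one_ne_zero hs
  simp only [NNReal.coe_one, mul_one, Fintype.card_fin] at h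
  refine (measure_mono fun g hg => ?_).trans h
  by_contra hc
  simp only [Set.mem_ofPred_eq, not_exists, not_le] at hc
  simp only [Set.mem_preimage, Set.mem_ofPred_eq, EuclideanSpace.real_norm_sq_eq] at hg
  refine hg.not_ge ?_
  calc ∑ i, g i ^ 2 ≤ ∑ _i : Fin d, s ^ 2 := Finset.sum_le_sum fun i _ => by
        rw [← sq_abs]
        gcongr
        exact (hc i).le
    _ = d * s ^ 2 := by simp

theorem pi_stdGaussian_norm_tail (n d : ℕ) {s : ℝ} (hs : 0 < s) :
    Measure.pi (fun _ : Fin n => stdGaussian (Vec d)) {g | ∃ i, d * s ^ 2 < ‖g i‖ ^ 2} ≤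
      ENNReal.ofReal (n * (d * (2 * Real.exp (-(s ^ 2 / 2))))) := by
  have hsub : {g : Fin n → Vec d | ∃ i, d * s ^ 2 < ‖g i‖ ^ 2} =
      ⋃ i, (Function.eval i) ⁻¹' {x : Vec d | d * s ^ 2 < ‖x‖ ^ 2} := by
    ext g
    simp
  rw [hsub]
  refine (measure_iUnion_fintype_le _ _).trans ?_
  rw [ENNReal.ofReal_mul (Nat.cast_nonneg _), ENNReal.ofReal_natCast]
  refine (Finset.sum_le_card_nsmul Finset.univ _
    (ENNReal.ofReal (d * (2 * Real.exp (-(s ^ 2 / 2))))) fun i _ => ?_).trans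
      (by simp [nsmul_eq_mul])
  rw [(measurePreserving_eval (fun _ : Fin n => stdGaussian (Vec d)) i).measure_preimage
    (measurableSet_lt measurable_const (by fun_prop)).nullMeasurableSet]
  exact stdGaussian_norm_tail d hs

/-- Multiplying the standard density by exp(t x²) gives a multiple of the density of variance 1/(1 -
2t). -/
theorem lintegral_exp_sq_gaussianReal {t : ℝ} (ht : t < 1 / 2) :
    ∫⁻ x, ENNReal.ofReal (Real.exp (t * x ^ 2)) ∂gaussianReal 0 1 =
      ENNReal.ofReal (1 / √(1 - 2 * t)) := by
  have h0 : 0 < 1 - 2 * t := by linarith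
  set w : NNReal := ⟨1 / (1 - 2 * t), (one_div_pos.2 h0).le⟩ with hw
  have hwc : (w : ℝ) = 1 / (1 - 2 * t) := rfl
  have hw0 : w ≠ 0 := by
    rw [← NNReal.coe_ne_zero, hwc]
    exact (one_div_pos.2 h0).ne'
  rw [gaussianReal_of_var_ne_zero 0 one_ne_zero,
    lintegral_withDensity_eq_lintegral_mul _ (measurable_gaussianPDF 0 1) (by fun_prop)]
  have e : ∀ x, (gaussianPDF 0 1 * fun x => ENNReal.ofReal (Real.exp (t * x ^ 2))) x =
      ENNReal.ofReal (1 / √(1 - 2 * t)) * gaussianPDF 0 w x := by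
    intro x
    simp only [Pi.mul_apply, gaussianPDF, gaussianPDFReal]
    rw [← ENNReal.ofReal_mul (by positivity), ← ENNReal.ofReal_mul (by positivity), mul_assoc,
      ← Real.exp_add, ← mul_assoc]
    congr 2
    · rw [hwc, NNReal.coe_one, mul_one, mul_one_div, Real.sqrt_div (by positivity)]
      have := (Real.sqrt_pos.2 h0).ne'
      field_simp
    · rw [hwc, NNReal.coe_one]
      field_simp
      ring_nf
  simp_rw [e]
  rw [lintegral_const_mul _ (measurable_gaussianPDF 0 w), lintegral_gaussianPDF_eq_one 0 hw0,
    mul_one]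

theorem one_sub_ge_exp {y : ℝ} (hy : |y| ≤ 1 / 2) : Real.exp (-y - 2 * y ^ 2) ≤ 1 - y := by
  obtain ⟨h1, h2⟩ := abs_le.1 hy
  have h3 : 0 < 1 - y := by linarith
  rw [← Real.le_log_iff_exp_le h3]
  have h := Real.abs_log_sub_add_sum_range_le (x := y) (by linarith) 1
  simp only [Finset.range_one, Finset.sum_singleton, zero_add, pow_one, Nat.cast_zero, div_one,
    one_add_one_eq_two, sq_abs] at h
  have h4 : y ^ 2 / (1 - |y|) ≤ 2 * y ^ 2 := by
    rw [div_le_iff₀ (by linarith)]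
    nlinarith [sq_nonneg y]
  linarith [(abs_le.1 h).1]

/-- Centering cancels the linear term of -log(1 - 2t)/2 and leaves a quadratic exponent. -/
theorem lintegral_exp_sq_centered_le {t : ℝ} (ht : |t| ≤ 1 / 4) :
    ∫⁻ x, ENNReal.ofReal (Real.exp (t * (x ^ 2 - 1))) ∂gaussianReal 0 1 ≤
      ENNReal.ofReal (Real.exp (4 * t ^ 2)) := by
  obtain ⟨h1, h2⟩ := abs_le.1 ht
  have h0 : 0 < 1 - 2 * t := by linarith
  have e : ∀ x, ENNReal.ofReal (Real.exp (t * (x ^ 2 - 1))) =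
      ENNReal.ofReal (Real.exp (-t)) * ENNReal.ofReal (Real.exp (t * x ^ 2)) := fun x => by
    rw [← ENNReal.ofReal_mul (Real.exp_pos _).le, ← Real.exp_add]
    ring_nf
  simp_rw [e]
  rw [lintegral_const_mul _ (by fun_prop), lintegral_exp_sq_gaussianReal (by linarith),
    ← ENNReal.ofReal_mul (Real.exp_pos _).le]
  refine ENNReal.ofReal_le_ofReal ?_
  have h3 : Real.exp (-t - 4 * t ^ 2) ≤ √(1 - 2 * t) := by
    refine Real.le_sqrt_of_sq_le ?_
    have := one_sub_ge_exp (y := 2 * t) (by rw [abs_mul, abs_two]; linarith)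
    rw [← Real.exp_nat_mul]
    refine le_trans (Real.exp_le_exp.2 (le_of_eq ?_)) this
    push_cast
    ring
  rw [mul_one_div, div_le_iff₀ (Real.sqrt_pos.2 h0)]
  calc Real.exp (-t) = Real.exp (4 * t ^ 2) * Real.exp (-t - 4 * t ^ 2) := by
        rw [← Real.exp_add]; ring_nf
    _ ≤ _ := by gcongr

end GaussianTails

/-! ### Concentration of Gaussian quadratic forms. -/

section QuadraticForms

variable {n d : ℕ}

theorem sum_eigenvalues_sq {H : Mat d} (hH : H.IsHermitian) :
    ∑ j, hH.eigenvalues j ^ 2 = frobNorm H ^ 2 := by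
  have ht : Hᵀ = H := by rw [← conjTranspose_eq_transpose_of_trivial]; exact hH
  have h1 : frobNorm H ^ 2 = (H * H).trace := by
    rw [frobNorm_sq]
    simp_rw [sq]
    rw [frobInner_eq_trace, ht]
  rw [h1]
  conv_rhs => rw [hH.spectral_theorem, ← map_mul, Unitary.conjStarAlgAut_apply, trace_mul_cycle,
    Unitary.coe_star_mul_self, one_mul, diagonal_mul_diagonal, trace_diagonal]
  simp [sq]

theorem dot_mulVec_sum_eigenvectorBasis {H : Mat d} (hH : H.IsHermitian) (g : Fin d → ℝ) :
    (∑ j, g j • hH.eigenvectorBasis j).ofLp ⬝ᵥ (H *ᵥ (∑ j, g j • hH.eigenvectorBasis j).ofLp) =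
      ∑ j, hH.eigenvalues j * g j ^ 2 := by
  set b := hH.eigenvectorBasis with hb
  have h1 : H *ᵥ (∑ j, g j • b j).ofLp = (∑ j, (hH.eigenvalues j * g j) • b j).ofLp := by
    simp only [WithLp.ofLp_sum, WithLp.ofLp_smul, mulVec_sum, mulVec_smul]
    refine Finset.sum_congr rfl fun j _ => ?_
    rw [hb, hH.mulVec_eigenvectorBasis, smul_smul, mul_comm]
  have h2 : ∀ x y : Vec d, x.ofLp ⬝ᵥ y.ofLp = inner ℝ x y := fun x y => by
    rw [EuclideanSpace.inner_eq_star_dotProduct, dotProduct_comm]; simp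
  rw [h1, h2, b.orthonormal.inner_sum]
  refine Finset.sum_congr rfl fun j _ => ?_
  simp only [conj_trivial]
  ring

/-- In an eigenbasis of H the vector is still standard Gaussian and the form is a sum of independent
centered squares weighted by eigenvalues. The eigenvalue squares sum to ‖H‖_F² ≤ 1, which bounds the
total exponent and keeps each factor in the admissible range. -/
theorem lintegral_exp_quadratic_le_of_isHermitian {H : Mat d} (hH : H.IsHermitian)
    (hf : frobNorm H ≤ 1) {t : ℝ} (ht : |t| ≤ 1 / 4) :
    ∫⁻ x, ENNReal.ofReal (Real.exp (t * (x.ofLp ⬝ᵥ (H *ᵥ x.ofLp) - H.trace)))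
      ∂stdGaussian (Vec d) ≤ ENNReal.ofReal (Real.exp (4 * t ^ 2)) := by
  have hs := sum_eigenvalues_sq hH
  set ev := hH.eigenvalues with hev
  have hle : ∑ j, ev j ^ 2 ≤ 1 := by
    rw [hs]; exact pow_le_one₀ (frobNorm_nonneg _) hf
  have hev1 : ∀ j, |ev j| ≤ 1 := fun j => by
    have := Finset.single_le_sum (f := fun j => ev j ^ 2) (fun i _ => sq_nonneg _)
      (Finset.mem_univ j)
    exact (sq_le_one_iff_abs_le_one _).1 (this.trans hle)
  have htr : H.trace = ∑ j, ev j := by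
    rw [hH.trace_eq_sum_eigenvalues]; rfl
  have hm : Measurable fun x : Vec d =>
      ENNReal.ofReal (Real.exp (t * (x.ofLp ⬝ᵥ (H *ᵥ x.ofLp) - H.trace))) := by
    simp only [dot_mulVec_eq_sum]
    fun_prop
  rw [stdGaussian_eq_map_pi_orthonormalBasis hH.eigenvectorBasis, lintegral_map hm (by fun_prop)]
  have e : ∀ g : Fin d → ℝ, ENNReal.ofReal (Real.exp (t *
      ((∑ j, g j • hH.eigenvectorBasis j).ofLp ⬝ᵥ
        (H *ᵥ (∑ j, g j • hH.eigenvectorBasis j).ofLp) - H.trace))) =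
      ∏ j, ENNReal.ofReal (Real.exp (t * ev j * (g j ^ 2 - 1))) := fun g => by
    rw [dot_mulVec_sum_eigenvectorBasis, htr, ← hev, ← Finset.sum_sub_distrib, Finset.mul_sum,
      Real.exp_sum, ENNReal.ofReal_prod_of_nonneg fun i _ => (Real.exp_pos _).le]
    exact Finset.prod_congr rfl fun j _ => by ring_nf
  simp_rw [e]
  rw [lintegral_pi_prod (fun _ : Fin d => gaussianReal 0 1)
    (f := fun j x => ENNReal.ofReal (Real.exp (t * ev j * (x ^ 2 - 1)))) fun i => by fun_prop]
  calc _ ≤ ∏ j, ENNReal.ofReal (Real.exp (4 * (t * ev j) ^ 2)) :=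
        Finset.prod_le_prod' fun j _ => lintegral_exp_sq_centered_le (by
          rw [abs_mul]
          calc |t| * |ev j| ≤ |t| * 1 := by gcongr; exact hev1 j
            _ ≤ 1 / 4 := by linarith)
    _ = ENNReal.ofReal (Real.exp (4 * t ^ 2 * ∑ j, ev j ^ 2)) := by
        rw [← ENNReal.ofReal_prod_of_nonneg fun i _ => (Real.exp_pos _).le, ← Real.exp_sum,
          Finset.mul_sum]
        congr 3 with j
        ring
    _ ≤ _ := by
        refine ENNReal.ofReal_le_ofReal (Real.exp_le_exp.2 ?_)
        nlinarith [sq_nonneg t]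

/-- Symmetrizing M changes neither the form nor the trace and does not increase the Frobenius norm.
General M is needed because the directions in the volume argument range over all matrices. -/
theorem lintegral_exp_quadratic_le {M : Mat d} (hf : frobNorm M ≤ 1) {t : ℝ} (ht : |t| ≤ 1 / 4) :
    ∫⁻ x, ENNReal.ofReal (Real.exp (t * (x.ofLp ⬝ᵥ (M *ᵥ x.ofLp) - M.trace)))
      ∂stdGaussian (Vec d) ≤ ENNReal.ofReal (Real.exp (4 * t ^ 2)) := by
  set H : Mat d := (1 / 2 : ℝ) • (M + Mᵀ) with hH
  have hHt : Hᵀ = H := by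
    rw [hH, transpose_smul, transpose_add, transpose_transpose, add_comm]
  have hHf : frobNorm H ≤ 1 := by
    have e : ∀ N : Mat d, frobNorm (M - N) ≤ frobNorm M + frobNorm N := fun N => by
      simpa [frobNorm] using frobNorm_sub_le M 0 N
    have h1 : frobNorm H = 1 / 2 * frobNorm (M - -Mᵀ) := by
      rw [hH, sub_neg_eq_add]
      simp only [frobNorm, Matrix.smul_apply, smul_eq_mul, mul_pow, ← Finset.mul_sum]
      rw [Real.sqrt_mul (by positivity), Real.sqrt_sq (by norm_num)]
    have h2 : frobNorm (-Mᵀ) = frobNorm M := by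
      rw [← frobNorm_transpose M]; simp [frobNorm]
    have h3 := e (-Mᵀ)
    rw [h1]
    linarith
  have hq : ∀ x : Fin d → ℝ, x ⬝ᵥ (M *ᵥ x) = x ⬝ᵥ (H *ᵥ x) := fun x => by
    rw [hH, smul_mulVec, add_mulVec, dotProduct_smul, dotProduct_add, mulVec_transpose,
      dotProduct_comm x (x ᵥ* M), ← dotProduct_mulVec, smul_eq_mul]
    ring
  have htr : M.trace = H.trace := by
    rw [hH, trace_smul, trace_add, trace_transpose, smul_eq_mul]
    ring
  simp_rw [hq, htr]
  exact lintegral_exp_quadratic_le_of_isHermitian (isHermitian_of_transpose hHt) hHf ht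

theorem trace_vecMulVec_mul (M : Mat d) (x : Fin d → ℝ) :
    ∑ i, ∑ j, M i j * vecMulVec x x i j = x ⬝ᵥ (M *ᵥ x) := by
  rw [dot_mulVec_eq_sum]
  rfl

theorem frobInner_empDev (hn : n ≠ 0) (M : Mat d) (g : Fin n → Vec d) :
    ∑ i, ∑ j, M i j * empDev g i j =
      1 / (n : ℝ) * ∑ k, ((g k).ofLp ⬝ᵥ (M *ᵥ (g k).ofLp) - M.trace) := by
  have hn' : (n : ℝ) ≠ 0 := by exact_mod_cast hn
  rw [Finset.sum_sub_distrib, mul_sub]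
  simp_rw [← trace_vecMulVec_mul]
  have h1 : 1 / (n : ℝ) * ∑ _k : Fin n, M.trace = ∑ i, ∑ j, M i j * (1 : Mat d) i j := by
    simp [trace, Matrix.one_apply, hn']
  have h2 : ∑ k, ∑ i, ∑ j, M i j * vecMulVec (g k).ofLp (g k).ofLp i j =
      ∑ i, ∑ j, M i j * ∑ k, vecMulVec (g k).ofLp (g k).ofLp i j := by
    rw [Finset.sum_comm]
    refine Finset.sum_congr rfl fun i _ => ?_
    rw [Finset.sum_comm]
    exact Finset.sum_congr rfl fun j _ => (Finset.mul_sum _ _ _).symm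
  rw [h1, h2, Finset.mul_sum, ← Finset.sum_sub_distrib]
  refine Finset.sum_congr rfl fun i _ => ?_
  rw [Finset.mul_sum, ← Finset.sum_sub_distrib]
  refine Finset.sum_congr rfl fun j _ => ?_
  simp only [empDev, Matrix.sub_apply, Matrix.smul_apply, Matrix.sum_apply, smul_eq_mul]
  ring

theorem measurable_quadratic (M : Mat d) :
    Measurable fun x : Vec d => x.ofLp ⬝ᵥ (M *ᵥ x.ofLp) := by
  simp only [dot_mulVec_eq_sum]
  fun_prop

/-- Concentration of a fixed linear functional of the empirical second moment matrix. -/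
theorem frobInner_empDev_tail (hn : n ≠ 0) {M : Mat d} (hf : frobNorm M ≤ 1) {s : ℝ} (hs : 0 ≤ s)
    (hs1 : s ≤ 2) :
    Measure.pi (fun _ : Fin n => stdGaussian (Vec d))
      {g | s ≤ ∑ i, ∑ j, M i j * empDev g i j} ≤
      ENNReal.ofReal (Real.exp (-(n * s ^ 2 / 16))) := by
  have hn' : (0 : ℝ) < n := by exact_mod_cast Nat.pos_of_ne_zero hn
  have hm := measurable_quadratic M
  rcases hs.eq_or_lt with h0 | h0
  · rw [← h0]
    simpa using prob_le_one
  -- Chernoff parameter s/8: the threshold n s²/8 exceeds the exponent bound n · 4(s/8)² by n s²/16,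
  -- and s ≤ 2 keeps s/8 ≤ 1/4.
  have e : {g : Fin n → Vec d | s ≤ ∑ i, ∑ j, M i j * empDev g i j} =
      {g | n * s ^ 2 / 8 ≤ ∑ k, s / 8 * ((g k).ofLp ⬝ᵥ (M *ᵥ (g k).ofLp) - M.trace)} := by
    ext g
    simp only [Set.mem_ofPred_eq]
    rw [frobInner_empDev hn, ← Finset.mul_sum, one_div_mul_eq_div, le_div_iff₀ hn',
      show n * s ^ 2 / 8 = s / 8 * (s * n) by ring, mul_le_mul_iff_right₀ (by positivity)]
  rw [e]
  refine (measure_ge_le_exp (A := n * (s ^ 2 / 16)) ?_ ?_).trans ?_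
  · exact Finset.measurable_sum _ fun k _ =>
      ((hm.comp (measurable_pi_apply k)).sub_const _).const_mul _
  · have e2 : ∀ g : Fin n → Vec d,
        ENNReal.ofReal (Real.exp (∑ k, s / 8 * ((g k).ofLp ⬝ᵥ (M *ᵥ (g k).ofLp) - M.trace))) =
        ∏ k, ENNReal.ofReal (Real.exp (s / 8 * ((g k).ofLp ⬝ᵥ (M *ᵥ (g k).ofLp) - M.trace))) :=
      fun g => by
        rw [Real.exp_sum, ENNReal.ofReal_prod_of_nonneg fun i _ => (Real.exp_pos _).le]
    simp_rw [e2]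
    rw [lintegral_pi_prod (fun _ : Fin n => stdGaussian (Vec d))
      (f := fun _ x => ENNReal.ofReal (Real.exp (s / 8 * (x.ofLp ⬝ᵥ (M *ᵥ x.ofLp) - M.trace))))
      fun k => by
        exact ((hm.sub_const _).const_mul _).exp.ennreal_ofReal]
    calc _ ≤ ∏ _k : Fin n, ENNReal.ofReal (Real.exp (4 * (s / 8) ^ 2)) :=
          Finset.prod_le_prod' fun k _ => lintegral_exp_quadratic_le hf (by
            rw [abs_of_nonneg (by positivity)]; linarith)
      _ = _ := by
          rw [← ENNReal.ofReal_prod_of_nonneg fun i _ => (Real.exp_pos _).le, ← Real.exp_sum]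
          congr 2
          rw [Finset.sum_const, Finset.card_univ, Fintype.card_fin, nsmul_eq_mul]
          ring
  · refine ENNReal.ofReal_le_ofReal (Real.exp_le_exp.2 (le_of_eq ?_))
    ring

end QuadraticForms

/-! ### A union bound by volume. -/

section Volume

/-- A union bound over a continuum: if every bad outcome is witnessed by a ball of radius `r` in
the unit ball of a `D`-dimensional space, and every single witness has probability at most `δ`, then
the bad outcomes have probability at most `(1 / r) ^ D * δ`. -/
theorem measure_le_of_ball_witness {ι Ω : Type*} [Fintype ι] [MeasurableSpace Ω] (μ : Measure Ω)
    [IsProbabilityMeasure μ] {s : Set Ω} {T : Set (Ω × EuclideanSpace ℝ ι)} (hT : MeasurableSet T)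
    (hs : MeasurableSet s) {r : ℝ} (hr : 0 < r) {δ : ℝ≥0∞}
    (h1 : ∀ ω ∈ s, ∃ c : EuclideanSpace ℝ ι, ‖c‖ + r ≤ 1 ∧ ∀ v ∈ Metric.ball c r, (ω, v) ∈ T)
    (h2 : ∀ v : EuclideanSpace ℝ ι, ‖v‖ < 1 → μ {ω | (ω, v) ∈ T} ≤ δ) :
    μ s ≤ ENNReal.ofReal ((1 / r) ^ Fintype.card ι) * δ := by
  set vol : Measure (EuclideanSpace ℝ ι) := volume
  set b := vol (Metric.ball 0 1) with hb
  have hb0 : b ≠ 0 := (Metric.measure_ball_pos vol 0 one_pos).ne'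
  have hbt : b ≠ ⊤ := measure_ball_lt_top.ne
  set T' : Set (Ω × EuclideanSpace ℝ ι) := T ∩ {z | ‖z.2‖ < 1} with hT'
  have hT'm : MeasurableSet T' :=
    hT.inter (measurableSet_lt measurable_snd.norm measurable_const)
  have hlow : ∀ ω ∈ s, ENNReal.ofReal (r ^ Fintype.card ι) * b ≤ vol (Prod.mk ω ⁻¹' T') := by
    intro ω hω
    obtain ⟨c, hc, hcT⟩ := h1 ω hω
    have := Measure.addHaar_ball_of_pos vol c hr
    rw [finrank_euclideanSpace] at this
    rw [hb, ← this]
    refine measure_mono fun v hv => ⟨hcT v hv, ?_⟩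
    have h3 : ‖v - c‖ < r := by rwa [← dist_eq_norm]
    have h4 : ‖v‖ ≤ ‖v - c‖ + ‖c‖ := norm_le_norm_sub_add v c
    simp only [Set.mem_ofPred_eq]
    linarith
  have hup : ∀ v, μ ((fun ω => (ω, v)) ⁻¹' T') ≤ (Metric.ball 0 1).indicator (fun _ => δ) v := by
    intro v
    by_cases hv : v ∈ Metric.ball (0 : EuclideanSpace ℝ ι) 1
    · rw [Set.indicator_of_mem hv]
      exact (measure_mono fun ω hω => hω.1).trans (h2 v (by simpa using hv))
    · rw [Set.indicator_of_notMem hv]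
      refine le_of_eq (measure_mono_null (t := ∅) (fun ω hω => hv ?_) measure_empty)
      simpa using hω.2
  -- The measure of T' is computed in both orders. Each bad ω contributes at least the fraction r^D
  -- of the unit ball; each direction v contributes at most δ.
  have key : ENNReal.ofReal (r ^ Fintype.card ι) * b * μ s ≤ δ * b := by
    calc ENNReal.ofReal (r ^ Fintype.card ι) * b * μ s
        = ∫⁻ _ in s, ENNReal.ofReal (r ^ Fintype.card ι) * b ∂μ := by
          rw [setLIntegral_const]
      _ ≤ ∫⁻ ω in s, vol (Prod.mk ω ⁻¹' T') ∂μ := setLIntegral_mono' hs hlow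
      _ ≤ ∫⁻ ω, vol (Prod.mk ω ⁻¹' T') ∂μ := setLIntegral_le_lintegral _ _
      _ = ∫⁻ v, μ ((fun ω => (ω, v)) ⁻¹' T') ∂vol := by
          rw [← Measure.prod_apply hT'm, Measure.prod_apply_symm hT'm]
      _ ≤ ∫⁻ v, (Metric.ball 0 1).indicator (fun _ => δ) v ∂vol := lintegral_mono hup
      _ = δ * b := by rw [lintegral_indicator measurableSet_ball, setLIntegral_const]
  have hr0 : 0 < r ^ Fintype.card ι := by positivity
  rw [mul_right_comm, ENNReal.mul_le_mul_iff_left hb0 hbt, mul_comm] at key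
  rw [one_div, inv_pow, ENNReal.ofReal_inv_of_pos hr0, mul_comm, ← div_eq_mul_inv]
  rwa [ENNReal.le_div_iff_mul_le (by left; simpa using hr0) (by left; exact ENNReal.ofReal_ne_top)]

end Volume

/-! ### Frobenius and operator norm bounds for the sampling error and the noise. -/

section Concentration

variable {n d : ℕ}

theorem continuous_empDev : Continuous fun g : Fin n → Vec d => empDev g := by
  unfold empDev
  have h : Continuous fun g : Fin n → Vec d => ∑ i, vecMulVec (g i).ofLp (g i).ofLp :=
    continuous_finsetSum _ fun i _ => Continuous.matrix_vecMulVec (by fun_prop) (by fun_prop)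
  exact (h.const_smul (1 / (n : ℝ))).sub continuous_const

theorem continuous_frobNorm : Continuous (frobNorm : Mat d → ℝ) := by
  unfold frobNorm
  refine Real.continuous_sqrt.comp (continuous_finsetSum _ fun i _ => continuous_finsetSum _
    fun j _ => ?_)
  exact (continuous_id.matrix_elem i j).pow 2

/-- Concentration of the empirical second moment matrix in the Frobenius norm. -/
theorem frobNorm_empDev_tail (hn : n ≠ 0) {t : ℝ} (ht : 0 < t) (ht4 : t ≤ 4) :
    Measure.pi (fun _ : Fin n => stdGaussian (Vec d)) {g | t < frobNorm (empDev g)} ≤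
      ENNReal.ofReal (4 ^ (d * d) * Real.exp (-(n * t ^ 2 / 64))) := by
  set μ := Measure.pi (fun _ : Fin n => stdGaussian (Vec d))
  have hent : ∀ i j, Continuous fun g : Fin n → Vec d => empDev g i j := fun i j =>
    continuous_empDev.matrix_elem i j
  set T : Set ((Fin n → Vec d) × EuclideanSpace ℝ (Fin d × Fin d)) :=
    {z | t / 2 ≤ ∑ i, ∑ j, z.2 (i, j) * empDev z.1 i j} with hTdef
  have hT : MeasurableSet T := by
    refine measurableSet_le measurable_const (Finset.measurable_sum _ fun i _ =>
      Finset.measurable_sum _ fun j _ => Measurable.mul (by fun_prop) ?_)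
    exact (hent i j).measurable.comp measurable_fst
  have hs : MeasurableSet {g : Fin n → Vec d | t < frobNorm (empDev g)} :=
    measurableSet_lt measurable_const (continuous_frobNorm.comp continuous_empDev).measurable
  have h := measure_le_of_ball_witness μ (r := 1 / 4)
    (δ := ENNReal.ofReal (Real.exp (-(n * t ^ 2 / 64)))) hT hs (by norm_num) ?_ ?_
  · refine h.trans (le_of_eq ?_)
    rw [← ENNReal.ofReal_mul (by positivity)]
    simp
  · intro g hg
    simp only [Set.mem_ofPred_eq] at hg
    set W := empDev g with hW
    set f := frobNorm W with hf
    have hf0 : 0 < f := ht.trans hg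
    have hfsq : f ^ 2 = ∑ i, ∑ j, W i j ^ 2 := frobNorm_sq W
    set w : EuclideanSpace ℝ (Fin d × Fin d) := WithLp.toLp 2 fun p => W p.1 p.2 with hw
    have hwn : ‖w‖ = f := by
      rw [← sq_eq_sq₀ (norm_nonneg _) hf0.le, hfsq, EuclideanSpace.real_norm_sq_eq,
        Fintype.sum_prod_type]
    have hin : ∀ v : EuclideanSpace ℝ (Fin d × Fin d),
        ∑ i, ∑ j, v (i, j) * W i j = inner ℝ w v := fun v => by
      rw [PiLp.inner_apply, Fintype.sum_prod_type]
      rfl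
    -- Around the center 3/4 · W/‖W‖, every direction within 1/4 has inner product at least (3/4 -
    -- 1/4)‖W‖ > t/2 with W.
    refine ⟨(3 / 4 / f) • w, ?_, fun v hv => ?_⟩
    · rw [norm_smul, hwn, Real.norm_of_nonneg (by positivity), div_mul_cancel₀ _ hf0.ne']
      norm_num
    · simp only [hTdef, Set.mem_ofPred_eq, ← hW]
      rw [hin]
      set c := (3 / 4 / f) • w
      have hvc : ‖v - c‖ < 1 / 4 := by rwa [← dist_eq_norm]
      have e : inner ℝ w v = inner ℝ w (v - c) + 3 / 4 * f := by
        rw [inner_sub_right, inner_smul_right, real_inner_self_eq_norm_sq, hwn]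
        field_simp
        ring
      have hb := (abs_le.1 (abs_real_inner_le_norm w (v - c))).1
      rw [hwn] at hb
      have : f * ‖v - c‖ ≤ f * (1 / 4) := by gcongr
      rw [e]
      linarith
  · intro v hv
    have hM : frobNorm (Matrix.of fun i j => v (i, j)) ≤ 1 := by
      refine (sq_le_one_iff₀ (frobNorm_nonneg _)).1 ?_
      rw [frobNorm_sq]
      have : ‖v‖ ^ 2 ≤ 1 := pow_le_one₀ (norm_nonneg _) hv.le
      rwa [EuclideanSpace.real_norm_sq_eq, Fintype.sum_prod_type] at this
    refine (frobInner_empDev_tail hn hM (s := t / 2) (by positivity) (by linarith)).trans ?_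
    refine ENNReal.ofReal_le_ofReal (Real.exp_le_exp.2 (le_of_eq ?_))
    ring

theorem symMat_transpose (g : Fin d × Fin d → ℝ) : (symMat d g)ᵀ = symMat d g := by
  ext i j
  simp [symMat, min_comm, max_comm]

/-- The coefficients of the quadratic form of a symmetric matrix in its upper triangular part. -/
noncomputable def triCoeff (v : Fin d → ℝ) (p : Fin d × Fin d) : ℝ :=
  (if p.1 < p.2 then 2 else if p.1 = p.2 then 1 else 0) * (v p.1 * v p.2)

/-- Folding the lower triangle onto the upper one exhibits the form as linear in independent
entries, so that the Gaussian tail for linear functionals applies. -/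
theorem dot_symMat (g : Fin d × Fin d → ℝ) (v : Fin d → ℝ) :
    v ⬝ᵥ (symMat d g *ᵥ v) = ∑ p, triCoeff v p * g p := by
  set w : Fin d → Fin d → ℝ := fun i j => if i < j then 2 else if i = j then 1 else 0 with hw
  set h : Fin d → Fin d → ℝ := fun i j => g (min i j, max i j) * (v i * v j) with hh
  have hsymm : ∀ i j, h i j = h j i := fun i j => by
    simp only [hh]
    rw [min_comm, max_comm, mul_comm (v i)]
  have hw2 : ∀ i j, w i j + w j i = 2 := fun i j => by
    simp only [hw]
    rcases lt_trichotomy i j with h | h | h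
    · simp [h, h.not_gt, h.ne']
    · subst h; norm_num
    · simp [h, h.not_gt, h.ne']
  have h1 : ∑ i, ∑ j, w i j * h i j = ∑ i, ∑ j, w j i * h i j := by
    rw [Finset.sum_comm]
    exact Finset.sum_congr rfl fun i _ => Finset.sum_congr rfl fun j _ => by rw [hsymm]
  have h2 : 2 * ∑ i, ∑ j, h i j = ∑ i, ∑ j, w i j * h i j + ∑ i, ∑ j, w j i * h i j := by
    simp only [Finset.mul_sum, ← Finset.sum_add_distrib, ← add_mul, hw2]
  have h3 : ∑ i, ∑ j, h i j = ∑ i, ∑ j, w i j * h i j := by linarith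
  rw [dot_mulVec_eq_sum, Fintype.sum_prod_type]
  refine Eq.trans h3 (Finset.sum_congr rfl fun i _ => Finset.sum_congr rfl fun j _ => ?_)
  simp only [hw, hh, triCoeff]
  rcases lt_trichotomy i j with h | h | h
  · simp only [h, if_true, min_eq_left h.le, max_eq_right h.le]; ring
  · subst h; simp only [lt_irrefl, if_false, if_true, min_self, max_self]; ring
  · simp [h.not_gt, h.ne']

theorem sum_triCoeff_sq_le (v : Fin d → ℝ) : ∑ p, triCoeff v p ^ 2 ≤ 4 * (v ⬝ᵥ v) ^ 2 := by
  have h1 : ∀ p, triCoeff v p ^ 2 ≤ 4 * ((v p.1 * v p.1) * (v p.2 * v p.2)) := fun p => by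
    rw [triCoeff, mul_pow]
    have h0 : 0 ≤ (v p.1 * v p.2) ^ 2 := sq_nonneg _
    have h2 : (v p.1 * v p.1) * (v p.2 * v p.2) = (v p.1 * v p.2) ^ 2 := by ring
    rw [h2]
    split_ifs <;> linarith
  refine (Finset.sum_le_sum fun p _ => h1 p).trans (le_of_eq ?_)
  rw [← Finset.mul_sum, Fintype.sum_prod_type, sq (v ⬝ᵥ v), dotProduct, Finset.sum_mul_sum]

/-- Polarization. -/
theorem abs_dot_symm_le {N : Mat d} (hN : Nᵀ = N) {m : ℝ}
    (hm : ∀ x, |x ⬝ᵥ (N *ᵥ x)| ≤ m * (x ⬝ᵥ x)) {x y : Fin d → ℝ} :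
    |x ⬝ᵥ (N *ᵥ y)| ≤ m / 2 * (x ⬝ᵥ x + y ⬝ᵥ y) := by
  have hs : y ⬝ᵥ (N *ᵥ x) = x ⬝ᵥ (N *ᵥ y) := by
    rw [dotProduct_mulVec, ← mulVec_transpose, hN, dotProduct_comm]
  have h1 := abs_le.1 (hm (x + y))
  have h2 := abs_le.1 (hm (x - y))
  simp only [mulVec_add, mulVec_sub, add_dotProduct, sub_dotProduct, dotProduct_add,
    dotProduct_sub, hs, dotProduct_comm y x] at h1 h2
  rw [abs_le]
  constructor <;> nlinarith

/-- The witnesses are vectors near 7/8 · u, where u maximizes |u·Nu| on the sphere. Working with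
d-dimensional vectors instead of matrices gives the entropy factor 8^d. -/
theorem pi_symMat_opNorm_tail {v : NNReal} (hv : v ≠ 0) {τ : ℝ} (hτ : 0 < τ) :
    Measure.pi (fun _ : Fin d × Fin d => gaussianReal 0 v)
      {g | ∃ x, τ * (x ⬝ᵥ x) < |x ⬝ᵥ (symMat d g *ᵥ x)|} ≤
      ENNReal.ofReal (8 ^ d * (2 * Real.exp (-(τ ^ 2 / (32 * v))))) := by
  set μ := Measure.pi (fun _ : Fin d × Fin d => gaussianReal 0 v)
  set T : Set ((Fin d × Fin d → ℝ) × Vec d) :=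
    {z | τ / 2 ≤ |∑ p, triCoeff z.2.ofLp p * z.1 p|} with hTdef
  have hT : MeasurableSet T := by
    refine measurableSet_le measurable_const ?_
    have : Measurable fun z : (Fin d × Fin d → ℝ) × Vec d =>
        ∑ p, triCoeff z.2.ofLp p * z.1 p := by
      unfold triCoeff
      fun_prop
    exact measurable_norm.comp this
  have hs : MeasurableSet {g | ∃ x, τ * (x ⬝ᵥ x) < |x ⬝ᵥ (symMat d g *ᵥ x)|} := by
    have : {g | ∃ x, τ * (x ⬝ᵥ x) < |x ⬝ᵥ (symMat d g *ᵥ x)|} =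
        ⋃ x, {g | τ * (x ⬝ᵥ x) < |x ⬝ᵥ (symMat d g *ᵥ x)|} := by
      ext g; simp
    rw [this]
    -- The union is uncountable but its members are open.
    refine (isOpen_iUnion fun x => isOpen_lt continuous_const ?_).measurableSet
    simp only [dot_symMat]
    fun_prop
  have h := measure_le_of_ball_witness μ (r := 1 / 8)
    (δ := ENNReal.ofReal (2 * Real.exp (-(τ ^ 2 / (32 * v))))) hT hs (by norm_num) ?_ ?_
  · refine h.trans (le_of_eq ?_)
    rw [← ENNReal.ofReal_mul (by positivity)]
    simp
  · intro g ⟨x, hx⟩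
    set N := symMat d g with hN
    have hcont : Continuous fun u : Vec d => |u.ofLp ⬝ᵥ (N *ᵥ u.ofLp)| := by
      simp only [dot_mulVec_eq_sum]
      fun_prop
    have hx0 : 0 < x ⬝ᵥ x := by
      refine (dot_self_nonneg x).lt_of_ne fun h0 => ?_
      rw [dotProduct_self_eq_zero.1 h0.symm] at hx
      simp at hx
    obtain ⟨k, hk⟩ : ∃ k : ℝ, k * k * (x ⬝ᵥ x) = 1 := ⟨(√(x ⬝ᵥ x))⁻¹, by
      rw [← mul_inv, Real.mul_self_sqrt hx0.le, inv_mul_cancel₀ hx0.ne']⟩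
    have hsph : ∀ y : Fin d → ℝ, y ⬝ᵥ y = 1 ↔
        (WithLp.toLp 2 y : Vec d) ∈ Metric.sphere (0 : Vec d) 1 := fun y => by
      rw [mem_sphere_zero_iff_norm, ← norm_sq_toLp]
      exact pow_eq_one_iff_of_nonneg (norm_nonneg _) two_ne_zero
    have hkx : (k • x) ⬝ᵥ (k • x) = 1 := by
      rw [smul_dotProduct, dotProduct_smul, smul_eq_mul, smul_eq_mul, ← mul_assoc, hk]
    obtain ⟨u, hu, hmax⟩ := (isCompact_sphere (0 : Vec d) 1).exists_isMaxOn
      ⟨_, (hsph _).1 hkx⟩ hcont.continuousOn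
    set m := |u.ofLp ⬝ᵥ (N *ᵥ u.ofLp)| with hm
    have huu : u.ofLp ⬝ᵥ u.ofLp = 1 := (hsph u.ofLp).2 hu
    have hscale : ∀ (k : ℝ) (y : Fin d → ℝ), |(k • y) ⬝ᵥ (N *ᵥ (k • y))| =
        k * k * |y ⬝ᵥ (N *ᵥ y)| := fun k y => by
      rw [mulVec_smul, smul_dotProduct, dotProduct_smul, smul_eq_mul, smul_eq_mul, ← mul_assoc,
        abs_mul, abs_mul_self]
    have hall : ∀ y : Fin d → ℝ, |y ⬝ᵥ (N *ᵥ y)| ≤ m * (y ⬝ᵥ y) := fun y => by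
      rcases (dot_self_nonneg y).eq_or_lt with h0 | h0
      · rw [dotProduct_self_eq_zero.1 h0.symm]; simp
      · set l := (√(y ⬝ᵥ y))⁻¹ with hl
        have hll : l * l * (y ⬝ᵥ y) = 1 := by
          rw [hl, ← mul_inv, Real.mul_self_sqrt h0.le, inv_mul_cancel₀ h0.ne']
        have hly : (l • y) ⬝ᵥ (l • y) = 1 := by
          rw [smul_dotProduct, dotProduct_smul, smul_eq_mul, smul_eq_mul, ← mul_assoc, hll]
        have h1 : |(l • y) ⬝ᵥ (N *ᵥ (l • y))| ≤ m := hmax ((hsph _).1 hly)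
        rw [hscale] at h1
        calc |y ⬝ᵥ (N *ᵥ y)| = (l * l * |y ⬝ᵥ (N *ᵥ y)|) * (y ⬝ᵥ y) := by
              rw [mul_right_comm, hll, one_mul]
          _ ≤ _ := by gcongr
    have hτm : τ < m := by
      have := hx.trans_le (hall x)
      exact lt_of_mul_lt_mul_right this hx0.le
    refine ⟨(7 / 8 : ℝ) • u, ?_, fun w hw => ?_⟩
    · rw [norm_smul, mem_sphere_zero_iff_norm.1 hu]
      norm_num
    · simp only [hTdef, Set.mem_ofPred_eq, ← dot_symMat, ← hN]
      set e := w - (7 / 8 : ℝ) • u with he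
      have hwe : w = (7 / 8 : ℝ) • u + e := by rw [he]; abel
      have hee : e.ofLp ⬝ᵥ e.ofLp ≤ 1 / 64 := by
        rw [← norm_sq_eq_dot]
        have h1 : ‖e‖ < 1 / 8 := by rwa [he, ← dist_eq_norm]
        nlinarith [norm_nonneg e]
      have hexp : w.ofLp ⬝ᵥ (N *ᵥ w.ofLp) = 49 / 64 * (u.ofLp ⬝ᵥ (N *ᵥ u.ofLp)) +
          14 / 8 * (e.ofLp ⬝ᵥ (N *ᵥ u.ofLp)) + e.ofLp ⬝ᵥ (N *ᵥ e.ofLp) := by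
        have hsw : u.ofLp ⬝ᵥ (N *ᵥ e.ofLp) = e.ofLp ⬝ᵥ (N *ᵥ u.ofLp) := by
          rw [dotProduct_mulVec, ← mulVec_transpose, hN, symMat_transpose, dotProduct_comm]
        rw [hwe]
        simp only [WithLp.ofLp_add, WithLp.ofLp_smul, mulVec_add, mulVec_smul, add_dotProduct,
          dotProduct_add, smul_dotProduct, dotProduct_smul, smul_eq_mul, hsw]
        ring
      -- The vector 8e has length at most 1, so the cross term is at most 14/64 of m. What remains
      -- of the form is at least (49 - 14 - 1)/64 > 1/2 of m.
      have hcross : |(8 : ℝ) * (e.ofLp ⬝ᵥ (N *ᵥ u.ofLp))| ≤ m := by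
        have := abs_dot_symm_le (symMat_transpose g) hall (x := (8 : ℝ) • e.ofLp) (y := u.ofLp)
        rw [smul_dotProduct, smul_dotProduct, dotProduct_smul, huu, smul_eq_mul, smul_eq_mul,
          smul_eq_mul] at this
        nlinarith [hτ.trans hτm]
      have hlast := hall e.ofLp
      have h3 : m * (e.ofLp ⬝ᵥ e.ofLp) ≤ m * (1 / 64) := by gcongr
      obtain ⟨a1, a2⟩ := abs_le.1 hcross
      obtain ⟨b1, b2⟩ := abs_le.1 hlast
      rcases le_total 0 (u.ofLp ⬝ᵥ (N *ᵥ u.ofLp)) with h0 | h0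
      · rw [abs_of_nonneg h0] at hm
        refine le_trans ?_ (le_abs_self _)
        rw [hexp]
        linarith
      · rw [abs_of_nonpos h0] at hm
        refine le_trans ?_ (neg_le_abs _)
        rw [hexp]
        linarith
  · intro w hw
    have hww : (w.ofLp ⬝ᵥ w.ofLp) ^ 2 ≤ 1 := by
      rw [← norm_sq_eq_dot]
      exact pow_le_one₀ (sq_nonneg _) (pow_le_one₀ (norm_nonneg _) hw.le)
    refine (pi_gaussianReal_abs_tail v (triCoeff w.ofLp) (V := 4 * v) (by positivity)
      (half_pos hτ) ?_).trans ?_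
    · calc (v : ℝ) * ∑ p, triCoeff w.ofLp p ^ 2 ≤ v * (4 * (w.ofLp ⬝ᵥ w.ofLp) ^ 2) := by
            gcongr; exact sum_triCoeff_sq_le _
        _ ≤ v * (4 * 1) := by gcongr
        _ = 4 * v := by ring
    · refine ENNReal.ofReal_le_ofReal (le_of_eq ?_)
      congr 3
      field_simp
      norm_num

theorem pi_symMat_frobNorm_tail {v : NNReal} (hv : v ≠ 0) {s : ℝ} (hs : 0 < s) :
    Measure.pi (fun _ : Fin d × Fin d => gaussianReal 0 v) {g | d * s < frobNorm (symMat d g)} ≤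
      ENNReal.ofReal (d * d * (2 * Real.exp (-(s ^ 2 / (2 * v))))) := by
  have h := pi_gaussianReal_coord_tail (ι := Fin d × Fin d) v hv hs
  simp only [Fintype.card_prod, Fintype.card_fin, Nat.cast_mul] at h
  refine (measure_mono fun g hg => ?_).trans h
  by_contra hc
  simp only [Set.mem_ofPred_eq, not_exists, not_le] at hc hg
  refine hg.not_ge ?_
  refine abs_le_of_sq_le_sq' ?_ (by positivity) |>.2
  rw [frobNorm_sq]
  calc ∑ i, ∑ j, symMat d g i j ^ 2 ≤ ∑ _i : Fin d, ∑ _j : Fin d, s ^ 2 :=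
        Finset.sum_le_sum fun i _ => Finset.sum_le_sum fun j _ => by
          rw [← sq_abs]
          gcongr
          exact (hc (min i j, max i j)).le
    _ = (d * s) ^ 2 := by simp; ring

end Concentration

/-! ### Failure probabilities of the rounds and of the whole algorithm. -/

section Accuracy

variable {n d : ℕ}

theorem measure_bind_le {Ω Ω' : Type*} [MeasurableSpace Ω] [MeasurableSpace Ω'] {μ : Measure Ω}
    [IsProbabilityMeasure μ] {κ : Ω → Measure Ω'} (hκ : Measurable κ)
    [∀ x, IsProbabilityMeasure (κ x)] {s : Set Ω'} (hs : MeasurableSet s) {G : Set Ω}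
    (hG : MeasurableSet G) {δ₁ δ₂ : ℝ≥0∞} (h1 : μ Gᶜ ≤ δ₁) (h2 : ∀ x ∈ G, κ x s ≤ δ₂) :
    (μ.bind κ) s ≤ δ₁ + δ₂ := by
  rw [Measure.bind_apply hs hκ.aemeasurable]
  calc ∫⁻ x, κ x s ∂μ ≤ ∫⁻ x, (Gᶜ.indicator (fun _ => 1) x + δ₂) ∂μ := by
        refine lintegral_mono fun x => ?_
        by_cases hx : x ∈ G
        · exact (h2 x hx).trans le_add_self
        · rw [Set.indicator_of_mem (show x ∈ Gᶜ from hx)]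
          exact prob_le_one.trans le_self_add
    _ = μ Gᶜ + δ₂ := by
        rw [lintegral_add_right _ measurable_const, lintegral_indicator hG.compl,
          lintegral_const, lintegral_const]
        simp
    _ ≤ _ := by gcongr

theorem bind_map_left {Ω Ω' Ω'' : Type*} [MeasurableSpace Ω] [MeasurableSpace Ω']
    [MeasurableSpace Ω''] (μ : Measure Ω) {f : Ω → Ω'} (hf : Measurable f)
    {κ : Ω' → Measure Ω''} (hκ : Measurable κ) :
    (μ.map f).bind κ = μ.bind fun x => κ (f x) := by
  rw [Measure.bind, Measure.map_map hκ hf]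
  rfl

theorem measurableSet_sandwich (κ : ℝ) (B : Mat d) :
    MeasurableSet {A : Mat d | Sandwich κ (A * B)} := by
  have h : ∀ x : Fin d → ℝ, Continuous fun A : Mat d =>
      ((A * B)ᵀ *ᵥ x) ⬝ᵥ ((A * B)ᵀ *ᵥ x) := fun x => by
    have : Continuous fun A : Mat d => (A * B)ᵀ *ᵥ x :=
      ((continuous_id.matrix_mul continuous_const).matrix_transpose).matrix_mulVec continuous_const
    exact this.dotProduct this
  have e : {A : Mat d | Sandwich κ (A * B)} =
      ⋂ x : Fin d → ℝ, {A | x ⬝ᵥ x ≤ ((A * B)ᵀ *ᵥ x) ⬝ᵥ ((A * B)ᵀ *ᵥ x)} ∩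
        {A | ((A * B)ᵀ *ᵥ x) ⬝ᵥ ((A * B)ᵀ *ᵥ x) ≤ κ * (x ⬝ᵥ x)} := by
    ext A
    simp only [Set.mem_ofPred_eq, Set.mem_iInter, Set.mem_inter_iff]
    rfl
  rw [e]
  exact (isClosed_iInter fun x => (isClosed_le continuous_const (h x)).inter
    (isClosed_le (h x) continuous_const)).measurableSet

theorem naivePCE_eq_map_symMat (a b ρ β κ : ℝ) (X : Fin n → Vec d) :
    naivePCE a b ρ β κ X = (Measure.pi fun _ : Fin d × Fin d =>
      gaussianReal 0 (Real.toNNReal (noiseStd b ρ β κ n d ^ 2))).map fun h =>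
        psdProj (truncCov (truncRadius a β κ n d) X + symMat d h) := by
  have hm : Measurable fun N => psdProj (truncCov (truncRadius a β κ n d) X + N) :=
    measurable_psdProj.comp (measurable_mat_add measurable_const measurable_id)
  rw [naivePCE_eq, gue_eq, Measure.map_map hm measurable_symMat]
  rfl

theorem measurable_psdProj_add_symMat (T : Mat d) :
    Measurable fun h => psdProj (T + symMat d h) :=
  measurable_psdProj.comp (measurable_mat_add measurable_const measurable_symMat)

theorem noiseStd_eq_mul (b ρ β κ : ℝ) (n d : ℕ) :
    noiseStd b ρ β κ n d = κ * noiseStd b ρ β 1 n d := by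
  unfold noiseStd
  ring

/-- The samples `g` (before multiplication by the square root of the covariance) are typical. -/
def Typical (R w : ℝ) (g : Fin n → Vec d) : Prop :=
  (∀ i, ‖g i‖ ^ 2 ≤ R) ∧ frobNorm (empDev g) ≤ w

theorem measurableSet_typical (R w : ℝ) : MeasurableSet {g : Fin n → Vec d | Typical R w g} := by
  have e : {g : Fin n → Vec d | Typical R w g} =
      (⋂ i, {g | ‖g i‖ ^ 2 ≤ R}) ∩ {g | frobNorm (empDev g) ≤ w} := by
    ext g
    simp [Typical]
  rw [e]
  exact ((isClosed_iInter fun i => isClosed_le (by fun_prop) continuous_const).inter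
    (isClosed_le (continuous_frobNorm.comp continuous_empDev) continuous_const)).measurableSet

/-- Truncation radius, noise and the tolerance κ/1000 all scale linearly in κ, so only the noise
level at κ = 1 enters the bound. -/
theorem weakPPC_failure_le {a b ρ β κ R w : ℝ} {B : Mat d} {g : Fin n → Vec d}
    (hg : Typical R w g) (hw : w ≤ 1 / 100) (hκ : 1000 ≤ κ) (hB : Sandwich κ B)
    (hR : R ≤ truncRadius a β 1 n d) (hσ : noiseStd b ρ β 1 n d ≠ 0) :
    weakPPC a b 20 ρ β κ (applyAll B g)
      {A | Sandwich (7 / 10 * κ) (((11 / 10 : ℝ) • A) * B)}ᶜ ≤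
      ENNReal.ofReal
        (8 ^ d * (2 * Real.exp (-((1 / 1000) ^ 2 / (32 * noiseStd b ρ β 1 n d ^ 2))))) := by
  have hκ0 : 0 < κ := by linarith
  set v := Real.toNNReal (noiseStd b ρ β κ n d ^ 2) with hv
  have hvc : (v : ℝ) = κ ^ 2 * noiseStd b ρ β 1 n d ^ 2 := by
    rw [hv, Real.coe_toNNReal _ (sq_nonneg _), noiseStd_eq_mul, mul_pow]
  have hv0 : v ≠ 0 := by
    rw [← NNReal.coe_ne_zero, hvc]
    exact mul_ne_zero (by positivity) (pow_ne_zero _ hσ)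
  have hm : MeasurableSet {A : Mat d | Sandwich (7 / 10 * κ) (((11 / 10 : ℝ) • A) * B)} :=
    (measurable_mat_const_smul (11 / 10 : ℝ) measurable_id) (measurableSet_sandwich _ B)
  have hT : truncCov (truncRadius a β κ n d) (applyAll B g) = B * (1 + empDev g) * Bᵀ := by
    refine truncCov_applyAll hκ0.le (fun x => (hB x).2) hg.1 ?_
    have : truncRadius a β κ n d = κ * truncRadius a β 1 n d := by unfold truncRadius; ring
    rw [this]
    gcongr
  rw [weakPPC_eq, naivePCE_eq_map_symMat, hT,
    Measure.map_map (measurable_weakPrecond 20 κ) (measurable_psdProj_add_symMat _),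
    Measure.map_apply ((measurable_weakPrecond 20 κ).comp (measurable_psdProj_add_symMat _))
      hm.compl]
  have htail := pi_symMat_opNorm_tail (d := d) hv0 (τ := κ / 1000) (by positivity)
  have he : (κ / 1000) ^ 2 / (32 * (v : ℝ)) =
      (1 / 1000) ^ 2 / (32 * noiseStd b ρ β 1 n d ^ 2) := by
    rw [hvc]
    field_simp
  rw [he] at htail
  refine (measure_mono fun h hh => ?_).trans htail
  by_contra hc
  simp only [Set.mem_ofPred_eq, not_exists, not_lt] at hc
  refine hh ?_
  refine hB.round hκ (fun x => ?_) (empDev_transpose g) hc (symMat_transpose h)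
  refine (abs_dot_mulVec_le_frobNorm _ x).trans ?_
  have := dot_self_nonneg x
  gcongr
  exact hg.2.trans hw

/-- The induction varies B and keeps g: the next round sees the dataset of (1.1 A') B with the same
g, so typicality carries over unchanged and only the fresh noise has to be controlled. -/
theorem ppcRounds_failure_le {a b ρ β R w : ℝ} {g : Fin n → Vec d} (hg : Typical R w g)
    (hw : w ≤ 1 / 100) (hR : R ≤ truncRadius a β 1 n d) (hσ : noiseStd b ρ β 1 n d ≠ 0) {δ : ℝ≥0∞}
    (hδ : ENNReal.ofReal
      (8 ^ d * (2 * Real.exp (-((1 / 1000) ^ 2 / (32 * noiseStd b ρ β 1 n d ^ 2))))) ≤ δ)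
    (t : ℕ) : ∀ (κ : ℝ) (B : Mat d), (∀ j < t, 1000 ≤ (7 / 10 : ℝ) ^ j * κ) → Sandwich κ B →
      ppcRounds a b 20 ρ β t κ (applyAll B g) {A | Sandwich ((7 / 10 : ℝ) ^ t * κ) (A * B)}ᶜ ≤
        t * δ := by
  induction t with
  | zero =>
    intro κ B _ hB
    have h : Measure.dirac (1 : Mat d) {A | Sandwich ((7 / 10 : ℝ) ^ 0 * κ) (A * B)}ᶜ = 0 := by
      rw [Measure.dirac_apply' _ (measurableSet_sandwich _ B).compl]
      simp [hB]
    exact h.le.trans zero_le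
  | succ t ih =>
    intro κ B hκ hB
    have h1 := weakPPC_failure_le (a := a) (b := b) (ρ := ρ) (β := β) hg hw
      (by simpa using hκ 0 t.succ_pos) hB hR hσ
    have hm : MeasurableSet {A : Mat d | Sandwich (7 / 10 * κ) (((11 / 10 : ℝ) • A) * B)} :=
      (measurable_mat_const_smul (11 / 10 : ℝ) measurable_id) (measurableSet_sandwich _ B)
    have hp : ∀ A' : Mat d, IsProbabilityMeasure
        ((ppcRounds a b 20 ρ β t (7 / 10 * κ)
          (applyAll ((11 / 10 : ℝ) • A') (applyAll B g))).map
            fun C => C * ((11 / 10 : ℝ) • A')) := fun A' =>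
      Measure.isProbabilityMeasure_map
        (measurable_mat_mul measurable_id measurable_const).aemeasurable
    have := measure_bind_le (μ := weakPPC a b 20 ρ β κ (applyAll B g))
      (measurable_ppcRounds_step a b 20 ρ β (7 / 10 * κ) t (applyAll B g))
      (measurableSet_sandwich ((7 / 10 : ℝ) ^ (t + 1) * κ) B).compl hm (h1.trans hδ)
      (δ₂ := t * δ) fun A' hA' => ?_
    · refine LE.le.trans ?_ (this.trans (le_of_eq ?_))
      · exact le_rfl
      · push_cast
        ring
    · have hmul : Measurable fun C : Mat d => C * ((11 / 10 : ℝ) • A') :=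
        measurable_mat_mul measurable_id measurable_const
      rw [Measure.map_apply hmul (measurableSet_sandwich _ B).compl, applyAll_applyAll]
      have h2 := ih (7 / 10 * κ) (((11 / 10 : ℝ) • A') * B) (fun j hj => by
        have := hκ (j + 1) (by omega)
        rwa [pow_succ, mul_assoc] at this) hA'
      refine le_trans (le_of_eq ?_) h2
      congr 1
      ext C
      simp only [Set.mem_preimage, Set.mem_compl_iff, Set.mem_ofPred_eq, pow_succ, mul_assoc]

theorem Sandwich.mono {κ κ' : ℝ} (h : κ ≤ κ') {B : Mat d} (hB : Sandwich κ B) : Sandwich κ' B :=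
  fun x => ⟨(hB x).1, (hB x).2.trans (by have := dot_self_nonneg x; gcongr)⟩

theorem sqrt_transpose (S : Mat d) : (CFC.sqrt S)ᵀ = CFC.sqrt S := by
  rw [← conjTranspose_eq_transpose_of_trivial]
  exact (CFC.sqrt_nonneg S).isSelfAdjoint

theorem sandwich_sqrt {κ : ℝ} {S : Mat d} (h1 : (S - 1).PosSemidef) (h2 : (κ • 1 - S).PosSemidef) :
    Sandwich κ (CFC.sqrt S) := by
  have hS : S.PosSemidef := by
    have := h1.add (PosSemidef.one (n := Fin d) (R := ℝ))
    rwa [sub_add_cancel] at this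
  intro x
  have e : ((CFC.sqrt S)ᵀ *ᵥ x) ⬝ᵥ ((CFC.sqrt S)ᵀ *ᵥ x) = x ⬝ᵥ (S *ᵥ x) := by
    have := dot_mulVec_transpose ((CFC.sqrt S)ᵀ) 1 x
    rw [one_mulVec] at this
    rw [this, mul_one, transpose_transpose, sqrt_transpose,
      CFC.sqrt_mul_sqrt_self _ (nonneg_iff_posSemidef.2 hS)]
  rw [e]
  have a1 := h1.dotProduct_mulVec_nonneg x
  have a2 := h2.dotProduct_mulVec_nonneg x
  simp only [star_trivial, sub_mulVec, one_mulVec, smul_mulVec, dotProduct_sub, dotProduct_smul,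
    smul_eq_mul] at a1 a2
  exact ⟨by linarith, by linarith⟩

theorem measurableSet_relNorm (S : Mat d) (ε : ℝ) :
    MeasurableSet {M : Mat d | relNorm S (S - M) ≤ ε} := by
  refine (isClosed_le (continuous_frobNorm.comp ?_) continuous_const).measurableSet
  exact (continuous_const.matrix_mul (continuous_const.sub continuous_id)).matrix_mul
    continuous_const

/-- Here s bounds the entries of the noise, so d s bounds its Frobenius norm. -/
theorem pgceStep_failure_le {a b ρ β R w s ε : ℝ} {S A : Mat d} (hS : S.PosSemidef)
    {g : Fin n → Vec d} (hg : Typical R w g) (hA : Sandwich 1000 (A * CFC.sqrt S))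
    (hR : R ≤ truncRadius a β 1 n d) (hσ : noiseStd b ρ β 1000 n d ≠ 0) (hs : 0 < s)
    (hε : w + d * s ≤ ε) :
    pgceStep a b ρ β (applyAll (CFC.sqrt S) g) A {M | relNorm S (S - M) ≤ ε}ᶜ ≤
      ENNReal.ofReal
        (d * d * (2 * Real.exp (-(s ^ 2 / (2 * noiseStd b ρ β 1000 n d ^ 2))))) := by
  set v := Real.toNNReal (noiseStd b ρ β 1000 n d ^ 2) with hv
  have hvc : (v : ℝ) = noiseStd b ρ β 1000 n d ^ 2 := by
    rw [hv, Real.coe_toNNReal _ (sq_nonneg _)]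
  have hv0 : v ≠ 0 := by
    rw [← NNReal.coe_ne_zero, hvc]
    exact pow_ne_zero _ hσ
  have hT : truncCov (truncRadius a β 1000 n d) (applyAll (A * CFC.sqrt S) g) =
      (A * CFC.sqrt S) * (1 + empDev g) * (A * CFC.sqrt S)ᵀ := by
    refine truncCov_applyAll (by norm_num) (fun x => (hA x).2) hg.1 ?_
    have : truncRadius a β 1000 n d = 1000 * truncRadius a β 1 n d := by unfold truncRadius; ring
    rw [this]
    gcongr
  have hc := measurable_conj_inv_right A
  rw [pgceStep, applyAll_applyAll, naivePCE_eq_map_symMat, hT,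
    Measure.map_map hc (measurable_psdProj_add_symMat _),
    Measure.map_apply (hc.comp (measurable_psdProj_add_symMat _))
      (measurableSet_relNorm S ε).compl]
  have htail := pi_symMat_frobNorm_tail (d := d) hv0 hs
  rw [hvc] at htail
  refine (measure_mono fun h hh => ?_).trans htail
  by_contra hcon
  simp only [Set.mem_ofPred_eq, not_lt] at hcon
  refine hh ?_
  refine (relNorm_le hS hA (symMat_transpose h)).trans (le_trans ?_ hε)
  exact add_le_add hg.2 hcon

theorem pi_multivariateGaussian (S : Mat d) :
    (Measure.pi fun _ : Fin n => multivariateGaussian 0 S) =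
      (Measure.pi fun _ : Fin n => stdGaussian (Vec d)).map (applyAll (CFC.sqrt S)) := by
  have h : ∀ x : Vec d, 0 + toEuclideanCLM (𝕜 := ℝ) (CFC.sqrt S) x =
      WithLp.toLp 2 (CFC.sqrt S *ᵥ x.ofLp) := fun x => by
    rw [zero_add]
    rfl
  have hm : Measurable fun x : Vec d =>
      (0 : Vec d) + toEuclideanCLM (𝕜 := ℝ) (CFC.sqrt S) x := by fun_prop
  have := Measure.pi_map_pi (μ := fun _ : Fin n => stdGaussian (Vec d))
    (f := fun _ x => (0 : Vec d) + toEuclideanCLM (𝕜 := ℝ) (CFC.sqrt S) x)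
    (hμ := fun i => by
      have := Measure.isProbabilityMeasure_map (μ := stdGaussian (Vec d)) hm.aemeasurable
      infer_instance) fun i => hm.aemeasurable
  rw [show (fun _ : Fin n => multivariateGaussian (0 : Vec d) S) = fun _ : Fin n =>
    (stdGaussian (Vec d)).map fun x => (0 : Vec d) + toEuclideanCLM (𝕜 := ℝ) (CFC.sqrt S) x from rfl,
    ← this]
  congr 1
  funext x i
  exact h (x i)

theorem log_ratio_pos : 0 < Real.log (10 / 7) := Real.log_pos (by norm_num)

theorem le_of_lt_numRounds {κ : ℝ} (hκ : 0 < κ) {j : ℕ} (hj : j < numRounds κ) :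
    1000 ≤ (7 / 10 : ℝ) ^ j * κ := by
  have h1 := (lt_div_iff₀ log_ratio_pos).1 (Nat.lt_ceil.1 hj)
  rw [← Real.log_pow] at h1
  have h2 := (Real.log_lt_log_iff (by positivity) (by positivity)).1 h1
  rw [lt_div_iff₀ (by norm_num)] at h2
  have h3 : (7 / 10 : ℝ) ^ j * (10 / 7) ^ j = 1 := by rw [← mul_pow]; norm_num
  have h4 : (0 : ℝ) < (7 / 10) ^ j := by positivity
  nlinarith

theorem pow_numRounds_mul_le {κ : ℝ} (hκ : 0 < κ) : (7 / 10 : ℝ) ^ numRounds κ * κ ≤ 1000 := by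
  have h1 := (div_le_iff₀ log_ratio_pos).1 (Nat.le_ceil (Real.log (κ / 1000) / Real.log (10 / 7)))
  rw [← Real.log_pow] at h1
  have h2 := (Real.log_le_log_iff (by positivity) (by positivity)).1 h1
  rw [div_le_iff₀ (by norm_num)] at h2
  change κ ≤ (10 / 7 : ℝ) ^ numRounds κ * 1000 at h2
  have h3 : (7 / 10 : ℝ) ^ numRounds κ * (10 / 7) ^ numRounds κ = 1 := by
    rw [← mul_pow]; norm_num
  have h4 : (0 : ℝ) < (7 / 10) ^ numRounds κ := by positivity
  nlinarith

/-- The failure probability of PGCE, under explicit conditions on the parameters. -/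
theorem pgce_failure_le {a b ρ β κ R w s ε : ℝ} {S : Mat d} (hκ : 0 < κ)
    (h1 : (S - 1).PosSemidef) (h2 : (κ • 1 - S).PosSemidef) (hw : w ≤ 1 / 100) (hs : 0 < s)
    (hε : w + d * s ≤ ε) {δ₁ δ₂ δ₃ : ℝ≥0∞}
    (htyp : Measure.pi (fun _ : Fin n => stdGaussian (Vec d)) {g | Typical R w g}ᶜ ≤ δ₁)
    (hrounds : numRounds κ ≠ 0 →
      R ≤ truncRadius a (β / 2 / numRounds κ) 1 n d ∧
      noiseStd b (ρ / 2 / numRounds κ) (β / 2 / numRounds κ) 1 n d ≠ 0 ∧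
      ENNReal.ofReal (8 ^ d * (2 * Real.exp (-((1 / 1000) ^ 2 /
        (32 * noiseStd b (ρ / 2 / numRounds κ) (β / 2 / numRounds κ) 1 n d ^ 2))))) ≤ δ₂)
    (hR : R ≤ truncRadius a (β / 2) 1 n d) (hσ : noiseStd b (ρ / 2) (β / 2) 1000 n d ≠ 0)
    (hδ₃ : ENNReal.ofReal (d * d * (2 * Real.exp
      (-(s ^ 2 / (2 * noiseStd b (ρ / 2) (β / 2) 1000 n d ^ 2))))) ≤ δ₃) :
    ((Measure.pi fun _ : Fin n => multivariateGaussian 0 S).bind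
      (fun X => pgce a b 20 ρ β κ X)) {M | relNorm S (S - M) ≤ ε}ᶜ ≤
      δ₁ + (numRounds κ * δ₂ + δ₃) := by
  have hS : S.PosSemidef := by
    have := h1.add (PosSemidef.one (n := Fin d) (R := ℝ))
    rwa [sub_add_cancel] at this
  have happ : Measurable (applyAll (CFC.sqrt S) : (Fin n → Vec d) → (Fin n → Vec d)) :=
    measurable_applyAll measurable_const measurable_id
  rw [pi_multivariateGaussian, bind_map_left _ happ (measurable_pgce _ _ _ _ _ _)]
  have hpg : Measurable fun g : Fin n → Vec d => pgce a b 20 ρ β κ (applyAll (CFC.sqrt S) g) :=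
    (measurable_pgce _ _ _ _ _ _).comp happ
  refine measure_bind_le hpg (measurableSet_relNorm S ε).compl (measurableSet_typical R w) htyp fun g hg => ?_
  rw [pgce_eq]
  refine measure_bind_le (measurable_pgceStep _ _ _ _ _) (measurableSet_relNorm S ε).compl
    (measurableSet_sandwich ((7 / 10 : ℝ) ^ numRounds κ * κ) (CFC.sqrt S)) ?_ fun A hA => ?_
  -- With no rounds the preconditioner is the identity, and the per-round parameters would be
  -- divisions by zero.
  · by_cases hT : numRounds κ = 0
    · rw [ppc, hT]
      have h : Measure.dirac (1 : Mat d)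
          {A | Sandwich ((7 / 10 : ℝ) ^ 0 * κ) (A * CFC.sqrt S)}ᶜ = 0 := by
        rw [Measure.dirac_apply' _ (measurableSet_sandwich _ _).compl]
        simp [sandwich_sqrt h1 h2]
      exact h.le.trans zero_le
    · obtain ⟨hR', hσ', hδ'⟩ := hrounds hT
      exact ppcRounds_failure_le hg hw hR' hσ' hδ' _ κ _
        (fun j hj => le_of_lt_numRounds hκ hj) (sandwich_sqrt h1 h2)
  · exact (pgceStep_failure_le hS hg (Sandwich.mono (pow_numRounds_mul_le hκ) hA) hR hσ hs
      hε).trans hδ₃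

end Accuracy

/-! ### From the sample bound to inequalities with log n. -/

section SampleSize

/-- With r = y^{1/4} one has log y ≤ 4r, so log² y ≤ 16 √y, which is a small fraction of y for large
y. This absorbs the logarithm of n. -/
theorem sq_add_log_le {u y : ℝ} (hu : 1 ≤ u) (hy : 10 ^ 20 * u ^ 2 ≤ y) :
    4 * 10 ^ 6 * (u + Real.log y) ^ 2 ≤ y := by
  have hu2 : 1 ≤ u ^ 2 := one_le_pow₀ hu
  have hy0 : 0 < y := by linarith
  set r := √(√y) with hr
  have hr0 : 0 < r := Real.sqrt_pos.2 (Real.sqrt_pos.2 hy0)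
  have hr4 : r ^ 4 = y := by
    rw [show r ^ 4 = (r ^ 2) ^ 2 by ring, hr, Real.sq_sqrt (Real.sqrt_nonneg _),
      Real.sq_sqrt hy0.le]
  have hr2 : 10 ^ 10 ≤ r ^ 2 := by
    rw [hr, Real.sq_sqrt (Real.sqrt_nonneg _)]
    exact Real.le_sqrt_of_sq_le (by linarith)
  have hlog : Real.log y ≤ 4 * r := by
    rw [← hr4, Real.log_pow]
    have := Real.log_le_self hr0.le
    push_cast
    linarith
  have hlog0 : 0 ≤ Real.log y := Real.log_nonneg (by linarith)
  have h1 : Real.log y ^ 2 ≤ 16 * r ^ 2 := by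
    calc Real.log y ^ 2 ≤ (4 * r) ^ 2 := by gcongr
      _ = _ := by ring
  have h2 : 10 ^ 10 * r ^ 2 ≤ y := by
    rw [← hr4]
    nlinarith
  nlinarith [sq_nonneg (u - Real.log y)]

theorem log_le_log_one_add {x : ℝ} (hx : 0 < x) : Real.log x ≤ Real.log (1 + x) :=
  Real.log_le_log hx (by linarith)

theorem rpow_three_halves_sq (d : ℕ) : ((d : ℝ) ^ (3 / 2 : ℝ)) ^ 2 = (d : ℝ) ^ 3 := by
  rw [← Real.rpow_natCast, ← Real.rpow_mul (Nat.cast_nonneg d), ← Real.rpow_natCast]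
  norm_num

theorem log_eight_le : Real.log 8 ≤ 3 := by
  rw [show (8 : ℝ) = 2 ^ 3 by norm_num, Real.log_pow]
  have := Real.log_le_sub_one_of_pos (show (0 : ℝ) < 2 by norm_num)
  push_cast
  linarith

/-- The third term of the sample complexity controls the noise of the preconditioning rounds. -/
theorem rounds_sample_size {d n : ℕ} {ρ β l T : ℝ} (hd : 1 ≤ d) (hρ : 0 < ρ) (hβ : 0 < β)
    (hβ1 : β ≤ 1) (hl : 1 ≤ l) (hT : 1 ≤ T) (hTl : T ≤ 4 * l)
    (hn : 10 ^ 20 * ((d : ℝ) ^ (3 / 2 : ℝ) * √l * polylogFactor 2 (d * l / (min ρ 1 * β)) / √ρ) ≤ n) :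
    96000 * ((d : ℝ) ^ (3 / 2 : ℝ) * √T * Real.log (2 * n * T / β) *
      (3 + Real.log (2 * T / β))) ≤ n * √ρ := by
  have hd' : (1 : ℝ) ≤ d := by exact_mod_cast hd
  set D := (d : ℝ) ^ (3 / 2 : ℝ) with hD
  have hD0 : 0 < D := by positivity
  have hsρ : 0 < √ρ := Real.sqrt_pos.2 hρ
  have hsl : 0 < √l := Real.sqrt_pos.2 (by linarith)
  set m := min ρ 1 with hm
  have hm0 : 0 < m := lt_min hρ one_pos
  have hm1 : m ≤ 1 := min_le_right _ _
  set x := d * l / (m * β) with hx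
  have hx0 : 0 < x := by positivity
  set u := 1 + Real.log (1 + x) with hu
  have hlx : 0 ≤ Real.log (1 + x) := Real.log_nonneg (by linarith)
  have hu1 : 1 ≤ u := by linarith
  -- The sample size in units of its leading term A is y; then log n = log y + log A.
  set A := D * √l / √ρ with hA
  have hA0 : 0 < A := by positivity
  set y := n / A with hy
  have hny : (n : ℝ) = y * A := by rw [hy, div_mul_cancel₀ _ hA0.ne']
  have hyu : 10 ^ 20 * u ^ 2 ≤ y := by
    rw [hy, le_div_iff₀ hA0]
    refine le_trans (le_of_eq ?_) hn
    rw [polylogFactor, hA]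
    ring
  have hu2 : 1 ≤ u ^ 2 := one_le_pow₀ hu1
  have hy0 : 0 < y := by linarith
  have hly : 0 ≤ Real.log y := Real.log_nonneg (by linarith)
  have hlam : Real.log (2 * T / β) ≤ 3 + Real.log (1 + x) := by
    have h1 : 2 * T / β ≤ 8 * x := by
      rw [hx, div_le_iff₀ hβ]
      have : 8 * (d * l / (m * β)) * β = 8 * (d * l / m) := by field_simp
      rw [this]
      have : l ≤ d * l / m := by
        rw [le_div_iff₀ hm0]
        nlinarith
      linarith
    calc Real.log (2 * T / β) ≤ Real.log (8 * x) := Real.log_le_log (by positivity) h1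
      _ = Real.log 8 + Real.log x := Real.log_mul (by norm_num) hx0.ne'
      _ ≤ _ := add_le_add log_eight_le (log_le_log_one_add hx0)
  have hlA : Real.log A ≤ 2 * Real.log (1 + x) := by
    -- Polynomial control of A by x makes log A a multiple of log(1 + x). The minimum of ρ and 1 in
    -- x is what makes this hold also for large ρ.
    have h1 : A ^ 2 ≤ x ^ 3 := by
      have e1 : A ^ 2 = d ^ 3 * l / ρ := by
        rw [hA, div_pow, mul_pow, Real.sq_sqrt (by linarith), Real.sq_sqrt hρ.le,
          rpow_three_halves_sq]
      rw [e1, hx, div_pow, mul_pow, mul_pow]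
      have h2 : l ≤ l ^ 3 := le_self_pow₀ hl (by norm_num)
      have h3 : m ^ 3 * β ^ 3 ≤ ρ := by
        calc m ^ 3 * β ^ 3 ≤ m * 1 := by
              gcongr
              · exact pow_le_of_le_one hm0.le hm1 (by norm_num)
              · exact pow_le_one₀ hβ.le hβ1
          _ ≤ ρ := by rw [mul_one]; exact min_le_left _ _
      gcongr
    have h2 := Real.log_le_log (by positivity) h1
    rw [Real.log_pow, Real.log_pow] at h2
    push_cast at h2
    have := log_le_log_one_add hx0
    linarith
  have hLam : Real.log (2 * n * T / β) ≤ 3 * u + Real.log y := by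
    have e : 2 * n * T / β = y * (A * (2 * T / β)) := by rw [hny]; ring
    rw [e, Real.log_mul hy0.ne' (by positivity), Real.log_mul hA0.ne' (by positivity)]
    rw [hu]
    linarith
  have hLam0 : 0 ≤ 3 * u + Real.log y := by linarith
  have hT4 : √T ≤ 2 * √l := by
    rw [show (2 : ℝ) = √4 by rw [show (4 : ℝ) = 2 ^ 2 by norm_num]; simp, ← Real.sqrt_mul (by norm_num)]
    exact Real.sqrt_le_sqrt hTl
  have hlam0 : 0 ≤ Real.log (2 * T / β) := Real.log_nonneg (by
    rw [le_div_iff₀ hβ]; linarith)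
  have key := sq_add_log_le hu1 hyu
  have hprod : Real.log (2 * n * T / β) * (3 + Real.log (2 * T / β)) ≤
      18 * (u + Real.log y) ^ 2 := by
    calc _ ≤ (3 * u + Real.log y) * (6 * u) := by
          refine mul_le_mul hLam (by linarith) (by linarith) hLam0
      _ ≤ (3 * (u + Real.log y)) * (6 * (u + Real.log y)) := by gcongr <;> linarith
      _ = _ := by ring
  calc _ = 96000 * (D * √T) * (Real.log (2 * n * T / β) * (3 + Real.log (2 * T / β))) := by ring
    _ ≤ 96000 * (D * √T) * (18 * (u + Real.log y) ^ 2) := by gcongr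
    _ ≤ 96000 * (D * (2 * √l)) * (18 * (u + Real.log y) ^ 2) := by gcongr
    _ = D * √l * (3456000 * (u + Real.log y) ^ 2) := by ring
    _ ≤ D * √l * y := by
        gcongr
        nlinarith [sq_nonneg (u + Real.log y)]
    _ = n * √ρ := by
        rw [hny, hA]
        field_simp

/-- The first two terms of the sample complexity control the noise of the final estimate. -/
theorem final_sample_size {d n : ℕ} {ρ β α : ℝ} (hd : 1 ≤ d) (hρ : 0 < ρ) (hβ : 0 < β)
    (hβ1 : β ≤ 1) (hα : 0 < α) (hα1 : α ≤ 1) (hn1 : (d : ℝ) ^ 2 / α ^ 2 ≤ n)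
    (hn : 10 ^ 20 * (d ^ 2 * polylogFactor 2 (d / (α * β * ρ)) / (α * √ρ)) ≤ n) :
    24000 * (d ^ 2 * Real.log (2 * n / β) * (1 + Real.log (2 * d ^ 2 / β))) ≤ α * n * √ρ := by
  have hd' : (1 : ℝ) ≤ d := by exact_mod_cast hd
  have hsρ : 0 < √ρ := Real.sqrt_pos.2 hρ
  set x := d / (α * β * ρ) with hx
  have hx0 : 0 < x := by positivity
  set u := 1 + Real.log (1 + x) with hu
  have hlx : 0 ≤ Real.log (1 + x) := Real.log_nonneg (by linarith)
  have hu1 : 1 ≤ u := by linarith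
  set A := (d : ℝ) ^ 2 / (α * √ρ) with hA
  have hA0 : 0 < A := by positivity
  set y := n / A with hy
  have hny : (n : ℝ) = y * A := by rw [hy, div_mul_cancel₀ _ hA0.ne']
  have hyu : 10 ^ 20 * u ^ 2 ≤ y := by
    rw [hy, le_div_iff₀ hA0]
    refine le_trans (le_of_eq ?_) hn
    rw [polylogFactor, hA]
    ring
  have hu2 : 1 ≤ u ^ 2 := one_le_pow₀ hu1
  have hy0 : 0 < y := by linarith
  have hly : 0 ≤ Real.log y := Real.log_nonneg (by linarith)
  -- Here x contains ρ itself, so a large ρ makes x small and log(1 + x) no longer controls log d.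
  -- The first term of the sample bound compensates: it bounds log ρ by 2 log y.
  have hyρ : √ρ ≤ y := by
    rw [hy, le_div_iff₀ hA0]
    refine le_trans ?_ hn1
    have : √ρ * A = d ^ 2 / α := by rw [hA]; field_simp
    rw [this]
    gcongr
    exact pow_le_of_le_one hα.le hα1 (by norm_num)
  have hlρ : Real.log ρ ≤ 2 * Real.log y := by
    have := Real.log_le_log hsρ hyρ
    rw [Real.log_sqrt hρ.le] at this
    linarith
  have hlogx : Real.log x = Real.log d - Real.log α - Real.log β - Real.log ρ := by
    rw [hx, Real.log_div (by positivity) (by positivity), Real.log_mul (by positivity) hρ.ne',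
      Real.log_mul hα.ne' hβ.ne']
    ring
  have hxl := log_le_log_one_add hx0
  have hlα : Real.log α ≤ 0 := Real.log_nonpos hα.le hα1
  have hlβ : Real.log β ≤ 0 := Real.log_nonpos hβ.le hβ1
  have hl2 : Real.log 2 ≤ 1 := by
    have := Real.log_le_sub_one_of_pos (show (0 : ℝ) < 2 by norm_num)
    linarith
  have hlam : Real.log (2 * d ^ 2 / β) ≤ 1 + 2 * Real.log (1 + x) + 4 * Real.log y := by
    rw [Real.log_div (by positivity) hβ.ne', Real.log_mul (by norm_num) (by positivity),
      Real.log_pow]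
    push_cast
    linarith
  have hLam : Real.log (2 * n / β) ≤ 1 + 2 * Real.log (1 + x) + 4 * Real.log y := by
    clear_value y
    rw [hny, hA, Real.log_div (by positivity) hβ.ne', Real.log_mul (by norm_num) (by positivity),
      Real.log_mul hy0.ne' (by positivity), Real.log_div (by positivity) (by positivity),
      Real.log_mul hα.ne' hsρ.ne', Real.log_sqrt hρ.le, Real.log_pow]
    push_cast
    linarith
  have hlam0 : 0 ≤ Real.log (2 * d ^ 2 / β) := Real.log_nonneg (by
    rw [le_div_iff₀ hβ]; nlinarith)
  have key := sq_add_log_le hu1 hyu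
  have hprod : Real.log (2 * n / β) * (1 + Real.log (2 * d ^ 2 / β)) ≤
      16 * (u + Real.log y) ^ 2 := by
    calc _ ≤ (4 * (u + Real.log y)) * (4 * (u + Real.log y)) := by
          refine mul_le_mul ?_ ?_ (by linarith) (by linarith) <;> linarith
      _ = _ := by ring
  calc _ = 24000 * (d : ℝ) ^ 2 * (Real.log (2 * n / β) * (1 + Real.log (2 * d ^ 2 / β))) := by ring
    _ ≤ 24000 * (d : ℝ) ^ 2 * (16 * (u + Real.log y) ^ 2) := by gcongr
    _ = (d : ℝ) ^ 2 * (384000 * (u + Real.log y) ^ 2) := by ring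
    _ ≤ (d : ℝ) ^ 2 * y := by
        gcongr
        nlinarith [sq_nonneg (u + Real.log y)]
    _ = α * n * √ρ := by
        rw [hny, hA]
        field_simp

end SampleSize

/-! ### Choice of constants. -/

section Parameters

variable {n d : ℕ}

theorem exp_neg_log {z : ℝ} (hz : 0 < z) : Real.exp (-Real.log z) = z⁻¹ := by
  rw [Real.exp_neg, Real.exp_log hz]

/-- With 6 = 2 · 3 the coordinate tail is 2(2n/β)^{-3}, which survives the union over n d
coordinates because d ≤ n. For `empDev`, the assumption on n beats the entropy 4^(d²) and leaves β.
-/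
theorem typical_failure_le {α β : ℝ} (hd : 1 ≤ d) (hβ : 0 < β) (hβ1 : β ≤ 1) (hα : 0 < α)
    (hα1 : α ≤ 1) (hn : 10 ^ 20 * ((d ^ 2 + Real.log (1 / β)) / α ^ 2) ≤ n) :
    Measure.pi (fun _ : Fin n => stdGaussian (Vec d))
      {g | Typical (d * (6 * Real.log (2 * n / β))) (α / 100) g}ᶜ ≤ ENNReal.ofReal (2 * β) := by
  have hd' : (1 : ℝ) ≤ d := by exact_mod_cast hd
  have hlb : 0 ≤ Real.log (1 / β) := Real.log_nonneg (by rw [le_div_iff₀ hβ]; linarith)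
  have hα2 : 0 < α ^ 2 := by positivity
  have hα21 : α ^ 2 ≤ 1 := pow_le_one₀ hα.le hα1
  have hnα : 10 ^ 20 * (d ^ 2 + Real.log (1 / β)) ≤ n * α ^ 2 := by
    rwa [← mul_div_assoc, div_le_iff₀ hα2] at hn
  have hdn : (d : ℝ) ≤ n := by nlinarith
  have hn1 : (1 : ℝ) ≤ n := hd'.trans hdn
  have hn0 : n ≠ 0 := by rintro rfl; norm_num at hn1
  have hz1 : 1 < 2 * n / β := by rw [lt_div_iff₀ hβ]; linarith
  have hz : 0 < 2 * n / β := by linarith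
  have hL : 0 < Real.log (2 * n / β) := Real.log_pos hz1
  set s := √(6 * Real.log (2 * n / β)) with hs
  have hs0 : 0 < s := Real.sqrt_pos.2 (by positivity)
  have hss : s ^ 2 = 6 * Real.log (2 * n / β) := Real.sq_sqrt (by positivity)
  rw [← hss]
  have hsub : {g : Fin n → Vec d | Typical (d * s ^ 2) (α / 100) g}ᶜ ⊆
      {g | ∃ i, d * s ^ 2 < ‖g i‖ ^ 2} ∪ {g | α / 100 < frobNorm (empDev g)} := by
    intro g hg
    by_contra hc
    simp only [Set.mem_union, Set.mem_ofPred_eq, not_or, not_exists, not_lt] at hc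
    exact hg hc
  refine (measure_mono hsub).trans ((measure_union_le _ _).trans ?_)
  rw [two_mul, ENNReal.ofReal_add hβ.le hβ.le]
  refine add_le_add ((pi_stdGaussian_norm_tail n d hs0).trans (ENNReal.ofReal_le_ofReal ?_))
    ((frobNorm_empDev_tail hn0 (by positivity) (by linarith)).trans
      (ENNReal.ofReal_le_ofReal ?_))
  · have e : -(s ^ 2 / 2) = -Real.log ((2 * n / β) ^ 3) := by
      rw [hss, Real.log_pow]; push_cast; ring
    rw [e, exp_neg_log (by positivity)]
    have e2 : (n : ℝ) * (d * (2 * ((2 * n / β) ^ 3)⁻¹)) = d / n * (β ^ 3 / (4 * n)) := by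
      field_simp
      norm_num
    rw [e2]
    calc d / n * (β ^ 3 / (4 * n)) ≤ 1 * (β / 1) := by
          gcongr
          · rwa [div_le_one (by linarith)]
          · exact pow_le_of_le_one hβ.le hβ1 (by norm_num)
          · linarith
      _ = β := by ring
  · have h4 : (4 : ℝ) ^ (d * d) ≤ Real.exp (2 * d ^ 2) := by
      have h5 : (4 : ℝ) ≤ Real.exp 2 := by
        have := Real.add_one_le_exp (1 : ℝ)
        calc (4 : ℝ) ≤ Real.exp 1 * Real.exp 1 := by nlinarith
          _ = Real.exp 2 := by rw [← Real.exp_add]; norm_num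
      calc (4 : ℝ) ^ (d * d) ≤ Real.exp 2 ^ (d * d) := by gcongr
        _ = Real.exp (2 * d ^ 2) := by
            rw [← Real.exp_nat_mul]; push_cast; ring_nf
    calc (4 : ℝ) ^ (d * d) * Real.exp (-(n * (α / 100) ^ 2 / 64))
        ≤ Real.exp (2 * d ^ 2) * Real.exp (-(n * (α / 100) ^ 2 / 64)) := by gcongr
      _ = Real.exp (2 * d ^ 2 + -(n * (α / 100) ^ 2 / 64)) := (Real.exp_add _ _).symm
      _ ≤ Real.exp (-Real.log (1 / β)) := Real.exp_le_exp.2 (by nlinarith)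
      _ = β := by rw [exp_neg_log (by positivity), one_div, inv_inv]

/-- Since 8^d ≤ exp(3d), an exponent of 3d + log(2T/β) is enough for failure β/T per round. -/
theorem rounds_failure_le {σ T β : ℝ} (hσ : σ ≠ 0) (hT : 0 < T) (hβ : 0 < β)
    (h : 32 * 10 ^ 6 * σ ^ 2 * (3 * d + Real.log (2 * T / β)) ≤ 1) :
    (8 : ℝ) ^ d * (2 * Real.exp (-((1 / 1000) ^ 2 / (32 * σ ^ 2)))) ≤ β / T := by
  have hσ2 : 0 < σ ^ 2 := by positivity
  have h1 : 3 * d + Real.log (2 * T / β) ≤ (1 / 1000) ^ 2 / (32 * σ ^ 2) := by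
    rw [le_div_iff₀ (by positivity)]
    linarith
  have h8 : (8 : ℝ) ^ d ≤ Real.exp (3 * d) := by
    have : (8 : ℝ) ≤ Real.exp 3 := (Real.log_le_iff_le_exp (by norm_num)).1 log_eight_le
    calc (8 : ℝ) ^ d ≤ Real.exp 3 ^ d := by gcongr
      _ = _ := by rw [← Real.exp_nat_mul, mul_comm]
  calc (8 : ℝ) ^ d * (2 * Real.exp (-((1 / 1000) ^ 2 / (32 * σ ^ 2))))
      ≤ Real.exp (3 * d) * (2 * Real.exp (-(3 * d + Real.log (2 * T / β)))) := by gcongr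
    _ = 2 * Real.exp (3 * d + -(3 * d + Real.log (2 * T / β))) := by rw [Real.exp_add]; ring
    _ = 2 * (2 * T / β)⁻¹ := by
        rw [← exp_neg_log (by positivity)]
        congr 2
        ring
    _ = β / T := by field_simp

/-- The hypothesis is used squared: σ² = 288 d² T Λ²/(n² ρ), and 32 · 10⁶ · 288 = 96000². The
entropy 3d adds one power of d to d², hence d^{3/2}. -/
theorem rounds_noise_le {ρ β T : ℝ} (hd : 1 ≤ d) (hn : 1 ≤ n) (hρ : 0 < ρ)
    (hβ : 0 < β) (hβ1 : β ≤ 1) (hT : 1 ≤ T)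
    (h : 96000 * ((d : ℝ) ^ (3 / 2 : ℝ) * √T * Real.log (2 * n * T / β) *
      (3 + Real.log (2 * T / β))) ≤ n * √ρ) :
    noiseStd 12 (ρ / 2 / T) (β / 2 / T) 1 n d ≠ 0 ∧
      32 * 10 ^ 6 * noiseStd 12 (ρ / 2 / T) (β / 2 / T) 1 n d ^ 2 *
        (3 * d + Real.log (2 * T / β)) ≤ 1 := by
  have hd' : (1 : ℝ) ≤ d := by exact_mod_cast hd
  have hn' : (1 : ℝ) ≤ n := by exact_mod_cast hn
  have e1 : (n : ℝ) / (β / 2 / T) = 2 * n * T / β := by field_simp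
  have hz : 1 < 2 * n * T / β := by rw [lt_div_iff₀ hβ]; nlinarith
  have hΛ := Real.log_pos hz
  have hlam : 0 ≤ Real.log (2 * T / β) := Real.log_nonneg (by rw [le_div_iff₀ hβ]; linarith)
  set Λ := Real.log (2 * n * T / β) with hΛd
  set l := Real.log (2 * T / β) with hl
  have hr : 0 < √(ρ / 2 / T) := Real.sqrt_pos.2 (by positivity)
  have hσ : noiseStd 12 (ρ / 2 / T) (β / 2 / T) 1 n d =
      12 * (d * 1 * Λ / (n * √(ρ / 2 / T))) := by rw [noiseStd, e1]
  refine ⟨by rw [hσ]; positivity, ?_⟩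
  have hσ2 : noiseStd 12 (ρ / 2 / T) (β / 2 / T) 1 n d ^ 2 =
      288 * d ^ 2 * T * Λ ^ 2 / (n ^ 2 * ρ) := by
    rw [hσ, mul_pow, div_pow, mul_pow (n : ℝ), Real.sq_sqrt (by positivity)]
    field_simp
    norm_num
  rw [hσ2]
  have hsq := pow_le_pow_left₀ (by positivity) h 2
  rw [mul_pow, mul_pow, mul_pow, mul_pow, rpow_three_halves_sq, mul_pow, Real.sq_sqrt (by linarith),
    Real.sq_sqrt hρ.le] at hsq
  have h3 : d ^ 2 * (3 * d + l) ≤ (d : ℝ) ^ 3 * (3 + l) ^ 2 := by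
    have : 3 * d + l ≤ d * (3 + l) ^ 2 := by
      have h31 : 3 + l ≤ (3 + l) ^ 2 := by nlinarith
      calc 3 * d + l ≤ d * (3 + l) := by nlinarith
        _ ≤ d * (3 + l) ^ 2 := by gcongr
    calc (d : ℝ) ^ 2 * (3 * d + l) ≤ d ^ 2 * (d * (3 + l) ^ 2) := by gcongr
      _ = _ := by ring
  have e4 : 32 * 10 ^ 6 * (288 * d ^ 2 * T * Λ ^ 2 / (n ^ 2 * ρ)) * (3 * d + l) =
      96000 ^ 2 * T * Λ ^ 2 * (d ^ 2 * (3 * d + l)) / (n ^ 2 * ρ) := by ring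
  rw [e4, div_le_one (by positivity)]
  refine le_trans ?_ hsq
  calc 96000 ^ 2 * T * Λ ^ 2 * (d ^ 2 * (3 * d + l))
      ≤ 96000 ^ 2 * T * Λ ^ 2 * (d ^ 3 * (3 + l) ^ 2) := by gcongr
    _ = _ := by ring

/-- Entries of size α/d give Frobenius error α. The constant comes from 2 · 288 · 10⁶ = 24000². -/
theorem final_failure_le {ρ β α : ℝ} (hd : 1 ≤ d) (hn : 1 ≤ n) (hρ : 0 < ρ)
    (hβ : 0 < β) (hβ1 : β ≤ 1)
    (h : 24000 * (d ^ 2 * Real.log (2 * n / β) * (1 + Real.log (2 * d ^ 2 / β))) ≤ α * n * √ρ) :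
    noiseStd 12 (ρ / 2) (β / 2) 1000 n d ≠ 0 ∧
      (d : ℝ) * d * (2 * Real.exp
        (-((α / d) ^ 2 / (2 * noiseStd 12 (ρ / 2) (β / 2) 1000 n d ^ 2)))) ≤ β := by
  have hd' : (1 : ℝ) ≤ d := by exact_mod_cast hd
  have hn' : (1 : ℝ) ≤ n := by exact_mod_cast hn
  have e1 : (n : ℝ) / (β / 2) = 2 * n / β := by field_simp
  have hz : 1 < 2 * n / β := by rw [lt_div_iff₀ hβ]; linarith
  have hΛ := Real.log_pos hz
  have hlam : 0 ≤ Real.log (2 * d ^ 2 / β) := Real.log_nonneg (by rw [le_div_iff₀ hβ]; nlinarith)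
  set Λ := Real.log (2 * n / β) with hΛd
  set l := Real.log (2 * d ^ 2 / β) with hl
  have hr : 0 < √(ρ / 2) := Real.sqrt_pos.2 (by positivity)
  have hσ : noiseStd 12 (ρ / 2) (β / 2) 1000 n d =
      12 * (d * 1000 * Λ / (n * √(ρ / 2))) := by rw [noiseStd, e1]
  have hσ0 : noiseStd 12 (ρ / 2) (β / 2) 1000 n d ≠ 0 := by rw [hσ]; positivity
  refine ⟨hσ0, ?_⟩
  have hσ2 : noiseStd 12 (ρ / 2) (β / 2) 1000 n d ^ 2 =
      288000000 * d ^ 2 * Λ ^ 2 / (n ^ 2 * ρ) := by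
    rw [hσ, mul_pow, div_pow, mul_pow (n : ℝ), Real.sq_sqrt (by positivity)]
    field_simp
    norm_num
  have hsq := pow_le_pow_left₀ (by positivity) h 2
  rw [mul_pow, mul_pow, mul_pow, mul_pow, mul_pow, Real.sq_sqrt hρ.le] at hsq
  have hX : l ≤ (α / d) ^ 2 / (2 * noiseStd 12 (ρ / 2) (β / 2) 1000 n d ^ 2) := by
    rw [le_div_iff₀ (by positivity), hσ2, div_pow, le_div_iff₀ (by positivity)]
    have h3 : l ≤ (1 + l) ^ 2 := by nlinarith
    have e4 : l * (2 * (288000000 * d ^ 2 * Λ ^ 2 / (n ^ 2 * ρ))) * d ^ 2 =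
        24000 ^ 2 * ((d ^ 2) ^ 2 * Λ ^ 2 * l) / (n ^ 2 * ρ) := by ring
    rw [e4, div_le_iff₀ (by positivity)]
    calc 24000 ^ 2 * ((d ^ 2) ^ 2 * Λ ^ 2 * l)
        ≤ 24000 ^ 2 * (((d : ℝ) ^ 2) ^ 2 * Λ ^ 2 * (1 + l) ^ 2) := by gcongr
      _ ≤ _ := hsq
      _ = _ := by ring
  calc (d : ℝ) * d * (2 * Real.exp
        (-((α / d) ^ 2 / (2 * noiseStd 12 (ρ / 2) (β / 2) 1000 n d ^ 2))))
      ≤ d * d * (2 * Real.exp (-l)) := by gcongr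
    _ = β := by
        rw [hl, exp_neg_log (by positivity)]
        field_simp

/-- A round takes place only if κ > 1000; then log κ ≥ 1, and the +1 of the ceiling is absorbed by
the subtracted log 1000. -/
theorem numRounds_le {κ : ℝ} (hκ : 0 < κ) (h : numRounds κ ≠ 0) :
    1 ≤ Real.log κ ∧ (numRounds κ : ℝ) ≤ 4 * Real.log κ := by
  have h0 : 0 < Real.log (κ / 1000) / Real.log (10 / 7) := Nat.ceil_pos.1 (Nat.pos_of_ne_zero h)
  have h1 : 0 < Real.log (κ / 1000) := (div_pos_iff_of_pos_right log_ratio_pos).1 h0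
  have h2 : Real.log (κ / 1000) = Real.log κ - Real.log 1000 :=
    Real.log_div hκ.ne' (by norm_num)
  have h3 : 1 ≤ Real.log 1000 := by
    rw [Real.le_log_iff_exp_le (by norm_num)]
    linarith [Real.exp_one_lt_d9]
  have h4 : 3 / 10 ≤ Real.log (10 / 7) := by
    have := Real.one_sub_inv_le_log_of_pos (show (0 : ℝ) < 10 / 7 by norm_num)
    norm_num at this ⊢
    linarith
  have h5 : (numRounds κ : ℝ) < Real.log (κ / 1000) / Real.log (10 / 7) + 1 :=
    Nat.ceil_lt_add_one h0.le
  have h6 : Real.log (κ / 1000) / Real.log (10 / 7) ≤ Real.log (κ / 1000) / (3 / 10) := by gcongr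
  refine ⟨by linarith, ?_⟩
  rw [div_eq_mul_inv _ (3 / 10 : ℝ)] at h6
  norm_num at h6
  linarith

theorem one_le_of_posSemidef {κ : ℝ} {S : Mat d} (hd : 1 ≤ d) (h1 : (S - 1).PosSemidef)
    (h2 : (κ • 1 - S).PosSemidef) : 1 ≤ κ := by
  have a1 := h1.diag_nonneg (i := ⟨0, hd⟩)
  have a2 := h2.diag_nonneg (i := ⟨0, hd⟩)
  simp only [Matrix.sub_apply, Matrix.smul_apply, Matrix.one_apply_eq, smul_eq_mul, mul_one]
    at a1 a2
  linarith

/-- The accuracy of PGCE in positive dimension and for small failure probability. -/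
theorem pgce_accuracy {ρ β κ α : ℝ} (hd : 1 ≤ d) (hρ : 0 < ρ) (hβ : 0 < β) (hβ1 : β ≤ 1)
    (hα : 0 < α) (hα1 : α ≤ 1) (hn : 10 ^ 20 * sampleBound 2 d α β ρ κ ≤ n) {S : Mat d}
    (h1 : (S - 1).PosSemidef) (h2 : (κ • 1 - S).PosSemidef) :
    ((Measure.pi fun _ : Fin n => multivariateGaussian 0 S).bind
      (fun X => pgce 6 12 20 ρ β κ X)) {M | relNorm S (S - M) ≤ 2 * α}ᶜ ≤
      ENNReal.ofReal (4 * β) := by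
  have hd' : (1 : ℝ) ≤ d := by exact_mod_cast hd
  have hκ1 := one_le_of_posSemidef hd h1 h2
  have hκ : 0 < κ := by linarith
  have hlκ : 0 ≤ Real.log κ := Real.log_nonneg hκ1
  have hlb : 0 ≤ Real.log (1 / β) := Real.log_nonneg (by rw [le_div_iff₀ hβ]; linarith)
  have hsρ : 0 < √ρ := Real.sqrt_pos.2 hρ
  have t1 : 0 ≤ (d ^ 2 + Real.log (1 / β)) / α ^ 2 := by positivity
  have t2 : 0 ≤ d ^ 2 * polylogFactor 2 (d / (α * β * ρ)) / (α * √ρ) := by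
    unfold polylogFactor; positivity
  have t3 : 0 ≤ (d : ℝ) ^ (3 / 2 : ℝ) * √(Real.log κ)
        * polylogFactor 2 (d * Real.log κ / (min ρ 1 * β)) / √ρ := by
    unfold polylogFactor; positivity
  rw [sampleBound] at hn
  have n1 : 10 ^ 20 * ((d ^ 2 + Real.log (1 / β)) / α ^ 2) ≤ n := by linarith
  have n2 : 10 ^ 20 * (d ^ 2 * polylogFactor 2 (d / (α * β * ρ)) / (α * √ρ)) ≤ n := by linarith
  have n3 : 10 ^ 20 * ((d : ℝ) ^ (3 / 2 : ℝ) * √(Real.log κ)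
        * polylogFactor 2 (d * Real.log κ / (min ρ 1 * β)) / √ρ) ≤ n := by linarith
  have n4 : (d : ℝ) ^ 2 / α ^ 2 ≤ n := by
    have : (d : ℝ) ^ 2 / α ^ 2 ≤ (d ^ 2 + Real.log (1 / β)) / α ^ 2 := by gcongr; linarith
    linarith
  have n5 : (1 : ℝ) ≤ n := by
    refine le_trans ?_ n4
    rw [le_div_iff₀ (by positivity), one_mul]
    calc α ^ 2 ≤ 1 := pow_le_one₀ hα.le hα1
      _ ≤ d ^ 2 := one_le_pow₀ hd'
  have n6 : 1 ≤ n := by exact_mod_cast n5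
  have hd0 : (0 : ℝ) < d := by linarith
  obtain ⟨hσ, hfin⟩ := final_failure_le hd n6 hρ hβ hβ1
    (final_sample_size hd hρ hβ hβ1 hα hα1 n4 n2)
  have hε : α / 100 + d * (α / d) ≤ 2 * α := by
    rw [mul_div_cancel₀ _ hd0.ne']
    linarith
  have e1 : (n : ℝ) / (β / 2) = 2 * n / β := by field_simp
  have hmain := pgce_failure_le (a := 6) (b := 12) (ρ := ρ) (β := β) (w := α / 100)
    (s := α / d) (ε := 2 * α) (R := d * (6 * Real.log (2 * n / β)))
    (δ₂ := ENNReal.ofReal (β / numRounds κ)) (δ₃ := ENNReal.ofReal β) hκ h1 h2 (by linarith)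
    (by positivity) hε (typical_failure_le hd hβ hβ1 hα hα1 n1) (fun hT => ?_) ?_ hσ
    (ENNReal.ofReal_le_ofReal hfin)
  · refine hmain.trans ?_
    have hT : (numRounds κ : ℝ≥0∞) * ENNReal.ofReal (β / numRounds κ) ≤ ENNReal.ofReal β := by
      rw [← ENNReal.ofReal_natCast, ← ENNReal.ofReal_mul (Nat.cast_nonneg _)]
      refine ENNReal.ofReal_le_ofReal ?_
      rcases Nat.eq_zero_or_pos (numRounds κ) with h0 | h0
      · simp [h0, hβ.le]
      · have h0' : (0 : ℝ) < numRounds κ := by exact_mod_cast h0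
        exact (mul_div_cancel₀ _ h0'.ne').le
    calc _ ≤ ENNReal.ofReal (2 * β) + (ENNReal.ofReal β + ENNReal.ofReal β) := by gcongr
      _ = ENNReal.ofReal (4 * β) := by
          rw [← ENNReal.ofReal_add hβ.le hβ.le, ← ENNReal.ofReal_add (by positivity) (by positivity)]
          ring_nf
  · obtain ⟨l1, l2⟩ := numRounds_le hκ hT
    have hT1 : (1 : ℝ) ≤ numRounds κ := by exact_mod_cast Nat.one_le_iff_ne_zero.2 hT
    obtain ⟨r1, r2⟩ := rounds_noise_le hd n6 hρ hβ hβ1 hT1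
      (rounds_sample_size hd hρ hβ hβ1 l1 hT1 l2 n3)
    refine ⟨?_, r1, ENNReal.ofReal_le_ofReal (rounds_failure_le r1 (by linarith) hβ r2)⟩
    -- Dividing β by the number of rounds only enlarges the truncation radius.
    have hle : 2 * n / β ≤ (n : ℝ) / (β / 2 / numRounds κ) := by
      rw [show (n : ℝ) / (β / 2 / numRounds κ) = 2 * n / β * numRounds κ by field_simp]
      exact le_mul_of_one_le_right (by positivity) hT1
    have := Real.log_le_log (by positivity) hle
    rw [truncRadius, mul_one, ← mul_assoc, mul_comm (d : ℝ) 6, mul_assoc]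
    gcongr
  · rw [truncRadius, e1]
    exact le_of_eq (by ring)

end Parameters

end PrivateGaussian

/-! ### The theorem with explicit constants. -/

theorem mainTheorem4 :
    ∃ a b K : ℝ, 0 < a ∧ 0 < b ∧ 0 < K ∧
      (∀ (d n : ℕ) (ρ β κ : ℝ), 0 < ρ → 0 < β → 0 < κ →
        PrivateGaussian.IsZCDP ρ
          (fun X : Fin n → PrivateGaussian.Vec d => PrivateGaussian.pgce a b K ρ β κ X)) ∧
      ∃ (C : ℝ) (k : ℕ), 0 < C ∧
        ∀ (d n : ℕ) (ρ β κ α : ℝ), 0 < ρ → 0 < β → 0 < κ → 0 < α → α ≤ 1 →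
          C * PrivateGaussian.sampleBound k d α β ρ κ ≤ n →
          ∀ S : PrivateGaussian.Mat d, (S - 1).PosSemidef → (κ • 1 - S).PosSemidef →
            ENNReal.ofReal (1 - C * β) ≤
              ((Measure.pi fun _ : Fin n => multivariateGaussian 0 S).bind
                (fun X => PrivateGaussian.pgce a b K ρ β κ X))
                {M | PrivateGaussian.relNorm S (S - M) ≤ C * α} := by
  -- The value 6 matches the squared norm bound 6 d log(2n/β), 12 = 2 · 6 is what privacy asks, and
  -- 20 is the shrinking factor of `Sandwich.round`.
  refine ⟨6, 12, 20, by norm_num, by norm_num, by norm_num,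
    fun d n ρ β κ hρ _ _ => PrivateGaussian.isZCDP_pgce (by norm_num) (by norm_num) 20 hρ β κ,
    10 ^ 20, 2, by norm_num, fun d n ρ β κ α hρ hβ _ hα hα1 hn S h1 h2 => ?_⟩
  -- A large β makes the claim trivial, so β ≤ 1 may be assumed afterwards.
  rcases le_or_gt 1 (10 ^ 20 * β) with hβ1 | hβ1
  · rw [ENNReal.ofReal_of_nonpos (by linarith)]
    exact zero_le
  set ν := (Measure.pi fun _ : Fin n => multivariateGaussian 0 S).bind
    (fun X => PrivateGaussian.pgce 6 12 20 ρ β κ X) with hν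
  have hprob : IsProbabilityMeasure ν :=
    PrivateGaussian.isProbabilityMeasure_bind' (PrivateGaussian.measurable_pgce _ _ _ _ _ _)
  have hfail : ν {M | PrivateGaussian.relNorm S (S - M) ≤ 10 ^ 20 * α}ᶜ ≤
      ENNReal.ofReal (10 ^ 20 * β) := by
    -- In dimension zero all norms vanish; the estimates need d ≥ 1, for instance to get n ≥ 1.
    rcases Nat.eq_zero_or_pos d with rfl | hd
    · have : {M | PrivateGaussian.relNorm S (S - M) ≤ 10 ^ 20 * α}ᶜ = ∅ := by
        refine Set.compl_empty_iff.2 (Set.eq_univ_of_forall fun M => ?_)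
        simp only [Set.mem_ofPred_eq, PrivateGaussian.relNorm, PrivateGaussian.frobNorm,
          Finset.univ_eq_empty, Finset.sum_empty, Real.sqrt_zero]
        positivity
      rw [this, measure_empty]
      exact zero_le
    · have hsub : {M | PrivateGaussian.relNorm S (S - M) ≤ 10 ^ 20 * α}ᶜ ⊆
          {M | PrivateGaussian.relNorm S (S - M) ≤ 2 * α}ᶜ :=
        Set.compl_subset_compl.2 fun M hM =>
          le_trans (show PrivateGaussian.relNorm S (S - M) ≤ 2 * α from hM) (by linarith)
      exact (measure_mono hsub).trans
        ((PrivateGaussian.pgce_accuracy hd hρ hβ (by linarith) hα hα1 hn h1 h2).trans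
          (ENNReal.ofReal_le_ofReal (by linarith)))
  have hms := PrivateGaussian.measurableSet_relNorm S (10 ^ 20 * α)
  rw [ENNReal.ofReal_sub _ (by positivity), ENNReal.ofReal_one]
  have := prob_compl_eq_one_sub (μ := ν) hms.compl
  rw [compl_compl] at this
  rw [this]
  exact tsub_le_tsub_left hfail 1
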